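/- **Setting.** Let $0<d<D$, $0<\gamma<\Gamma$, $0<h_2\le h_1$, $p_1>0$, $\alpha\in[0,1]$, and let the demands $d_1,d_2,\dots$ be i.i.d. with a density $\phi$ that vanishes outside $[d,D]$ and takes values in $[\gamma,\Gamma]$ on $[d,D]$; let $\Phi$ be its distribution function. Write $x^+=\max\{x,0\}$, $x^-=\max\{-x,0\}$, $\kappa=\frac{h_2+p_1}{h_1+p_1}$, $s_{\max}=D-\frac{h_2}{\Gamma(h_2+p_1)}$, and $F^{-1}(z)=\inf\{x:F(x)\ge z\}$. With $x\sim\phi$ put $G_1(y)=h_1\mathbb E(y-x)^++\alpha p_1\mathbb E(y-x)^-$, $G_2(y)=(1-\alpha)p_1\mathbb E(y-x)^-$, $$H_1(s_1,s_2)=\Phi(s_2)G_1(s_1)+\int_{s_2}^D G_1(s_1+s_2-x)\phi(x)\,dx,$$ $$H_2(s_1,s_2)=h_2\mathbb E(s_2-x)^++\Phi(s_2)G_2(s_1)+\int_{s_2}^D G_2(s_1+s_2-x)\phi(x)\,dx,$$ and $H=H_1+H_2$. Let $(s_1^*,s_2^*)$ be the minimizer of $H$ over $\mathbb R^2$; if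 the minimizer is not unique, assume that $(s_1^*,s_2^*)$ is a minimizer with $s_1^*=\Phi^{-1}(\kappa)$ and $s_2^*\ge 0$. **Dynamics.** With desired levels $s_{t,1},s_{t,2}$ for round $t$, start with $\widehat s_{1,i}=s_{1,i}$ and no delayed shipment ($(o_0-\widehat s_{0,2})^+:=0$), and for $t\ge1$ let $\widetilde s_{t,1}=\widehat s_{t,1}-d_t+(o_{t-1}-\widehat s_{t-1,2})^+$, $o_t=(s_{t+1,1}-\widetilde s_{t,1})^+$, $\widehat s_{t+1,1}=\widetilde s_{t,1}+\min\{\widehat s_{t,2},o_t\}$, $\widetilde s_{t,2}=\widehat s_{t,2}-o_t$, $\widehat s_{t+1,2}=\widetilde s_{t,2}+(s_{t+1,2}-\widetilde s_{t,2})^+$. The loss of round $t$ is $\widetilde H_t=h_1(\widehat s_{t,1}-d_t)^++p_1(\widehat s_{t,1}-d_t)^-+h_2(\widehat s_{t,2}-o_t)^+$, and $\mathrm{Reg}_T=\sum_{t=1}^T(\widetilde H_t-H(s_1^*,s_2^*))$. **Algorithm** (horizon $T\ge 1$, failure probability $\delta$, constants $C_1,c>0$). Epoch $m=1,2,\dots$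 consists of the $L_m=2^{m-1}$ rounds $2^{m-1},\dots,2^m-1$, and both desired levels are constant on it: $s_{t,i}=s_{m,i}$. Agent 1 uses $s_{m,1}=\widehat\Phi_{m-1}^{-1}(\kappa)$, where $\widehat\Phi_m$ is the empirical distribution function of the demands of epoch $m$, and $\widehat\Phi_0$ is that of an arbitrary fixed non-empty finite sample. Agent 2 uses an arbitrary $s_{1,2}\in[b,s_{\max}]$ in epoch $1$. For $m\ge2$, $s_{m,2}=\frac1L\sum_{j=1}^Lx_j$ is the average iterate of projected stochastic gradient descent run on the demands $d_1',\dots,d_L'$ of epoch $m-1$ ($L=L_{m-1}$), with arbitrary $x_1\in[b,s_{\max}]$ and $$x_{j+1}=\min\Big\{s_{\max},\max\Big\{0,\;x_j-\tfrac{c}{\sqrt L}\,m_j\Big\}\Big\},$$ $$m_j=\mathbb I\{d'_{j-1}>x_j\}\big[(h_1+p_1)\mathbb I\{s_{m,1}+x_j-d'_{j-1}\ge d'_j\}-p_1\big]+h_2\mathbb I\{x_j\ge d'_j\}+C_1(h_1+p_1)\sqrt{\tfrac{\log(TD/\delta)}{L}}\;\widehat\Phi_{m-1}(x_j),$$ $d_0'$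 being an arbitrary number and $\sqrt{u}:=0$ for $u<0$. Thus $m_j$ is a stochastic gradient at $x_j$ of the augmented loss $H(s_{m,1},x)+(h_1+p_1)C_1\sqrt{\log(TD/\delta)/L}\int_0^x\Phi$. Here $b$ is an arbitrary fixed real number; the choices of $s_{1,2}$, of $d_0'$ and of the initial iterates (one for each epoch) are deterministic. Let $M$ be the number of epochs that are started within the first $T$ rounds. **Theorem.** There are constants $C>0$ and $k\in\mathbb N$, depending only on $d,D,\gamma,\Gamma,h_1,h_2,p_1,C_1,c,b$ and the initial sample of $\widehat\Phi_0$, such that: 1. $M\le C\log T$ for all $T\ge2$. 2. For all $T\ge1$ and $\delta\in(0,1)$, with probability at least $1-2\delta$, both $$|s_{M,1}-s_1^*|\le C\sqrt{\frac{\log(T/\delta)}{T}}\quad\text{and}\quad|s_{M,2}-s_2^*|\le C\,T^{-1/4}\log^{1/4}(T/\delta).$$ 3. For all $T\ge1$, if the algorithm is run with $\delta=1/T^2$, then $\mathrm{Reg}_T$ is integrable and $\mathbb E[\mathrm{Reg}_T]\le C\sqrt T\,(1+\log T)^k$, that is, $\mathbb E[\mathrm{Reg}_T]\le\widetilde O(\sqrt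 T)$. -/

import Mathlib

open MeasureTheory ProbabilityTheory Set

noncomputable section

namespace TwoEchelon

/-- Numerical data. `d, D` bound the demand, `γ, Γ` bound its density, `h₁, h₂` are the holding
costs and `p₁` is the backorder cost. `C₁` is the constant in the augmentation term of Agent 2's
loss and `c` the constant in the learning rate `c / √L`. -/
structure Params where
  d : ℝ
  D : ℝ
  γ : ℝ
  Γ : ℝ
  h₁ : ℝ
  h₂ : ℝ
  p₁ : ℝ
  C₁ : ℝ
  c : ℝ

/-- The conditions on the numerical data. -/
structure Params.Valid (p : Params) : Prop where
  d_pos : 0 < p.d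
  d_lt_D : p.d < p.D
  γ_pos : 0 < p.γ
  γ_lt_Γ : p.γ < p.Γ
  h₂_pos : 0 < p.h₂
  h₂_le_h₁ : p.h₂ ≤ p.h₁
  p₁_pos : 0 < p.p₁
  C₁_pos : 0 < p.C₁
  c_pos : 0 < p.c

/-- The critical ratio `(h₂ + p₁) / (h₁ + p₁)`. -/
def Params.ratio (p : Params) : ℝ := (p.h₂ + p.p₁) / (p.h₁ + p.p₁)

/-- The upper end of the interval in which Agent 2's level is searched. -/
def Params.sMax (p : Params) : ℝ := p.D - p.h₂ / (p.Γ * (p.h₂ + p.p₁))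

/-! ### The demand distribution and the expected loss of a base-stock policy -/

/-- `φ` is a probability density supported on `[d, D]` with values in `[γ, Γ]` there. -/
structure IsDemandDensity (p : Params) (φ : ℝ → ℝ) : Prop where
  measurable : Measurable φ
  eq_zero : ∀ x, x ∉ Icc p.d p.D → φ x = 0
  mem_Icc : ∀ x ∈ Icc p.d p.D, φ x ∈ Icc p.γ p.Γ
  integral_eq_one : ∫ x, φ x = 1

/-- The distribution with density `φ`. -/
def demandLaw (φ : ℝ → ℝ) : Measure ℝ := volume.withDensity fun x => ENNReal.ofReal (φ x)

/-- The cumulative distribution function of the demand. -/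
def demandCDF (φ : ℝ → ℝ) (x : ℝ) : ℝ := (demandLaw φ).real (Iic x)

/-- Agent 1's expected cost per round with unlimited supply; the share of the backorder
cost that is borne by Agent 1 is `α`. -/
def G₁ (p : Params) (α : ℝ) (φ : ℝ → ℝ) (y : ℝ) : ℝ :=
  p.h₁ * (∫ x, max (y - x) 0 ∂demandLaw φ) + α * p.p₁ * (∫ x, max (-(y - x)) 0 ∂demandLaw φ)

/-- Agent 2's expected backorder cost per round. -/
def G₂ (p : Params) (α : ℝ) (φ : ℝ → ℝ) (y : ℝ) : ℝ :=
  (1 - α) * p.p₁ * (∫ x, max (-(y - x)) 0 ∂demandLaw φ)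

/-- Agent 1's expected loss under the base-stock policy `(s₁, s₂)`. -/
def H₁ (p : Params) (α : ℝ) (φ : ℝ → ℝ) (s₁ s₂ : ℝ) : ℝ :=
  demandCDF φ s₂ * G₁ p α φ s₁ + ∫ x in s₂..p.D, G₁ p α φ (s₁ + s₂ - x) * φ x

/-- Agent 2's expected loss under the base-stock policy `(s₁, s₂)`. -/
def H₂ (p : Params) (α : ℝ) (φ : ℝ → ℝ) (s₁ s₂ : ℝ) : ℝ :=
  p.h₂ * (∫ x, max (s₂ - x) 0 ∂demandLaw φ) + demandCDF φ s₂ * G₂ p α φ s₁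
    + ∫ x in s₂..p.D, G₂ p α φ (s₁ + s₂ - x) * φ x

/-- The overall expected loss under the base-stock policy `(s₁, s₂)`. -/
def H (p : Params) (α : ℝ) (φ : ℝ → ℝ) (s₁ s₂ : ℝ) : ℝ := H₁ p α φ s₁ s₂ + H₂ p α φ s₁ s₂

/-- `(s₁, s₂)` minimizes the overall expected loss over all base-stock policies. -/
def IsMinimizer (p : Params) (α : ℝ) (φ : ℝ → ℝ) (s₁ s₂ : ℝ) : Prop :=
  ∀ a b, H p α φ s₁ s₂ ≤ H p α φ a b

/-! ### Empirical distributions -/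

/-- The empirical distribution function of a sample. -/
def empCDF {n : ℕ} (x : Fin n → ℝ) (z : ℝ) : ℝ := (∑ i, if x i ≤ z then (1 : ℝ) else 0) / n

/-- The generalized inverse `F⁻¹(z) = min {x : F x ≥ z}`. -/
def quantile (F : ℝ → ℝ) (z : ℝ) : ℝ := sInf {x | z ≤ F x}

/-- The best base-stock policy: the minimizer `(s₁, s₂)` of the overall expected loss. If there is
more than one minimizer, the one meant is the one whose first level is the quantile of the
demand at the critical ratio, and its second level must be a nonnegative inventory level. -/
def IsBestPolicy (p : Params) (α : ℝ) (φ : ℝ → ℝ) (s₁ s₂ : ℝ) : Prop :=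
  IsMinimizer p α φ s₁ s₂ ∧
    ((∀ a b, IsMinimizer p α φ a b → a = s₁ ∧ b = s₂) ∨
      (s₁ = quantile (demandCDF φ) p.ratio ∧ 0 ≤ s₂))

/-! ### Agent 2's algorithm: stochastic online gradient descent on the augmented loss -/

/-- The weight `C₁ (h₁ + p₁) √(log (T D / δ) / L)` of the augmentation term. -/
def augWeight (p : Params) (T : ℕ) (δ : ℝ) (L : ℕ) : ℝ :=
  p.C₁ * (p.h₁ + p.p₁) * √(Real.log (T * p.D / δ) / L)

/-- The derivative in the second level `x` of the one-round loss
`h₁ (ŝ - dCur)⁺ + p₁ (ŝ - dCur)⁻ + h₂ (x - dCur)⁺`, where `dPrev`, `dCur` are the previous and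
the current demand, and `ŝ = s₁` if `dPrev ≤ x` and `ŝ = s₁ + x - dPrev` otherwise. -/
def sampleGrad (p : Params) (s₁ x dPrev dCur : ℝ) : ℝ :=
  (if dPrev ≤ x then 0
    else (p.h₁ + p.p₁) * (if dCur ≤ s₁ + x - dPrev then 1 else 0) - p.p₁)
  + p.h₂ * (if dCur ≤ x then 1 else 0)

/-- The iterates of projected stochastic gradient descent on a sample `x 0, …, x (L - 1)`:
`ogdIter … j` is the iterate number `j + 1`. The descent starts in `y`, has learning rate
`c / √L`, and takes `d₀` for the demand that precedes the sample. -/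
def ogdIter (p : Params) (T : ℕ) (δ : ℝ) {L : ℕ} (x : Fin L → ℝ) (y d₀ : ℝ) : ℕ → ℝ
  | 0 => y
  | j + 1 =>
    let z := ogdIter p T δ x y d₀ j
    let dem : ℕ → ℝ := fun i => if h : i < L then x ⟨i, h⟩ else 0
    let dPrev := if j = 0 then d₀ else dem (j - 1)
    let grad := sampleGrad p (quantile (empCDF x) p.ratio) z dPrev (dem j)
      + augWeight p T δ L * empCDF x z
    min p.sMax (max 0 (z - p.c / √L * grad))

/-- The output of Agent 2's algorithm: the average of the first `L` iterates. -/
def ogdOutput (p : Params) (T : ℕ) (δ : ℝ) {L : ℕ} (x : Fin L → ℝ) (y d₀ : ℝ) : ℝ :=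
  (∑ j ∈ Finset.range L, ogdIter p T δ x y d₀ j) / L

/-! ### The central algorithm -/

/-- The length of epoch `m = 1, 2, …`. -/
def epochLength (m : ℕ) : ℕ := 2 ^ (m - 1)

/-- The rounds of epoch `m = 1, 2, …`. -/
def epoch (m : ℕ) : Finset ℕ := Finset.Ico (2 ^ (m - 1)) (2 ^ (m - 1) + epochLength m)

/-- The epoch that contains round `t = 1, 2, …`. Hence `epochOf T` is the number of epochs
that are started within `T` rounds. -/
def epochOf (t : ℕ) : ℕ := Nat.log 2 t + 1

theorem mem_epoch_iff {t m : ℕ} (ht : 1 ≤ t) (hm : 1 ≤ m) : t ∈ epoch m ↔ epochOf t = m := by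
  obtain ⟨k, rfl⟩ : ∃ k, m = k + 1 := ⟨m - 1, by omega⟩
  have := Nat.log_eq_iff (b := 2) (m := k) (n := t) (Or.inr ⟨by norm_num, by omega⟩)
  simp only [epoch, epochLength, epochOf, Finset.mem_Ico, Nat.add_sub_cancel, Nat.add_right_cancel_iff,
    this, pow_succ]
  omega

/-- The demands received in epoch `m`, in their order, when `w t` is the demand of round `t`. -/
def epochSample (w : ℕ → ℝ) (m : ℕ) : Fin (epochLength m) → ℝ := fun i => w (2 ^ (m - 1) + i)

/-- Agent 1's desired level in epoch `m`; `x₀` is the sample of the initial empirical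
distribution function. -/
def level₁ (p : Params) {n₀ : ℕ} (x₀ : Fin n₀ → ℝ) (w : ℕ → ℝ) (m : ℕ) : ℝ :=
  if m ≤ 1 then quantile (empCDF x₀) p.ratio
  else quantile (empCDF (epochSample w (m - 1))) p.ratio

/-- Agent 2's desired level in epoch `m`. The level in epoch 1 is `y₀ 0`, and `y₀ k` is the first
iterate of the descent on the demands of epoch `k`. -/
def level₂ (p : Params) (T : ℕ) (δ : ℝ) (y₀ : ℕ → ℝ) (d₀ : ℝ) (w : ℕ → ℝ) (m : ℕ) : ℝ :=
  if m ≤ 1 then y₀ 0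
  else ogdOutput p T δ (epochSample w (m - 1)) (y₀ (m - 1)) d₀

/-! ### The inventory dynamics -/

/-- The inventory levels of both agents at the start of a round, and the delayed shipment which
Agent 1 receives in that round after serving the demand. -/
structure State where
  inv₁ : ℝ
  inv₂ : ℝ
  late : ℝ

/-- Agent 1's inventory level after demand `dem` and delayed shipment. -/
def State.after₁ (s : State) (dem : ℝ) : ℝ := s.inv₁ - dem + s.late

/-- Agent 1's order, if the desired level for the next round is `next₁`. -/
def State.order (s : State) (dem next₁ : ℝ) : ℝ := max (next₁ - s.after₁ dem) 0

/-- Agent 2's inventory level after Agent 1's order. -/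
def State.after₂ (s : State) (dem next₁ : ℝ) : ℝ := s.inv₂ - s.order dem next₁

/-- One round with demand `dem`, after which the desired levels are `next₁` and `next₂`. -/
def State.step (s : State) (dem next₁ next₂ : ℝ) : State where
  inv₁ := s.after₁ dem + min s.inv₂ (s.order dem next₁)
  inv₂ := s.after₂ dem next₁ + max (next₂ - s.after₂ dem next₁) 0
  late := max (s.order dem next₁ - s.inv₂) 0

/-- The state at the start of round `t = 1, 2, …` (index `0` is not used), for desired levels
`S₁ t`, `S₂ t` and demands `w t`. In round 1 the inventories are the desired ones. -/
def state (S₁ S₂ w : ℕ → ℝ) : ℕ → State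
  | 0 => ⟨S₁ 1, S₂ 1, 0⟩
  | 1 => ⟨S₁ 1, S₂ 1, 0⟩
  | t + 2 => (state S₁ S₂ w (t + 1)).step (w (t + 1)) (S₁ (t + 2)) (S₂ (t + 2))

/-- The loss suffered in round `t`. -/
def roundLoss (p : Params) (S₁ S₂ w : ℕ → ℝ) (t : ℕ) : ℝ :=
  p.h₁ * max ((state S₁ S₂ w t).inv₁ - w t) 0
    + p.p₁ * max (-((state S₁ S₂ w t).inv₁ - w t)) 0
    + p.h₂ * max ((state S₁ S₂ w t).inv₂ - (state S₁ S₂ w t).order (w t) (S₁ (t + 1))) 0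

/-- The regret of the central algorithm over `T` rounds with demands `w` against a benchmark
`Hstar` for the loss per round. -/
def regret (p : Params) {n₀ : ℕ} (x₀ : Fin n₀ → ℝ) (y₀ : ℕ → ℝ) (d₀ : ℝ) (T : ℕ) (δ : ℝ)
    (Hstar : ℝ) (w : ℕ → ℝ) : ℝ :=
  ∑ t ∈ Finset.Icc 1 T,
    (roundLoss p (fun t => level₁ p x₀ w (epochOf t)) (fun t => level₂ p T δ y₀ d₀ w (epochOf t))
      w t - Hstar)

end TwoEchelon

end

/-!
Integrating out the current demand, the expected loss of a base-stock policy `(s₁, s₂)` is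
`avgLoss s₁ s₂ = E [h₂ (s₂ - x)⁺ + g (s₁ - (x - s₂)⁺)]`, where `g` is the expected newsvendor cost;
the share `α` drops out. The quantile `bestLevel₁` solves `g' = h₂` and is the optimal first level
for every sum `s₁ + s₂` (`avgLoss_bestLevel₁_le`). So the first level is learned from an empirical
quantile, and it remains to minimize `x ↦ avgLoss bestLevel₁ x`. This function is convex
(`avgLoss_subgradient`), and since the density is at least `γ` its derivative is strongly monotone
near the minimizer; hence it grows quadratically on bounded sets, with a rate that does not depend
on the density (`exists_quadratic_growth`). An excess loss of order `√(log (T / δ) / L)` thus gives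
a distance of order `(log (T / δ) / L) ^ (1 / 4)` in the second level.

The difficulty lies in the stochastic gradient descent. Its steps use the empirical quantile and the
empirical distribution function of the very sample on which it runs, so its noise is not a martingale
difference sequence. But the empirical distribution function is symmetric in the sample. Given it
and the demands of the first steps, the remaining demands are a random arrangement of the rest
of the sample, so the conditional mean of the next summand is an average over this rest. The
exponential moments of such sums are bounded by exchangeability, and the averages over the rest are
close to the true means by a Dvoretzky-Kiefer-Wolfowitz bound for every tail of the sample
(`measure_not_tailCDF_close_le`). The gradient also pairs an iterate with the preceding demand, on
which this iterate depends; as the iterates move by `O(1 / √L)` per step and the density is bounded,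
this demand may be paired with the iterate before at a small cost. The errors `√(log (T / δ) / j)`
of the tails of length `j` add up to order `√(L log (T / δ))`, as does the regret of the descent, so
the average iterate has an excess loss of order `√(log (T / δ) / L)` (`exists_epoch_bound`).

For the regret, inventories that are too high for newly lowered desired levels are used up at a rate
of at least `d` per round. So after a bounded number of rounds of an epoch the losses are those of
the base-stock policy with the levels of the epoch, which are independent of the current demands
(`algLoss_eq_steadyLoss`). The steady rounds cost `√(log T / t)` each in expectation
(`integral_algLoss_le`), and the other rounds a constant each; as there are `O(log T)` epochs, the
sum is `O(√T (1 + log T))`.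
-/

namespace TwoEchelon

variable {p : Params} {φ : ℝ → ℝ}

/-! ### The demand law and its distribution function -/

namespace IsDemandDensity

theorem nonneg (hp : p.Valid) (hφ : IsDemandDensity p φ) (x : ℝ) : 0 ≤ φ x := by
  by_cases hx : x ∈ Icc p.d p.D
  · exact hp.γ_pos.le.trans (hφ.mem_Icc x hx).1
  · exact (hφ.eq_zero x hx).ge

theorem le_Γ (hp : p.Valid) (hφ : IsDemandDensity p φ) (x : ℝ) : φ x ≤ p.Γ := by
  by_cases hx : x ∈ Icc p.d p.D
  · exact (hφ.mem_Icc x hx).2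
  · rw [hφ.eq_zero x hx]; exact (hp.γ_pos.trans hp.γ_lt_Γ).le

theorem isProbabilityMeasure (hp : p.Valid) (hφ : IsDemandDensity p φ) :
    IsProbabilityMeasure (demandLaw φ) := by
  refine ⟨?_⟩
  have hi : Integrable φ := by
    by_contra h
    have := hφ.integral_eq_one
    rw [integral_undef h] at this
    exact zero_ne_one this
  rw [demandLaw, withDensity_apply _ MeasurableSet.univ, Measure.restrict_univ,
    ← ofReal_integral_eq_lintegral_ofReal hi (Filter.Eventually.of_forall (hφ.nonneg hp)),
    hφ.integral_eq_one, ENNReal.ofReal_one]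

theorem ae_mem_Icc (hφ : IsDemandDensity p φ) : ∀ᵐ x ∂demandLaw φ, x ∈ Icc p.d p.D := by
  rw [ae_iff, show {a | a ∉ Icc p.d p.D} = (Icc p.d p.D)ᶜ from rfl, demandLaw,
    withDensity_apply _ (measurableSet_Icc (a := p.d) (b := p.D)).compl]
  rw [setLIntegral_congr_fun (g := fun _ => 0) measurableSet_Icc.compl]
  · simp
  · intro x hx
    simp [hφ.eq_zero x hx]

theorem integrable_of_continuous (hp : p.Valid) (hφ : IsDemandDensity p φ) {f : ℝ → ℝ}
    (hf : Continuous f) : Integrable f (demandLaw φ) := by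
  have := hφ.isProbabilityMeasure hp
  obtain ⟨K, hK⟩ := (isCompact_Icc (a := p.d) (b := p.D)).exists_bound_of_continuousOn
    hf.continuousOn
  exact Integrable.of_bound hf.aestronglyMeasurable K (hφ.ae_mem_Icc.mono hK)

theorem real_Ioc_le (hp : p.Valid) (hφ : IsDemandDensity p φ) {a b : ℝ} (hab : a ≤ b) :
    (demandLaw φ).real (Ioc a b) ≤ p.Γ * (b - a) := by
  have hΓ : 0 ≤ p.Γ := (hp.γ_pos.trans hp.γ_lt_Γ).le
  have : demandLaw φ (Ioc a b) ≤ ENNReal.ofReal (p.Γ * (b - a)) := by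
    rw [demandLaw, withDensity_apply _ measurableSet_Ioc]
    calc ∫⁻ x in Ioc a b, ENNReal.ofReal (φ x) ≤ ∫⁻ x in Ioc a b, ENNReal.ofReal p.Γ :=
          lintegral_mono fun x => ENNReal.ofReal_le_ofReal (hφ.le_Γ hp x)
      _ = ENNReal.ofReal (p.Γ * (b - a)) := by
          rw [setLIntegral_const, Real.volume_Ioc, ENNReal.ofReal_mul hΓ]
  exact ENNReal.toReal_le_of_le_ofReal (mul_nonneg hΓ (sub_nonneg.2 hab)) this

theorem le_real_Ioc (hp : p.Valid) (hφ : IsDemandDensity p φ) {a b : ℝ} (ha : p.d ≤ a)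
    (hb : b ≤ p.D) : p.γ * (b - a) ≤ (demandLaw φ).real (Ioc a b) := by
  have := hφ.isProbabilityMeasure hp
  have : ENNReal.ofReal (p.γ * (b - a)) ≤ demandLaw φ (Ioc a b) := by
    rw [demandLaw, withDensity_apply _ measurableSet_Ioc]
    calc ENNReal.ofReal (p.γ * (b - a)) = ∫⁻ x in Ioc a b, ENNReal.ofReal p.γ := by
          rw [setLIntegral_const, Real.volume_Ioc, ENNReal.ofReal_mul hp.γ_pos.le]
      _ ≤ ∫⁻ x in Ioc a b, ENNReal.ofReal (φ x) :=
          setLIntegral_mono (hφ.measurable.ennreal_ofReal) fun x hx => ENNReal.ofReal_le_ofReal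
            (hφ.mem_Icc x ⟨ha.trans hx.1.le, hx.2.trans hb⟩).1
  exact (ENNReal.ofReal_le_iff_le_toReal (measure_ne_top _ _)).1 this

end IsDemandDensity

theorem demandCDF_sub (hp : p.Valid) (hφ : IsDemandDensity p φ) {a b : ℝ} (hab : a ≤ b) :
    demandCDF φ b - demandCDF φ a = (demandLaw φ).real (Ioc a b) := by
  have := hφ.isProbabilityMeasure hp
  rw [demandCDF, demandCDF, ← Iic_union_Ioc_eq_Iic hab,
    measureReal_union ((Iic_disjoint_Ioc le_rfl)) measurableSet_Ioc]
  ring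

theorem demandCDF_mono (hp : p.Valid) (hφ : IsDemandDensity p φ) : Monotone (demandCDF φ) := by
  have := hφ.isProbabilityMeasure hp
  exact fun a b hab => measureReal_mono (Iic_subset_Iic.2 hab)

theorem demandCDF_nonneg (x : ℝ) : 0 ≤ demandCDF φ x := measureReal_nonneg

theorem demandCDF_le_one (hp : p.Valid) (hφ : IsDemandDensity p φ) (x : ℝ) :
    demandCDF φ x ≤ 1 := by
  have := hφ.isProbabilityMeasure hp
  exact measureReal_le_one

theorem demandCDF_sub_le (hp : p.Valid) (hφ : IsDemandDensity p φ) {a b : ℝ} (hab : a ≤ b) :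
    demandCDF φ b - demandCDF φ a ≤ p.Γ * (b - a) :=
  (demandCDF_sub hp hφ hab).trans_le (hφ.real_Ioc_le hp hab)

theorem abs_demandCDF_sub_le (hp : p.Valid) (hφ : IsDemandDensity p φ) (a b : ℝ) :
    |demandCDF φ a - demandCDF φ b| ≤ p.Γ * |a - b| := by
  wlog hab : a ≤ b generalizing a b
  · rw [abs_sub_comm, abs_sub_comm a]; exact this b a (le_of_not_ge hab)
  rw [abs_sub_comm, abs_sub_comm a, abs_of_nonneg (sub_nonneg.2 hab),
    abs_of_nonneg (sub_nonneg.2 (demandCDF_mono hp hφ hab))]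
  exact demandCDF_sub_le hp hφ hab

theorem le_demandCDF_sub (hp : p.Valid) (hφ : IsDemandDensity p φ) {a b : ℝ} (ha : p.d ≤ a)
    (hab : a ≤ b) (hb : b ≤ p.D) : p.γ * (b - a) ≤ demandCDF φ b - demandCDF φ a :=
  (hφ.le_real_Ioc hp ha hb).trans_eq (demandCDF_sub hp hφ hab).symm

theorem demandCDF_continuous (hp : p.Valid) (hφ : IsDemandDensity p φ) :
    Continuous (demandCDF φ) := by
  refine (LipschitzWith.of_dist_le_mul (K := p.Γ.toNNReal) fun a b => ?_).continuous
  rw [Real.coe_toNNReal _ (hp.γ_pos.trans hp.γ_lt_Γ).le, Real.dist_eq, Real.dist_eq]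
  exact abs_demandCDF_sub_le hp hφ a b

theorem demandCDF_of_le (hp : p.Valid) (hφ : IsDemandDensity p φ) {x : ℝ} (hx : x ≤ p.d) :
    demandCDF φ x = 0 := by
  -- The law charges only `[d, D]`, so the value is `0` left of `d`; continuity adds the endpoint.
  have h : ∀ y < p.d, demandCDF φ y = 0 := by
    intro y hy
    have : demandLaw φ (Iic y) = 0 := by
      refine measure_mono_null (fun z hz => ?_) (ae_iff.1 hφ.ae_mem_Icc)
      exact fun hz' => absurd (hz'.1.trans hz) (not_le.2 hy)
    rw [demandCDF, Measure.real, this, ENNReal.toReal_zero]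
  refine le_antisymm ?_ (demandCDF_nonneg x)
  refine le_of_forall_pos_le_add fun ε hε => ?_
  have hΓ := hp.γ_pos.trans hp.γ_lt_Γ
  have h1 := demandCDF_sub_le hp hφ (a := p.d - ε / p.Γ) (b := p.d) (by
    have := div_pos hε hΓ; linarith)
  rw [h (p.d - ε / p.Γ) (by have := div_pos hε hΓ; linarith)] at h1
  have h2 : p.Γ * (p.d - (p.d - ε / p.Γ)) = ε := by field_simp; ring
  have := demandCDF_mono hp hφ hx
  linarith

theorem demandCDF_of_ge (hp : p.Valid) (hφ : IsDemandDensity p φ) {x : ℝ} (hx : p.D ≤ x) :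
    demandCDF φ x = 1 := by
  have := hφ.isProbabilityMeasure hp
  rw [demandCDF, Measure.real, (prob_compl_eq_zero_iff measurableSet_Iic).1, ENNReal.toReal_one]
  refine measure_mono_null (fun z hz => ?_) (ae_iff.1 hφ.ae_mem_Icc)
  exact fun hz' => hz (hz'.2.trans hx)

theorem one_le_Γ_mul (hp : p.Valid) (hφ : IsDemandDensity p φ) : 1 ≤ p.Γ * (p.D - p.d) := by
  have := demandCDF_sub_le hp hφ hp.d_lt_D.le
  rwa [demandCDF_of_le hp hφ le_rfl, demandCDF_of_ge hp hφ le_rfl, sub_zero] at this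

theorem integral_indicator_le (x : ℝ) :
    ∫ y, (if y ≤ x then (1 : ℝ) else 0) ∂demandLaw φ = demandCDF φ x := by
  have : (fun y : ℝ => if y ≤ x then (1 : ℝ) else 0) = (Iic x).indicator 1 := by
    ext y; simp [indicator]
  rw [this, integral_indicator_one measurableSet_Iic, demandCDF]

theorem integrable_indicator_le (hp : p.Valid) (hφ : IsDemandDensity p φ) (x : ℝ) :
    Integrable (fun y : ℝ => if y ≤ x then (1 : ℝ) else 0) (demandLaw φ) := by
  have := hφ.isProbabilityMeasure hp
  refine Integrable.of_bound (Measurable.ite measurableSet_Iic measurable_const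
    measurable_const).aestronglyMeasurable 1 (Filter.Eventually.of_forall fun y => ?_)
  split_ifs <;> simp

/-! ### The expected loss as an integral over the demands of two rounds -/

theorem Params.Valid.sum_pos (hp : p.Valid) : 0 < p.h₁ + p.p₁ := by
  have := hp.h₂_pos; have := hp.h₂_le_h₁; have := hp.p₁_pos; linarith

theorem Params.Valid.h₁_pos (hp : p.Valid) : 0 < p.h₁ := hp.h₂_pos.trans_le hp.h₂_le_h₁

theorem Params.Valid.Γ_pos (hp : p.Valid) : 0 < p.Γ := hp.γ_pos.trans hp.γ_lt_Γ

/-- The newsvendor cost `h₁ u⁺ + p₁ u⁻` of ending a round with inventory `u`. -/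
noncomputable def cost (p : Params) (u : ℝ) : ℝ := p.h₁ * max u 0 + p.p₁ * max (-u) 0

/-- The expected newsvendor cost of starting a round with inventory `u`. -/
noncomputable def expCost (p : Params) (φ : ℝ → ℝ) (u : ℝ) : ℝ := ∫ y, cost p (u - y) ∂demandLaw φ

/-- The derivative of the expected newsvendor cost. -/
noncomputable def expCostDeriv (p : Params) (φ : ℝ → ℝ) (u : ℝ) : ℝ :=
  (p.h₁ + p.p₁) * demandCDF φ u - p.p₁

theorem cost_continuous (p : Params) : Continuous (cost p) := by unfold cost; fun_prop

theorem cost_nonneg (hp : p.Valid) (u : ℝ) : 0 ≤ cost p u := by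
  have := hp.h₁_pos; have := hp.p₁_pos
  unfold cost; positivity

theorem abs_cost_sub_le (hp : p.Valid) (u v : ℝ) :
    |cost p u - cost p v| ≤ (p.h₁ + p.p₁) * |u - v| := by
  have h1 := abs_max_sub_max_le_abs u v 0
  have h2 := abs_max_sub_max_le_abs (-u) (-v) 0
  rw [show -u - -v = -(u - v) by ring, abs_neg] at h2
  rw [show cost p u - cost p v = p.h₁ * (max u 0 - max v 0) + p.p₁ * (max (-u) 0 - max (-v) 0) by
    unfold cost; ring]
  refine (abs_add_le _ _).trans ?_
  rw [abs_mul, abs_mul, abs_of_pos hp.h₁_pos, abs_of_pos hp.p₁_pos, add_mul]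
  exact add_le_add (mul_le_mul_of_nonneg_left h1 hp.h₁_pos.le)
    (mul_le_mul_of_nonneg_left h2 hp.p₁_pos.le)

theorem integrable_cost (hp : p.Valid) (hφ : IsDemandDensity p φ) (u : ℝ) :
    Integrable (fun y => cost p (u - y)) (demandLaw φ) :=
  hφ.integrable_of_continuous hp ((cost_continuous p).comp (by fun_prop))

theorem abs_expCost_sub_le (hp : p.Valid) (hφ : IsDemandDensity p φ) (u v : ℝ) :
    |expCost p φ u - expCost p φ v| ≤ (p.h₁ + p.p₁) * |u - v| := by
  have := hφ.isProbabilityMeasure hp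
  rw [expCost, expCost, ← integral_sub (integrable_cost hp hφ u) (integrable_cost hp hφ v)]
  have := norm_integral_le_of_norm_le_const (μ := demandLaw φ) (C := (p.h₁ + p.p₁) * |u - v|)
    (f := fun y => cost p (u - y) - cost p (v - y)) (Filter.Eventually.of_forall fun y => by
      have := abs_cost_sub_le hp (u - y) (v - y)
      rwa [show u - y - (v - y) = u - v by ring] at this)
  simpa using this

theorem expCost_continuous (hp : p.Valid) (hφ : IsDemandDensity p φ) :
    Continuous (expCost p φ) := by
  refine (LipschitzWith.of_dist_le_mul (K := (p.h₁ + p.p₁).toNNReal) fun a b => ?_).continuous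
  rw [Real.coe_toNNReal _ hp.sum_pos.le, Real.dist_eq, Real.dist_eq]
  exact abs_expCost_sub_le hp hφ a b

theorem expCost_eq (hp : p.Valid) (hφ : IsDemandDensity p φ) (α u : ℝ) :
    G₁ p α φ u + G₂ p α φ u = expCost p φ u := by
  simp only [G₁, G₂, expCost, cost]
  rw [integral_add, integral_const_mul, integral_const_mul]
  · ring
  all_goals exact hφ.integrable_of_continuous hp (by fun_prop)

/-- `expCostDeriv` is a subgradient of the convex function `expCost`. -/
theorem expCost_subgradient (hp : p.Valid) (hφ : IsDemandDensity p φ) (u w : ℝ) :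
    expCost p φ w + expCostDeriv p φ w * (u - w) ≤ expCost p φ u := by
  have := hφ.isProbabilityMeasure hp
  have h : expCostDeriv p φ w * (u - w) =
      ∫ y, (((p.h₁ + p.p₁) * if y ≤ w then (1 : ℝ) else 0) - p.p₁) * (u - w) ∂demandLaw φ := by
    rw [integral_mul_const, integral_sub ((integrable_indicator_le hp hφ w).const_mul _)
      (integrable_const _), integral_const_mul, integral_indicator_le]
    simp [expCostDeriv]
  have hi : Integrable (fun y => (((p.h₁ + p.p₁) * if y ≤ w then (1 : ℝ) else 0) - p.p₁) * (u - w))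
      (demandLaw φ) :=
    (((integrable_indicator_le hp hφ w).const_mul _).sub (integrable_const _)).mul_const _
  rw [h, expCost, expCost, ← integral_add (integrable_cost hp hφ w) hi]
  refine integral_mono ((integrable_cost hp hφ w).add hi) (integrable_cost hp hφ u) fun y => ?_
  have h1 := hp.h₁_pos
  have h2 := hp.p₁_pos
  simp only [cost]
  split_ifs with hy
  · rw [max_eq_left (by linarith : (0 : ℝ) ≤ w - y), max_eq_right (by linarith : -(w - y) ≤ 0)]
    have := mul_le_mul_of_nonneg_left (le_max_left (u - y) 0) h1.le
    have := mul_nonneg h2.le (le_max_right (-(u - y)) 0)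
    linarith
  · rw [max_eq_right (by linarith : w - y ≤ 0), max_eq_left (by linarith : 0 ≤ -(w - y))]
    have := mul_le_mul_of_nonneg_left (le_max_left (-(u - y)) 0) h2.le
    have := mul_nonneg h1.le (le_max_right (u - y) 0)
    linarith

theorem expCostDeriv_mono (hp : p.Valid) (hφ : IsDemandDensity p φ) :
    Monotone (expCostDeriv p φ) := fun _ _ h =>
  sub_le_sub_right (mul_le_mul_of_nonneg_left (demandCDF_mono hp hφ h) hp.sum_pos.le) _

theorem expCostDeriv_continuous (hp : p.Valid) (hφ : IsDemandDensity p φ) :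
    Continuous (expCostDeriv p φ) :=
  (continuous_const.mul (demandCDF_continuous hp hφ)).sub continuous_const

theorem abs_expCostDeriv_sub_le (hp : p.Valid) (hφ : IsDemandDensity p φ) (a b : ℝ) :
    |expCostDeriv p φ a - expCostDeriv p φ b| ≤ (p.h₁ + p.p₁) * p.Γ * |a - b| := by
  rw [expCostDeriv, expCostDeriv, show ∀ x y z w : ℝ, x * y - z - (x * w - z) = x * (y - w) by
    intros; ring, abs_mul, abs_of_pos hp.sum_pos, mul_assoc]
  exact mul_le_mul_of_nonneg_left (abs_demandCDF_sub_le hp hφ a b) hp.sum_pos.le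

/-- The expected loss of one round in the steady state of the policy `(s₁, s₂)`, given that the
demand of the previous round was `x`. -/
noncomputable def condLoss (p : Params) (φ : ℝ → ℝ) (s₁ s₂ x : ℝ) : ℝ :=
  p.h₂ * max (s₂ - x) 0 + expCost p φ (s₁ - max (x - s₂) 0)

theorem condLoss_continuous (hp : p.Valid) (hφ : IsDemandDensity p φ) (s₁ s₂ : ℝ) :
    Continuous (condLoss p φ s₁ s₂) := by
  have := expCost_continuous hp hφ
  unfold condLoss; fun_prop

theorem integrable_condLoss (hp : p.Valid) (hφ : IsDemandDensity p φ) (s₁ s₂ : ℝ) :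
    Integrable (condLoss p φ s₁ s₂) (demandLaw φ) :=
  hφ.integrable_of_continuous hp (condLoss_continuous hp hφ s₁ s₂)

theorem intervalIntegral_mul_density (hp : p.Valid) (hφ : IsDemandDensity p φ) (f : ℝ → ℝ)
    (s : ℝ) : ∫ x in s..p.D, f x * φ x = ∫ x in Ioi s, f x ∂demandLaw φ := by
  have h : ∫ x in Ioi s, f x ∂demandLaw φ = ∫ x in Ioi s, f x * φ x := by
    rw [demandLaw, restrict_withDensity measurableSet_Ioi,
      integral_withDensity_eq_integral_toReal_smul hφ.measurable.ennreal_ofReal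
        (Filter.Eventually.of_forall fun _ => ENNReal.ofReal_lt_top)]
    refine integral_congr_ae (Filter.Eventually.of_forall fun x => ?_)
    simp only [smul_eq_mul, ENNReal.toReal_ofReal (hφ.nonneg hp x)]
    ring
  rw [h]
  rcases le_total s p.D with hs | hs
  · rw [intervalIntegral.integral_of_le hs]
    refine (setIntegral_eq_of_subset_of_forall_sdiff_eq_zero measurableSet_Ioi
      Ioc_subset_Ioi_self fun x hx => ?_).symm
    rw [hφ.eq_zero x fun h' => hx.2 ⟨hx.1, h'.2⟩, mul_zero]
  · rw [intervalIntegral.integral_of_ge hs, setIntegral_eq_zero_of_forall_eq_zero,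
      setIntegral_eq_zero_of_forall_eq_zero, neg_zero]
    · intro x hx
      rw [hφ.eq_zero x fun h' => absurd h'.2 (not_le.2 (hs.trans_lt hx)), mul_zero]
    · intro x hx
      rw [hφ.eq_zero x fun h' => absurd h'.2 (not_le.2 hx.1), mul_zero]

theorem H_eq_integral (hp : p.Valid) (hφ : IsDemandDensity p φ) (α s₁ s₂ : ℝ) :
    H p α φ s₁ s₂ = ∫ x, condLoss p φ s₁ s₂ x ∂demandLaw φ := by
  have := hφ.isProbabilityMeasure hp
  have hG := expCost_continuous hp hφ
  have hG1 : Continuous (G₁ p α φ) ∧ Continuous (G₂ p α φ) := by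
    have hA : Continuous fun y => ∫ x, max (-(y - x)) 0 ∂demandLaw φ := by
      refine (LipschitzWith.of_dist_le_mul (K := 1) fun a b => ?_).continuous
      rw [Real.dist_eq, Real.dist_eq, ← integral_sub
        (hφ.integrable_of_continuous hp (by fun_prop))
        (hφ.integrable_of_continuous hp (by fun_prop))]
      have := norm_integral_le_of_norm_le_const (μ := demandLaw φ) (C := |a - b|)
        (f := fun y => max (-(a - y)) 0 - max (-(b - y)) 0) (Filter.Eventually.of_forall fun y => by
          have := abs_max_sub_max_le_abs (-(a - y)) (-(b - y)) 0
          rwa [show -(a - y) - -(b - y) = -(a - b) by ring, abs_neg] at this)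
      simpa using this
    have h2 : Continuous (G₂ p α φ) := continuous_const.mul hA
    refine ⟨?_, h2⟩
    have : G₁ p α φ = fun u => expCost p φ u - G₂ p α φ u := by
      ext u; rw [← expCost_eq hp hφ α u]; ring
    rw [this]; exact hG.sub h2
  have hi : Integrable (fun x => expCost p φ (s₁ - max (x - s₂) 0)) (demandLaw φ) :=
    hφ.integrable_of_continuous hp (by fun_prop)
  have e1 : ∫ x, condLoss p φ s₁ s₂ x ∂demandLaw φ
      = p.h₂ * (∫ x, max (s₂ - x) 0 ∂demandLaw φ)
        + ((∫ x in Iic s₂, expCost p φ (s₁ - max (x - s₂) 0) ∂demandLaw φ)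
        + ∫ x in Ioi s₂, expCost p φ (s₁ - max (x - s₂) 0) ∂demandLaw φ) := by
    unfold condLoss
    rw [integral_add (hφ.integrable_of_continuous hp (by fun_prop)) hi, integral_const_mul,
      ← integral_add_compl measurableSet_Iic hi, compl_Iic]
  have e2 : ∫ x in Iic s₂, expCost p φ (s₁ - max (x - s₂) 0) ∂demandLaw φ
      = demandCDF φ s₂ * expCost p φ s₁ := by
    rw [setIntegral_congr_fun (g := fun _ => expCost p φ s₁) measurableSet_Iic]
    · rw [setIntegral_const, smul_eq_mul, demandCDF]
    · intro x hx
      simp only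
      rw [max_eq_right (sub_nonpos.2 hx), sub_zero]
  have e3 : ∫ x in Ioi s₂, expCost p φ (s₁ - max (x - s₂) 0) ∂demandLaw φ
      = (∫ x in s₂..p.D, G₁ p α φ (s₁ + s₂ - x) * φ x)
        + ∫ x in s₂..p.D, G₂ p α φ (s₁ + s₂ - x) * φ x := by
    have hj : ∀ {g : ℝ → ℝ}, Continuous g →
        IntegrableOn (fun x => g (s₁ + s₂ - x)) (Ioi s₂) (demandLaw φ) := fun hg =>
      (hφ.integrable_of_continuous hp (hg.comp (by fun_prop))).integrableOn
    rw [intervalIntegral_mul_density hp hφ, intervalIntegral_mul_density hp hφ,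
      ← integral_add (hj hG1.1) (hj hG1.2)]
    refine setIntegral_congr_fun measurableSet_Ioi fun x hx => ?_
    rw [expCost_eq hp hφ, max_eq_left (sub_nonneg.2 (le_of_lt hx))]
    congr 1; ring
  rw [e1, e2, e3, H, H₁, H₂, ← expCost_eq hp hφ α]
  ring

/-! ### The best policy -/

theorem Params.Valid.ratio_pos (hp : p.Valid) : 0 < p.ratio :=
  div_pos (add_pos hp.h₂_pos hp.p₁_pos) hp.sum_pos

theorem Params.Valid.ratio_le_one (hp : p.Valid) : p.ratio ≤ 1 :=
  (div_le_one hp.sum_pos).2 (add_le_add_left hp.h₂_le_h₁ _)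

/-- Agent 1's level in the best policy, the quantile of the demand at the critical ratio. -/
noncomputable def bestLevel₁ (p : Params) (φ : ℝ → ℝ) : ℝ := quantile (demandCDF φ) p.ratio

theorem demandCDF_bestLevel₁ (hp : p.Valid) (hφ : IsDemandDensity p φ) :
    demandCDF φ (bestLevel₁ p φ) = p.ratio := by
  have hcont := demandCDF_continuous hp hφ
  have hbdd : BddBelow {x | p.ratio ≤ demandCDF φ x} := by
    refine ⟨p.d, fun x hx => le_of_not_gt fun h => ?_⟩
    have : p.ratio ≤ demandCDF φ x := hx
    rw [demandCDF_of_le hp hφ h.le] at this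
    exact absurd hp.ratio_pos (not_lt.2 this)
  obtain ⟨y, -, hy⟩ := intermediate_value_Icc hp.d_lt_D.le hcont.continuousOn
    (show p.ratio ∈ Icc (demandCDF φ p.d) (demandCDF φ p.D) by
      rw [demandCDF_of_le hp hφ le_rfl, demandCDF_of_ge hp hφ le_rfl]
      exact ⟨hp.ratio_pos.le, hp.ratio_le_one⟩)
  refine le_antisymm ?_ ?_
  · rw [← hy]
    exact demandCDF_mono hp hφ (csInf_le hbdd hy.ge)
  · exact (isClosed_le continuous_const hcont).csInf_mem ⟨y, hy.ge⟩ hbdd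

theorem bestLevel₁_le (hp : p.Valid) (hφ : IsDemandDensity p φ) : bestLevel₁ p φ ≤ p.D := by
  refine csInf_le ⟨p.d, fun x hx => le_of_not_gt fun h => ?_⟩ ?_
  · have : p.ratio ≤ demandCDF φ x := hx
    rw [demandCDF_of_le hp hφ h.le] at this
    exact absurd hp.ratio_pos (not_lt.2 this)
  · change p.ratio ≤ _
    rw [demandCDF_of_ge hp hφ le_rfl]; exact hp.ratio_le_one

theorem le_sub_of_le_demandCDF (hp : p.Valid) (hφ : IsDemandDensity p φ) {x q : ℝ} (hq : 0 < q)
    (h : q ≤ demandCDF φ x) : q / p.Γ ≤ x - p.d := by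
  have hx : p.d ≤ x := le_of_not_gt fun h' => by
    rw [demandCDF_of_le hp hφ h'.le] at h; exact absurd hq (not_lt.2 h)
  have := demandCDF_sub_le hp hφ hx
  rw [demandCDF_of_le hp hφ le_rfl, sub_zero] at this
  rw [div_le_iff₀' hp.Γ_pos]
  exact h.trans this

theorem ratio_div_le_bestLevel₁ (hp : p.Valid) (hφ : IsDemandDensity p φ) :
    p.ratio / p.Γ ≤ bestLevel₁ p φ - p.d :=
  le_sub_of_le_demandCDF hp hφ hp.ratio_pos (demandCDF_bestLevel₁ hp hφ).ge

theorem d_lt_bestLevel₁ (hp : p.Valid) (hφ : IsDemandDensity p φ) : p.d < bestLevel₁ p φ := by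
  have := ratio_div_le_bestLevel₁ hp hφ
  have := div_pos hp.ratio_pos hp.Γ_pos
  linarith

theorem expCostDeriv_bestLevel₁ (hp : p.Valid) (hφ : IsDemandDensity p φ) :
    expCostDeriv p φ (bestLevel₁ p φ) = p.h₂ := by
  rw [expCostDeriv, demandCDF_bestLevel₁ hp hφ, Params.ratio, mul_div_cancel₀ _ hp.sum_pos.ne']
  ring

/-- The expected loss per round of the policy `(s₁, s₂)`, in a form that does not mention how the
backorder cost is shared. -/
noncomputable def avgLoss (p : Params) (φ : ℝ → ℝ) (s₁ s₂ : ℝ) : ℝ :=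
  ∫ x, condLoss p φ s₁ s₂ x ∂demandLaw φ

theorem abs_avgLoss_sub_le (hp : p.Valid) (hφ : IsDemandDensity p φ) (s t x : ℝ) :
    |avgLoss p φ s x - avgLoss p φ t x| ≤ (p.h₁ + p.p₁) * |s - t| := by
  have := hφ.isProbabilityMeasure hp
  rw [avgLoss, avgLoss, ← integral_sub (integrable_condLoss hp hφ s x)
    (integrable_condLoss hp hφ t x)]
  have := norm_integral_le_of_norm_le_const (μ := demandLaw φ) (C := (p.h₁ + p.p₁) * |s - t|)
    (f := fun y => condLoss p φ s x y - condLoss p φ t x y)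
    (Filter.Eventually.of_forall fun y => by
      have := abs_expCost_sub_le hp hφ (s - max (y - x) 0) (t - max (y - x) 0)
      rw [show s - max (y - x) 0 - (t - max (y - x) 0) = s - t by ring] at this
      rwa [Real.norm_eq_abs, condLoss, condLoss, add_sub_add_left_eq_sub])
  simpa using this

/-- For a given sum of the two levels it is best to let the first one be `bestLevel₁`: the
inventory of Agent 1 is then kept as close to its best value as the sum allows, for each demand. -/
theorem avgLoss_bestLevel₁_le (hp : p.Valid) (hφ : IsDemandDensity p φ) (s₁ s₂ : ℝ) :
    avgLoss p φ (bestLevel₁ p φ) (s₁ + s₂ - bestLevel₁ p φ) ≤ avgLoss p φ s₁ s₂ := by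
  refine integral_mono (integrable_condLoss hp hφ _ _) (integrable_condLoss hp hφ _ _) fun x => ?_
  set s := bestLevel₁ p φ
  have key : ∀ t u : ℝ, condLoss p φ t u x
      = p.h₂ * (t + u - x - min t (t + u - x)) + expCost p φ (min t (t + u - x)) := by
    intro t u
    have e : t - max (x - u) 0 = min t (t + u - x) := by
      rcases le_total x u with h | h
      · rw [max_eq_right (by linarith), min_eq_left (by linarith)]; ring
      · rw [max_eq_left (by linarith), min_eq_right (by linarith)]; ring
    have e' : max (u - x) 0 = t + u - x - min t (t + u - x) := by
      rcases le_total x u with h | h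
      · rw [max_eq_left (by linarith), min_eq_left (by linarith)]; ring
      · rw [max_eq_right (by linarith), min_eq_right (by linarith)]; ring
    rw [condLoss, e, e']
  simp only
  rw [key, key, show s + (s₁ + s₂ - s) - x = s₁ + s₂ - x by ring]
  set z := s₁ + s₂ - x
  have hsub := expCost_subgradient hp hφ (min s₁ z) (min s z)
  have hd := expCostDeriv_bestLevel₁ hp hφ
  rcases le_total s z with h | h
  · rw [min_eq_left h] at hsub ⊢
    rw [hd] at hsub; linarith
  · rw [min_eq_right h] at hsub ⊢
    have h1 : expCostDeriv p φ z ≤ p.h₂ := hd ▸ expCostDeriv_mono hp hφ h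
    have := mul_le_mul_of_nonpos_right h1 (sub_nonpos.2 (min_le_right s₁ z))
    linarith

theorem avgLoss_shift (hφ : IsDemandDensity p φ) (s₁ : ℝ) {s₂ t : ℝ}
    (h : s₂ ≤ p.d) (ht : 0 ≤ t) : avgLoss p φ (s₁ + t) (s₂ - t) = avgLoss p φ s₁ s₂ := by
  refine integral_congr_ae (hφ.ae_mem_Icc.mono fun x hx => ?_)
  have := hx.1
  simp only [condLoss]
  rw [max_eq_right (by linarith : s₂ - t - x ≤ 0), max_eq_right (by linarith : s₂ - x ≤ 0),
    max_eq_left (by linarith : 0 ≤ x - (s₂ - t)), max_eq_left (by linarith : 0 ≤ x - s₂)]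
  congr 2; ring

theorem IsBestPolicy.isMin {α s₁ s₂ : ℝ} (hp : p.Valid) (hφ : IsDemandDensity p φ)
    (h : IsBestPolicy p α φ s₁ s₂) (a b : ℝ) : avgLoss p φ s₁ s₂ ≤ avgLoss p φ a b := by
  have := h.1 a b
  rwa [H_eq_integral hp hφ, H_eq_integral hp hφ] at this

theorem IsBestPolicy.eq_and_nonneg {α s₁ s₂ : ℝ} (hp : p.Valid) (hφ : IsDemandDensity p φ)
    (h : IsBestPolicy p α φ s₁ s₂) : s₁ = bestLevel₁ p φ ∧ 0 ≤ s₂ := by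
  rcases h.2 with hu | hu
  · have hH : ∀ a b, avgLoss p φ a b ≤ avgLoss p φ s₁ s₂ → a = s₁ ∧ b = s₂ := by
      intro a b hab
      refine hu a b fun a' b' => ?_
      rw [H_eq_integral hp hφ, H_eq_integral hp hφ]
      exact hab.trans (h.isMin hp hφ a' b')
    refine ⟨(hH _ _ (avgLoss_bestLevel₁_le hp hφ s₁ s₂)).1.symm, ?_⟩
    by_contra hneg
    -- With `s₂ < 0`, stock can be moved from Agent 2 to Agent 1 without any change of the loss.
    have := (hH _ _ (avgLoss_shift hφ s₁ (t := 1)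
      ((not_le.1 hneg).le.trans hp.d_pos.le) zero_le_one).le).1
    linarith
  · exact hu

/-- The derivative in `x` of the expected loss of the policy `(s, x)`, for `s = bestLevel₁`. -/
noncomputable def lossDeriv (p : Params) (φ : ℝ → ℝ) (x : ℝ) : ℝ :=
  ∫ y, expCostDeriv p φ (bestLevel₁ p φ + min 0 (x - y)) ∂demandLaw φ

theorem integrable_lossDeriv (hp : p.Valid) (hφ : IsDemandDensity p φ) (x : ℝ) :
    Integrable (fun y => expCostDeriv p φ (bestLevel₁ p φ + min 0 (x - y))) (demandLaw φ) :=
  hφ.integrable_of_continuous hp ((expCostDeriv_continuous hp hφ).comp (by fun_prop))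

/-- The expected loss is convex in Agent 2's level if Agent 1's level is `bestLevel₁`. -/
theorem avgLoss_subgradient (hp : p.Valid) (hφ : IsDemandDensity p φ) (x z : ℝ) :
    avgLoss p φ (bestLevel₁ p φ) z + lossDeriv p φ z * (x - z)
      ≤ avgLoss p φ (bestLevel₁ p φ) x := by
  have hi := (integrable_lossDeriv hp hφ z).mul_const (x - z)
  rw [avgLoss, avgLoss, lossDeriv, ← integral_mul_const,
    ← integral_add (integrable_condLoss hp hφ _ _) hi]
  refine integral_mono ((integrable_condLoss hp hφ _ _).add hi) (integrable_condLoss hp hφ _ _)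
    fun y => ?_
  set s := bestLevel₁ p φ
  have hm : ∀ t : ℝ, -max (y - t) 0 = min 0 (t - y) := fun t => by
    rw [← min_neg_neg, neg_zero, neg_sub, min_comm]
  have hsum : ∀ t : ℝ, max (t - y) 0 = t - y - min 0 (t - y) := fun t => by
    have := max_add_min (t - y) 0
    rw [min_comm] at this; linarith
  simp only [condLoss, sub_eq_add_neg s, hm]
  have h1 := expCost_subgradient hp hφ (s + min 0 (x - y)) (s + min 0 (z - y))
  have hd := expCostDeriv_bestLevel₁ hp hφ
  rcases le_total y z with h | h
  · rw [min_eq_left (by linarith : 0 ≤ z - y), add_zero, hd] at h1 ⊢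
    rw [hsum x, hsum z, min_eq_left (by linarith : 0 ≤ z - y)]
    linarith
  · rw [min_eq_right (by linarith : z - y ≤ 0)] at h1 ⊢
    have h2 : expCostDeriv p φ (s + (z - y)) ≤ p.h₂ :=
      hd ▸ expCostDeriv_mono hp hφ (by linarith)
    have h3 := mul_le_mul_of_nonneg_right h2 (le_max_right (x - y) 0)
    rw [max_eq_right (by linarith : z - y ≤ 0)]
    have h4 := hsum x
    have h5 : expCostDeriv p φ (s + (z - y)) * (x - z)
      = expCostDeriv p φ (s + (z - y)) * max (x - y) 0
        + expCostDeriv p φ (s + (z - y)) * (s + min 0 (x - y) - (s + (z - y))) := by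
      rw [h4]; ring
    linarith

theorem abs_lossDeriv_sub_le (hp : p.Valid) (hφ : IsDemandDensity p φ) (x z : ℝ) :
    |lossDeriv p φ x - lossDeriv p φ z| ≤ (p.h₁ + p.p₁) * p.Γ * |x - z| := by
  have := hφ.isProbabilityMeasure hp
  rw [lossDeriv, lossDeriv, ← integral_sub (integrable_lossDeriv hp hφ x)
    (integrable_lossDeriv hp hφ z)]
  have := norm_integral_le_of_norm_le_const (μ := demandLaw φ)
    (C := (p.h₁ + p.p₁) * p.Γ * |x - z|)
    (f := fun y => expCostDeriv p φ (bestLevel₁ p φ + min 0 (x - y))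
      - expCostDeriv p φ (bestLevel₁ p φ + min 0 (z - y)))
    (Filter.Eventually.of_forall fun y => by
      refine (abs_expCostDeriv_sub_le hp hφ _ _).trans ?_
      refine mul_le_mul_of_nonneg_left ?_ (mul_nonneg hp.sum_pos.le hp.Γ_pos.le)
      rw [add_sub_add_left_eq_sub, min_comm, min_comm 0 (z - y)]
      exact (abs_min_sub_min_le_max _ _ _ _).trans (by simp))
  simpa using this

theorem lossDeriv_eq_zero (hp : p.Valid) (hφ : IsDemandDensity p φ) {z : ℝ}
    (hz : ∀ x, avgLoss p φ (bestLevel₁ p φ) z ≤ avgLoss p φ (bestLevel₁ p φ) x) :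
    lossDeriv p φ z = 0 := by
  have hcont : Continuous (lossDeriv p φ) := by
    refine (LipschitzWith.of_dist_le_mul (K := ((p.h₁ + p.p₁) * p.Γ).toNNReal)
      fun a b => ?_).continuous
    rw [Real.coe_toNNReal _ (mul_pos hp.sum_pos hp.Γ_pos).le, Real.dist_eq, Real.dist_eq]
    exact abs_lossDeriv_sub_le hp hφ a b
  have hs : ∀ x, lossDeriv p φ x * (z - x) ≤ 0 := fun x => by
    have := avgLoss_subgradient hp hφ z x
    linarith [hz x]
  refine le_antisymm ?_ ?_
  · refine le_of_tendsto (hcont.continuousWithinAt (s := Iio z) (x := z)) ?_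
    filter_upwards [self_mem_nhdsWithin] with x hx
    exact nonpos_of_mul_nonpos_left (hs x) (sub_pos.2 hx)
  · refine ge_of_tendsto (hcont.continuousWithinAt (s := Ioi z) (x := z)) ?_
    filter_upwards [self_mem_nhdsWithin] with x hx
    exact nonneg_of_mul_nonpos_left (hs x) (sub_neg.2 hx)

theorem le_sMax_of_isMin (hp : p.Valid) (hφ : IsDemandDensity p φ) {z : ℝ}
    (hz : lossDeriv p φ z = 0) : z ≤ p.sMax := by
  have := hφ.isProbabilityMeasure hp
  -- The derivative is at least `h₂ F(z) - p₁ (1 - F(z))`.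
  have h1 : (p.h₂ + p.p₁) * demandCDF φ z - p.p₁ ≤ lossDeriv p φ z := by
    have e : (p.h₂ + p.p₁) * demandCDF φ z - p.p₁
        = ∫ y, ((p.h₂ + p.p₁) * (if y ≤ z then (1 : ℝ) else 0) - p.p₁) ∂demandLaw φ := by
      rw [integral_sub ((integrable_indicator_le hp hφ z).const_mul _) (integrable_const _),
        integral_const_mul, integral_indicator_le]
      simp
    rw [e]
    refine integral_mono (((integrable_indicator_le hp hφ z).const_mul _).sub (integrable_const _))
      (integrable_lossDeriv hp hφ z) fun y => ?_
    simp only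
    split_ifs with h
    · rw [min_eq_left (by linarith), add_zero, expCostDeriv_bestLevel₁ hp hφ]; linarith
    · have := mul_nonneg hp.sum_pos.le
        (demandCDF_nonneg (φ := φ) (bestLevel₁ p φ + min 0 (z - y)))
      rw [expCostDeriv]; linarith
  rw [hz] at h1
  have hpos : 0 < p.h₂ + p.p₁ := add_pos hp.h₂_pos hp.p₁_pos
  have hzD : z ≤ p.D := by
    by_contra h
    rw [demandCDF_of_ge hp hφ (not_le.1 h).le] at h1
    linarith [hp.h₂_pos]
  have h2 := demandCDF_sub_le hp hφ hzD
  rw [demandCDF_of_ge hp hφ le_rfl] at h2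
  have h3 : p.h₂ / (p.Γ * (p.h₂ + p.p₁)) ≤ p.D - z := by
    rw [div_le_iff₀ (mul_pos hp.Γ_pos hpos)]
    have := mul_le_mul_of_nonneg_right h2 hpos.le
    linarith
  rw [Params.sMax]; linarith

theorem le_bestLevel₁_add_of_isMin (hp : p.Valid) (hφ : IsDemandDensity p φ) {z : ℝ}
    (hz : lossDeriv p φ z = 0) :
    p.p₁ / (p.h₁ + p.p₁) / p.Γ ≤ bestLevel₁ p φ + z - p.d - p.d := by
  have := hφ.isProbabilityMeasure hp
  refine le_sub_of_le_demandCDF hp hφ (div_pos hp.p₁_pos hp.sum_pos) ?_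
  have h1 : lossDeriv p φ z ≤ expCostDeriv p φ (bestLevel₁ p φ + z - p.d) := by
    have e : expCostDeriv p φ (bestLevel₁ p φ + z - p.d)
        = ∫ _, expCostDeriv p φ (bestLevel₁ p φ + z - p.d) ∂demandLaw φ := by simp
    rw [e]
    refine integral_mono_ae (integrable_lossDeriv hp hφ z) (integrable_const _)
      (hφ.ae_mem_Icc.mono fun y hy => expCostDeriv_mono hp hφ ?_)
    linarith [min_le_right 0 (z - y), hy.1]
  rw [hz, expCostDeriv] at h1
  rw [div_le_iff₀ hp.sum_pos]
  linarith

/-- The radius around the best level of Agent 2 in which the derivative of the expected loss is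
strongly monotone. -/
noncomputable def Params.radius (p : Params) : ℝ :=
  min (p.h₂ / (p.Γ * (p.h₂ + p.p₁))) (p.p₁ / (p.h₁ + p.p₁) / p.Γ) / 4

theorem Params.Valid.radius_pos (hp : p.Valid) : 0 < p.radius := by
  have := hp.h₁_pos; have := hp.h₂_pos; have := hp.p₁_pos; have := hp.Γ_pos
  unfold Params.radius; positivity

theorem lossDeriv_strongly_mono (hp : p.Valid) (hφ : IsDemandDensity p φ) {z u v : ℝ}
    (hz : lossDeriv p φ z = 0) (hu : z - p.radius ≤ u) (huv : u ≤ v) (hv : v ≤ z + p.radius) :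
    (p.h₁ + p.p₁) * p.γ ^ 2 * (2 * p.radius) * (v - u) ≤ lossDeriv p φ v - lossDeriv p φ u := by
  have := hφ.isProbabilityMeasure hp
  set s := bestLevel₁ p φ with hs_def
  set τ := p.radius with hτ_def
  have hτ : 0 < τ := hp.radius_pos
  have hmin1 : 4 * τ ≤ p.h₂ / (p.Γ * (p.h₂ + p.p₁)) := by
    rw [hτ_def, Params.radius]
    linarith [min_le_left (p.h₂ / (p.Γ * (p.h₂ + p.p₁))) (p.p₁ / (p.h₁ + p.p₁) / p.Γ)]
  have hmin2 : 4 * τ ≤ p.p₁ / (p.h₁ + p.p₁) / p.Γ := by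
    rw [hτ_def, Params.radius]
    linarith [min_le_right (p.h₂ / (p.Γ * (p.h₂ + p.p₁))) (p.p₁ / (p.h₁ + p.p₁) / p.Γ)]
  have hb1 := le_sMax_of_isMin hp hφ hz
  have hb2 := le_bestLevel₁_add_of_isMin hp hφ hz
  have hb3 := ratio_div_le_bestLevel₁ hp hφ
  have hsD := bestLevel₁_le hp hφ
  rw [Params.sMax] at hb1
  rw [← hs_def] at hb2 hb3 hsD
  have hratio : p.p₁ / (p.h₁ + p.p₁) / p.Γ ≤ p.ratio / p.Γ := by
    rw [Params.ratio]
    have := hp.h₂_pos; have := hp.sum_pos; have := hp.Γ_pos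
    gcongr; linarith
  have hratio1 : p.ratio / p.Γ ≤ p.D - p.d := by
    rw [div_le_iff₀' hp.Γ_pos]
    exact hp.ratio_le_one.trans (one_le_Γ_mul hp hφ)
  -- On the demands between `A` and `B` the integrand moves inside the support of the density.
  set A := max p.d (z + τ) with hA
  set B := min p.D (z + s - p.d - τ) with hB
  have hAB : 2 * τ ≤ B - A := by
    rw [hA, hB]
    rcases max_cases p.d (z + τ) with ⟨h, -⟩ | ⟨h, -⟩ <;>
    rcases min_cases p.D (z + s - p.d - τ) with ⟨h', -⟩ | ⟨h', -⟩ <;>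
    rw [h, h'] <;> linarith
  have hF : ∀ y, (Ioc A B).indicator (fun _ => p.γ * (v - u)) y ≤
      demandCDF φ (s + min 0 (v - y)) - demandCDF φ (s + min 0 (u - y)) := by
    intro y
    by_cases hy : y ∈ Ioc A B
    · rw [indicator_of_mem hy]
      have h1 : z + τ < y := (le_max_right _ _).trans_lt hy.1
      have h2 : y ≤ z + s - p.d - τ := hy.2.trans (min_le_right _ _)
      rw [min_eq_right (by linarith), min_eq_right (by linarith)]
      have := le_demandCDF_sub hp hφ (a := s + (u - y)) (b := s + (v - y)) (by linarith)
        (by linarith) (by linarith)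
      rwa [show s + (v - y) - (s + (u - y)) = v - u by ring] at this
    · rw [indicator_of_notMem hy, sub_nonneg]
      exact demandCDF_mono hp hφ (by gcongr)
  have hint : p.γ * (v - u) * (demandLaw φ).real (Ioc A B) * (p.h₁ + p.p₁)
      ≤ lossDeriv p φ v - lossDeriv p φ u := by
    rw [lossDeriv, lossDeriv, ← integral_sub (integrable_lossDeriv hp hφ v)
      (integrable_lossDeriv hp hφ u)]
    have e : p.γ * (v - u) * (demandLaw φ).real (Ioc A B) * (p.h₁ + p.p₁)
        = ∫ y, (Ioc A B).indicator (fun _ => p.γ * (v - u)) y * (p.h₁ + p.p₁) ∂demandLaw φ := by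
      rw [integral_mul_const, integral_indicator_const _ measurableSet_Ioc, smul_eq_mul]; ring
    rw [e]
    refine integral_mono (((integrable_const _).indicator measurableSet_Ioc).mul_const _)
      ((integrable_lossDeriv hp hφ v).sub (integrable_lossDeriv hp hφ u)) fun y => ?_
    have := mul_le_mul_of_nonneg_right (hF y) hp.sum_pos.le
    simp only [expCostDeriv]
    linarith
  refine le_trans ?_ hint
  have h3 := hφ.le_real_Ioc hp (le_max_left p.d (z + τ)) (min_le_left p.D (z + s - p.d - τ))
  have h4 : p.γ * (2 * τ) ≤ (demandLaw φ).real (Ioc A B) :=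
    (mul_le_mul_of_nonneg_left hAB hp.γ_pos.le).trans h3
  have := mul_le_mul_of_nonneg_left h4
    (mul_nonneg (mul_nonneg hp.γ_pos.le (sub_nonneg.2 huv)) hp.sum_pos.le)
  linarith

/-- Quadratic growth of the expected loss away from its minimum, with a constant that depends on
the numerical data only. -/
theorem exists_quadratic_growth (hp : p.Valid) (r : ℝ) (hr : 0 ≤ r) :
    ∃ μ : ℝ, 0 < μ ∧ ∀ φ, IsDemandDensity p φ → ∀ z,
      (∀ x, avgLoss p φ (bestLevel₁ p φ) z ≤ avgLoss p φ (bestLevel₁ p φ) x) →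
      ∀ x, |x - z| ≤ r → μ * (x - z) ^ 2
        ≤ avgLoss p φ (bestLevel₁ p φ) x - avgLoss p φ (bestLevel₁ p φ) z := by
  have hτ := hp.radius_pos
  set τ := p.radius with hτ_def
  set c := (p.h₁ + p.p₁) * p.γ ^ 2 * (2 * τ) with hc_def
  have hc : 0 < c := by have := hp.sum_pos; have := hp.γ_pos; positivity
  have hR : 0 < r + 2 * τ := by linarith
  set θ := τ / (r + 2 * τ) with hθ_def
  have hθ : 0 < θ := div_pos hτ hR
  have hθ2 : θ ≤ 1 / 2 := by rw [hθ_def, div_le_iff₀ hR]; linarith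
  refine ⟨c * θ / 2, by positivity, fun φ hφ z hz x hx => ?_⟩
  have hg0 := lossDeriv_eq_zero hp hφ hz
  -- Go from `z` a fixed fraction of the way towards `x`, so as to stay within the radius.
  set w := z + θ * (x - z) with hw
  have hwz : |θ * (x - z)| ≤ τ := by
    rw [abs_mul, abs_of_pos hθ, hθ_def, div_mul_eq_mul_div, div_le_iff₀ hR]
    exact mul_le_mul_of_nonneg_left (by linarith) hτ.le
  have hmono : c * (θ * (x - z)) ^ 2 ≤ lossDeriv p φ w * (θ * (x - z)) := by
    rcases le_total 0 (θ * (x - z)) with h | h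
    · have := lossDeriv_strongly_mono hp hφ hg0 (u := z) (v := w) (by linarith) (by linarith)
        (by rw [hw]; linarith [le_abs_self (θ * (x - z))])
      rw [hg0, sub_zero, show w - z = θ * (x - z) by rw [hw]; ring] at this
      have := mul_le_mul_of_nonneg_right this h
      linarith
    · have := lossDeriv_strongly_mono hp hφ hg0 (u := w) (v := z)
        (by rw [hw]; linarith [neg_abs_le (θ * (x - z))]) (by linarith) (by linarith)
      rw [hg0, zero_sub, show z - w = -(θ * (x - z)) by rw [hw]; ring] at this
      have := mul_le_mul_of_nonneg_right this (neg_nonneg.2 h)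
      linarith
  have h1 : c * θ * (x - z) ^ 2 ≤ lossDeriv p φ w * (x - z) := by
    refine le_of_mul_le_mul_left ?_ hθ
    linarith
  have h2 := avgLoss_subgradient hp hφ x w
  rw [show x - w = (1 - θ) * (x - z) by rw [hw]; ring] at h2
  have h3 := hz w
  have h4 : 0 ≤ c * θ * (x - z) ^ 2 := by positivity
  have h5 := mul_le_mul_of_nonneg_left h1 (by linarith : (0 : ℝ) ≤ 1 - θ)
  have h6 := mul_le_mul_of_nonneg_right hθ2 h4
  linarith

/-! ### Empirical distribution functions and their quantiles -/

section Empirical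

variable {n : ℕ}

theorem empCDF_comp_perm (x : Fin n → ℝ) (σ : Equiv.Perm (Fin n)) :
    empCDF (x ∘ σ) = empCDF x := by
  ext z
  simp only [empCDF, Function.comp_apply]
  rw [Equiv.sum_comp σ fun i => if x i ≤ z then (1 : ℝ) else 0]

theorem empCDF_nonneg (x : Fin n → ℝ) (z : ℝ) : 0 ≤ empCDF x z :=
  div_nonneg (Finset.sum_nonneg fun i _ => by split_ifs <;> simp) n.cast_nonneg

theorem empCDF_le_one (x : Fin n → ℝ) (z : ℝ) : empCDF x z ≤ 1 := by
  refine div_le_one_of_le₀ ?_ n.cast_nonneg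
  calc ∑ i, (if x i ≤ z then (1 : ℝ) else 0) ≤ ∑ _i : Fin n, (1 : ℝ) :=
        Finset.sum_le_sum fun i _ => by split_ifs <;> simp
    _ = n := by simp

theorem measurable_empCDF :
    Measurable fun q : (Fin n → ℝ) × ℝ => empCDF q.1 q.2 := by
  unfold empCDF
  refine Measurable.div_const (Finset.measurable_sum _ fun i _ => ?_) _
  exact Measurable.ite (measurableSet_le (by fun_prop) (by fun_prop)) measurable_const
    measurable_const

theorem bddBelow_empCDF (x : Fin n → ℝ) {q : ℝ} (hq : 0 < q) :
    BddBelow {t | q ≤ empCDF x t} := by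
  obtain ⟨m, hm⟩ := (Set.finite_range x).bddBelow
  refine ⟨m, fun t ht => le_of_not_gt fun h => ?_⟩
  have h0 : empCDF x t = 0 := by
    rw [empCDF, Finset.sum_eq_zero, zero_div]
    exact fun i _ => if_neg (not_le.2 (h.trans_le (hm ⟨i, rfl⟩)))
  have ht' : q ≤ empCDF x t := ht
  rw [h0] at ht'
  exact absurd hq (not_lt.2 ht')

theorem empCDF_eq_one (hn : 0 < n) (x : Fin n → ℝ) {t : ℝ} (ht : ∀ i, x i ≤ t) :
    empCDF x t = 1 := by
  have hn' : (n : ℝ) ≠ 0 := by positivity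
  simp [empCDF, ht, hn']

theorem empCDF_mono (x : Fin n → ℝ) : Monotone (empCDF x) := by
  intro s t hst
  refine div_le_div_of_nonneg_right (Finset.sum_le_sum fun i _ => ?_) n.cast_nonneg
  split_ifs with h1 h2
  · exact le_rfl
  · exact absurd (h1.trans hst) h2
  · exact zero_le_one
  · exact le_rfl

/-- The infimum that defines a quantile of a sample is attained, as the empirical distribution
function is right-continuous. -/
theorem le_empCDF_quantile (hn : 0 < n) (x : Fin n → ℝ) {q : ℝ} (hq : 0 < q) (hq1 : q ≤ 1) :
    q ≤ empCDF x (quantile (empCDF x) q) := by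
  obtain ⟨m, hm⟩ := (Set.finite_range x).bddAbove
  have hne : {t | q ≤ empCDF x t}.Nonempty :=
    ⟨m, by rw [mem_ofPred_eq, empCDF_eq_one hn x fun i => hm ⟨i, rfl⟩]; exact hq1⟩
  have hcl : IsClosed {t | q ≤ empCDF x t} := by
    have hu : UpperSemicontinuous fun t => ∑ i, if x i ≤ t then (1 : ℝ) else 0 := by
      refine upperSemicontinuous_sum fun i _ => ?_
      have : (fun t : ℝ => if x i ≤ t then (1 : ℝ) else 0) = (Ici (x i)).indicator fun _ => 1 := by
        ext t; simp [indicator]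
      rw [this]
      exact isClosed_Ici.upperSemicontinuous_indicator zero_le_one
    have := hu.isClosed_preimage (q * n)
    convert this using 1
    ext t
    have hn' : (0 : ℝ) < n := by exact_mod_cast hn
    simp only [mem_ofPred_eq, empCDF, mem_preimage, mem_Ici, le_div_iff₀ hn']
  exact hcl.csInf_mem hne (bddBelow_empCDF x hq)

theorem quantile_empCDF_le_iff (hn : 0 < n) (x : Fin n → ℝ) {q : ℝ} (hq : 0 < q) (hq1 : q ≤ 1)
    (t : ℝ) : quantile (empCDF x) q ≤ t ↔ q ≤ empCDF x t :=
  ⟨fun h => (le_empCDF_quantile hn x hq hq1).trans (empCDF_mono x h),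
    fun h => csInf_le (bddBelow_empCDF x hq) h⟩

theorem measurable_quantile_empCDF (hn : 0 < n) {q : ℝ} (hq : 0 < q) (hq1 : q ≤ 1) :
    Measurable fun x : Fin n → ℝ => quantile (empCDF x) q := by
  refine measurable_of_Iic fun t => ?_
  have : (fun x : Fin n → ℝ => quantile (empCDF x) q) ⁻¹' Iic t = {x | q ≤ empCDF x t} := by
    ext x; exact quantile_empCDF_le_iff hn x hq hq1 t
  rw [this]
  exact measurableSet_le measurable_const
    (measurable_empCDF.comp (measurable_id.prodMk measurable_const))

theorem quantile_empCDF_mem_Icc (hn : 0 < n) {x : Fin n → ℝ} {a b : ℝ} (hx : ∀ i, x i ∈ Icc a b)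
    {q : ℝ} (hq : 0 < q) (hq1 : q ≤ 1) : quantile (empCDF x) q ∈ Icc a b := by
  refine ⟨le_of_not_gt fun h => ?_, (quantile_empCDF_le_iff hn x hq hq1 b).2 ?_⟩
  · have := le_empCDF_quantile hn x hq hq1
    rw [empCDF, Finset.sum_eq_zero, zero_div] at this
    · exact absurd hq (not_lt.2 this)
    · exact fun i _ => if_neg (not_le.2 (h.trans_le (hx i).1))
  · rw [empCDF_eq_one hn x fun i => (hx i).2]; exact hq1

/-- The quantile of a sample is close to that of the law if the distribution functions are. -/
theorem abs_quantile_sub_le (hp : p.Valid) (hφ : IsDemandDensity p φ) (hn : 0 < n)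
    {x : Fin n → ℝ} (hx : ∀ i, x i ∈ Icc p.d p.D) {ε : ℝ}
    (hε : ∀ t, |empCDF x t - demandCDF φ t| ≤ ε) :
    |quantile (empCDF x) p.ratio - bestLevel₁ p φ| ≤ ε / p.γ := by
  set s := quantile (empCDF x) p.ratio with hs
  have hmem := quantile_empCDF_mem_Icc hn hx hp.ratio_pos hp.ratio_le_one
  rw [← hs] at hmem
  have hlow : p.ratio - ε ≤ demandCDF φ s := by
    have := le_empCDF_quantile hn x hp.ratio_pos hp.ratio_le_one
    linarith [(abs_le.1 (hε s)).2]
  have hup : demandCDF φ s ≤ p.ratio + ε := by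
    refine le_of_tendsto ((demandCDF_continuous hp hφ).continuousWithinAt (s := Iio s)) ?_
    filter_upwards [self_mem_nhdsWithin] with t ht
    have h1 : empCDF x t < p.ratio := by
      rw [← not_le, ← quantile_empCDF_le_iff hn x hp.ratio_pos hp.ratio_le_one, ← hs]
      exact not_le.2 ht
    linarith [(abs_le.1 (hε t)).1]
  have hb := demandCDF_bestLevel₁ hp hφ
  have hb1 := bestLevel₁_le hp hφ
  have hb2 := (d_lt_bestLevel₁ hp hφ).le
  rw [le_div_iff₀' hp.γ_pos]
  rcases le_total s (bestLevel₁ p φ) with h | h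
  · have := le_demandCDF_sub hp hφ hmem.1 h hb1
    rw [abs_sub_comm, abs_of_nonneg (sub_nonneg.2 h)]; linarith
  · have := le_demandCDF_sub hp hφ hb2 h hmem.2
    rw [abs_of_nonneg (sub_nonneg.2 h)]; linarith

end Empirical

/-! ### Concentration for sampling without replacement -/

section Exchangeable

variable {E : Type*} [MeasurableSpace E] {L : ℕ} (ν : Measure E) [IsProbabilityMeasure ν]

theorem measurePreserving_comp_perm (σ : Equiv.Perm (Fin L)) :
    MeasurePreserving (fun v : Fin L → E => v ∘ σ) (Measure.pi fun _ => ν)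
      (Measure.pi fun _ => ν) := by
  have hm : Measurable fun v : Fin L → E => v ∘ σ :=
    measurable_pi_lambda _ fun i => measurable_pi_apply (σ i)
  refine ⟨hm, (Measure.pi_eq fun s hs => ?_).symm⟩
  rw [Measure.map_apply hm (MeasurableSet.univ_pi hs)]
  have : (fun v : Fin L → E => v ∘ σ) ⁻¹' Set.pi univ s = Set.pi univ fun i => s (σ.symm i) := by
    ext v
    simp only [mem_preimage, Set.mem_pi, mem_univ, true_implies, Function.comp_apply]
    exact ⟨fun h i => by simpa using h (σ.symm i), fun h i => by simpa using h (σ i)⟩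
  rw [this, Measure.pi_pi, Equiv.prod_comp σ.symm fun i => ν (s i)]

/-- Hoeffding's lemma for the uniform distribution on a finite family of numbers. -/
theorem sum_exp_sub_mean_le {ι : Type*} (s : Finset ι) (hs : s.Nonempty) (y : ι → ℝ) {B : ℝ}
    (hy : ∀ i, |y i| ≤ B) (t : ℝ) :
    ∑ i ∈ s, Real.exp (t * (y i - (∑ k ∈ s, y k) / s.card))
      ≤ s.card * Real.exp (2 * t ^ 2 * B ^ 2) := by
  have hc : (0 : ℝ) < s.card := by exact_mod_cast hs.card_pos
  have h1 : ∀ i, Real.exp (t * (y i - (∑ k ∈ s, y k) / s.card))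
      ≤ ∑ k ∈ s, (1 / (s.card : ℝ)) * Real.exp (t * (y i - y k)) := by
    intro i
    have := convexOn_exp.map_sum_le (t := s) (w := fun _ => 1 / (s.card : ℝ))
      (p := fun k => t * (y i - y k)) (fun _ _ => by positivity)
      (by rw [Finset.sum_const, nsmul_eq_mul]; field_simp) (fun _ _ => mem_univ _)
    simp only [smul_eq_mul] at this
    refine le_trans (le_of_eq ?_) this
    congr 1
    rw [← Finset.mul_sum, ← Finset.mul_sum, Finset.sum_sub_distrib, Finset.sum_const, nsmul_eq_mul]
    field_simp
  have h2 : ∀ i k, Real.cosh (t * (y i - y k)) ≤ Real.exp (2 * t ^ 2 * B ^ 2) := by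
    intro i k
    refine (Real.cosh_le_exp_half_sq _).trans (Real.exp_le_exp.2 ?_)
    have h3 : |y i - y k| ≤ 2 * B := (abs_sub _ _).trans (by linarith [hy i, hy k])
    have h4 : (y i - y k) ^ 2 ≤ (2 * B) ^ 2 := by
      rw [← sq_abs (y i - y k)]; gcongr
    have := mul_le_mul_of_nonneg_left h4 (sq_nonneg t)
    rw [mul_pow]; linarith
  -- The double sum of the exponentials of differences is one of hyperbolic cosines, by symmetry.
  have hsymm : ∑ i ∈ s, ∑ k ∈ s, Real.exp (t * (y i - y k))
      = ∑ i ∈ s, ∑ k ∈ s, Real.cosh (t * (y i - y k)) := by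
    have hswap : ∑ i ∈ s, ∑ k ∈ s, Real.exp (-(t * (y i - y k)))
        = ∑ i ∈ s, ∑ k ∈ s, Real.exp (t * (y i - y k)) := by
      rw [Finset.sum_comm]
      refine Finset.sum_congr rfl fun i _ => Finset.sum_congr rfl fun k _ => ?_
      congr 1; ring
    simp only [Real.cosh_eq, ← Finset.sum_div, Finset.sum_add_distrib, hswap]
    ring
  calc ∑ i ∈ s, Real.exp (t * (y i - (∑ k ∈ s, y k) / s.card))
      ≤ ∑ i ∈ s, ∑ k ∈ s, (1 / (s.card : ℝ)) * Real.exp (t * (y i - y k)) :=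
        Finset.sum_le_sum fun i _ => h1 i
    _ = (1 / (s.card : ℝ)) * ∑ i ∈ s, ∑ k ∈ s, Real.cosh (t * (y i - y k)) := by
        rw [← hsymm, Finset.mul_sum]
        exact Finset.sum_congr rfl fun i _ => (Finset.mul_sum _ _ _).symm
    _ ≤ (1 / (s.card : ℝ)) * ∑ i ∈ s, ∑ k ∈ s, Real.exp (2 * t ^ 2 * B ^ 2) := by
        gcongr with i _ k _; exact h2 i k
    _ = s.card * Real.exp (2 * t ^ 2 * B ^ 2) := by
        simp only [Finset.sum_const, nsmul_eq_mul]; field_simp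

/-- The mean of a function over the entries `v j, v (j + 1), …` of a sample. -/
noncomputable def tailMean (v : Fin L → E) (j : Fin L) (f : E → ℝ) : ℝ :=
  (∑ i ∈ Finset.Ici j, f (v i)) / ((Finset.Ici j).card : ℝ)

/-- A family of functions `ψ j v : E → ℝ` that depends on the sample `v` only through the entries
before the index `j` and the unordered collection of all entries. -/
structure IsPredictable (ψ : Fin L → (Fin L → E) → E → ℝ) : Prop where
  measurable : ∀ j, Measurable fun q : (Fin L → E) × E => ψ j q.1 q.2
  symm : ∀ (j : Fin L) (v : Fin L → E) (σ : Equiv.Perm (Fin L)), (∀ i < j, σ i = i) →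
    ψ j (v ∘ σ) = ψ j v

/-- The deviation of `ψ j v (v j)` from its mean over the entries that are not drawn before. -/
noncomputable def tailDev (ψ : Fin L → (Fin L → E) → E → ℝ) (j : Fin L) (v : Fin L → E) : ℝ :=
  ψ j v (v j) - tailMean v j (ψ j v)

variable {ν} {ψ : Fin L → (Fin L → E) → E → ℝ}

theorem perm_mem_Ici {σ : Equiv.Perm (Fin L)} {j : Fin L} (hσ : ∀ i < j, σ i = i) (i : Fin L) :
    i ∈ Finset.Ici j ↔ σ i ∈ Finset.Ici j := by
  rw [Finset.mem_Ici, Finset.mem_Ici, ← not_lt, ← not_lt, not_iff_not]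
  refine ⟨fun h => by rwa [hσ i h], fun h => ?_⟩
  have := σ.injective (hσ _ h)
  rwa [this] at h

theorem IsPredictable.tailMean_comp (hψ : IsPredictable ψ) (v : Fin L → E) (j : Fin L)
    (σ : Equiv.Perm (Fin L)) (hσ : ∀ i < j, σ i = i) :
    tailMean (v ∘ σ) j (ψ j (v ∘ σ)) = tailMean v j (ψ j v) := by
  rw [tailMean, tailMean, hψ.symm j v σ hσ]
  congr 1
  exact Finset.sum_equiv σ (perm_mem_Ici hσ) fun i _ => rfl

theorem IsPredictable.measurable_tailMean (hψ : IsPredictable ψ) (j : Fin L) :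
    Measurable fun v => tailMean v j (ψ j v) := by
  unfold tailMean
  refine Measurable.div_const (Finset.measurable_sum _ fun i _ => ?_) _
  exact (hψ.measurable j).comp (measurable_id.prodMk (measurable_pi_apply i))

theorem IsPredictable.measurable_apply (hψ : IsPredictable ψ) (j i : Fin L) :
    Measurable fun v : Fin L → E => ψ j v (v i) :=
  (hψ.measurable j).comp (measurable_id.prodMk (measurable_pi_apply i))

theorem IsPredictable.measurable_tailDev (hψ : IsPredictable ψ) (j : Fin L) :
    Measurable (tailDev ψ j) :=
  (hψ.measurable_apply j j).sub (hψ.measurable_tailMean j)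

theorem abs_tailMean_le {E : Type*} (v : Fin L → E) (j : Fin L) {f : E → ℝ} {B : ℝ}
    (hf : ∀ y, |f y| ≤ B) :
    |tailMean v j f| ≤ B := by
  have hc : (0 : ℝ) < (Finset.Ici j).card := by
    exact_mod_cast Finset.card_pos.2 ⟨j, Finset.mem_Ici.2 le_rfl⟩
  rw [tailMean, abs_div, abs_of_pos hc, div_le_iff₀' hc]
  refine (Finset.abs_sum_le_sum_abs _ _).trans ?_
  rw [← nsmul_eq_mul]
  exact Finset.sum_le_card_nsmul _ _ _ fun i _ => hf _

theorem abs_tailDev_le {E : Type*} {ψ : Fin L → (Fin L → E) → E → ℝ} {B : ℝ}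
    (hB : ∀ j v y, |ψ j v y| ≤ B) (j : Fin L) (v : Fin L → E) :
    |tailDev ψ j v| ≤ 2 * B :=
  (abs_sub _ _).trans (by linarith [hB j v (v j), abs_tailMean_le v j (hB j v)])

/-- The exponential moments of a sum of deviations `tailDev`. The entry `v k` may be swapped with
any later entry `v i` without changing the law of `v` or the earlier deviations; averaging over `i`
turns the last factor into an average over a finite family, to which Hoeffding's lemma applies. -/
theorem IsPredictable.integral_exp_sum_le (hψ : IsPredictable ψ) {B : ℝ}
    (hB : ∀ j v y, |ψ j v y| ≤ B) (t : ℝ) (k : ℕ) (hk : k ≤ L) :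
    ∫ v, Real.exp (t * ∑ j with j.1 < k, tailDev ψ j v) ∂(Measure.pi fun _ => ν)
      ≤ Real.exp (2 * t ^ 2 * B ^ 2) ^ k := by
  set μ : Measure (Fin L → E) := Measure.pi fun _ => ν with hμ
  have hint : ∀ f : (Fin L → E) → ℝ, Measurable f → (∃ K, ∀ v, |f v| ≤ K) →
      Integrable (fun v => Real.exp (f v)) μ := by
    rintro f hf ⟨K, hK⟩
    refine Integrable.of_bound (Real.measurable_exp.comp hf).aestronglyMeasurable (Real.exp K)
      (Filter.Eventually.of_forall fun v => ?_)
    rw [Real.norm_eq_abs, abs_of_pos (Real.exp_pos _)]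
    exact Real.exp_le_exp.2 ((le_abs_self _).trans (hK v))
  induction k with
  | zero => simp
  | succ k ih =>
    have hkL : k < L := hk
    set κ : Fin L := ⟨k, hkL⟩ with hκ
    set S : (Fin L → E) → ℝ := fun v => ∑ j : Fin L with j.1 < k, tailDev ψ j v with hS
    have hSm : Measurable S := Finset.measurable_sum _ fun j _ => hψ.measurable_tailDev j
    have hSb : ∀ v, |S v| ≤ (Finset.univ.filter fun j : Fin L => j.1 < k).card * (2 * B) := by
      intro v
      refine (Finset.abs_sum_le_sum_abs _ _).trans ?_
      rw [← nsmul_eq_mul]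
      exact Finset.sum_le_card_nsmul _ _ _ fun i _ => abs_tailDev_le hB i v
    have hsplit : ∀ v, ∑ j : Fin L with j.1 < k + 1, tailDev ψ j v = S v + tailDev ψ κ v := by
      intro v
      have : (Finset.univ.filter fun j : Fin L => j.1 < k + 1)
          = insert κ (Finset.univ.filter fun j : Fin L => j.1 < k) := by
        ext j
        simp only [Finset.mem_filter, Finset.mem_univ, true_and, Finset.mem_insert, hκ, Fin.ext_iff]
        omega
      rw [this, Finset.sum_insert (by simp [hκ]), add_comm]
    set W : Fin L → (Fin L → E) → ℝ := fun i v =>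
      Real.exp (t * (S v + (ψ κ v (v i) - tailMean v κ (ψ κ v)))) with hW
    have hWi : ∀ i, Integrable (W i) μ := by
      intro i
      refine hint _ ((hSm.add ((hψ.measurable_apply κ i).sub
        (hψ.measurable_tailMean κ))).const_mul t)
        ⟨|t| * ((Finset.univ.filter fun j : Fin L => j.1 < k).card * (2 * B) + (B + B)),
          fun v => ?_⟩
      rw [abs_mul]
      refine mul_le_mul_of_nonneg_left ((abs_add_le _ _).trans (add_le_add (hSb v) ?_))
        (abs_nonneg t)
      exact (abs_sub _ _).trans (add_le_add (hB _ _ _) (abs_tailMean_le v κ (hB κ v)))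
    have hswap : ∀ i ∈ Finset.Ici κ, ∫ v, W κ v ∂μ = ∫ v, W i v ∂μ := by
      intro i hi
      rw [Finset.mem_Ici] at hi
      set σ := Equiv.swap κ i with hσ
      have hfix : ∀ j < κ, σ j = j := fun j hj =>
        Equiv.swap_apply_of_ne_of_ne hj.ne (hj.trans_le hi).ne
      have hmp := measurePreserving_comp_perm (L := L) ν σ
      have hcomp : ∀ v, W κ (v ∘ σ) = W i v := by
        intro v
        have hS' : S (v ∘ σ) = S v := by
          refine Finset.sum_congr rfl fun j hj => ?_
          have hj : j < κ := (Finset.mem_filter.1 hj).2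
          have hfix' : ∀ l < j, σ l = l := fun l hl => hfix l (hl.trans hj)
          rw [tailDev, tailDev, hψ.tailMean_comp v j σ hfix', hψ.symm j v σ hfix',
            Function.comp_apply, hfix j hj]
        simp only [hW]
        rw [hS', hψ.tailMean_comp v κ σ hfix, hψ.symm κ v σ hfix, Function.comp_apply, hσ,
          Equiv.swap_apply_left]
      rw [← integral_congr_ae (Filter.Eventually.of_forall hcomp)]
      conv_lhs => rw [hμ, ← hmp.map_eq]
      exact integral_map hmp.aemeasurable (by rw [hmp.map_eq]; exact (hWi κ).aestronglyMeasurable)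
    have hc : (0 : ℝ) < (Finset.Ici κ).card := by
      exact_mod_cast Finset.card_pos.2 ⟨κ, Finset.mem_Ici.2 le_rfl⟩
    have hSi : Integrable (fun v => Real.exp (t * S v)) μ := by
      refine hint _ (hSm.const_mul t) ⟨|t| *
        ((Finset.univ.filter fun j : Fin L => j.1 < k).card * (2 * B)), fun v => ?_⟩
      rw [abs_mul]
      exact mul_le_mul_of_nonneg_left (hSb v) (abs_nonneg t)
    have hmul : (Finset.Ici κ).card * ∫ v, W κ v ∂μ
        ≤ (Finset.Ici κ).card * (Real.exp (2 * t ^ 2 * B ^ 2) ^ (k + 1)) := by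
      calc (Finset.Ici κ).card * ∫ v, W κ v ∂μ = ∑ i ∈ Finset.Ici κ, ∫ v, W i v ∂μ := by
            rw [← Finset.sum_congr rfl hswap, Finset.sum_const, nsmul_eq_mul]
        _ = ∫ v, ∑ i ∈ Finset.Ici κ, W i v ∂μ := (integral_finsetSum _ fun i _ => hWi i).symm
        _ ≤ ∫ v, Real.exp (t * S v) * ((Finset.Ici κ).card * Real.exp (2 * t ^ 2 * B ^ 2)) ∂μ := by
            refine integral_mono (integrable_finsetSum _ fun i _ => hWi i) (hSi.mul_const _)
              fun v => ?_
            simp only [hW, mul_add, Real.exp_add, ← Finset.mul_sum]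
            refine mul_le_mul_of_nonneg_left ?_ (Real.exp_pos _).le
            exact sum_exp_sub_mean_le _ ⟨κ, Finset.mem_Ici.2 le_rfl⟩ (fun i => ψ κ v (v i))
              (fun i => hB _ _ _) t
        _ = (∫ v, Real.exp (t * S v) ∂μ) * ((Finset.Ici κ).card * Real.exp (2 * t ^ 2 * B ^ 2)) :=
            integral_mul_const _ _
        _ ≤ Real.exp (2 * t ^ 2 * B ^ 2) ^ k *
              ((Finset.Ici κ).card * Real.exp (2 * t ^ 2 * B ^ 2)) :=
            mul_le_mul_of_nonneg_right (ih hkL.le) (by positivity)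
        _ = _ := by ring
    simp only [hsplit]
    exact le_of_mul_le_mul_left hmul hc

/-- An Azuma–Hoeffding inequality for the sums of deviations `tailDev`. -/
theorem IsPredictable.measure_sum_tailDev_ge_le (hψ : IsPredictable ψ) {B : ℝ} (hB0 : 0 < B)
    (hB : ∀ j v y, |ψ j v y| ≤ B) (hL : 0 < L) {u : ℝ} (hu : 0 ≤ u) :
    (Measure.pi fun _ => ν).real {v | u ≤ ∑ j, tailDev ψ j v}
      ≤ Real.exp (-(u ^ 2 / (8 * L * B ^ 2))) := by
  have hL' : (0 : ℝ) < L := by exact_mod_cast hL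
  set t : ℝ := u / (4 * L * B ^ 2) with ht
  have ht0 : 0 ≤ t := by positivity
  have hint : Integrable (fun v => Real.exp (t * ∑ j, tailDev ψ j v))
      (Measure.pi fun _ : Fin L => ν) := by
    refine Integrable.of_bound (Real.measurable_exp.comp ((Finset.measurable_sum _ fun j _ =>
      hψ.measurable_tailDev j).const_mul t)).aestronglyMeasurable
      (Real.exp (t * (L * (2 * B)))) (Filter.Eventually.of_forall fun v => ?_)
    rw [Real.norm_eq_abs, abs_of_pos (Real.exp_pos _)]
    refine Real.exp_le_exp.2 (mul_le_mul_of_nonneg_left ?_ ht0)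
    refine (Finset.sum_le_card_nsmul _ _ (2 * B) fun j _ =>
      (le_abs_self _).trans (abs_tailDev_le hB j v)).trans (le_of_eq ?_)
    simp
  have h1 := measure_ge_le_exp_mul_mgf (X := fun v => ∑ j, tailDev ψ j v) u ht0 hint
  have h2 := hψ.integral_exp_sum_le (ν := ν) hB t L le_rfl
  simp only [Fin.is_lt, Finset.filter_true] at h2
  refine h1.trans ((mul_le_mul_of_nonneg_left h2 (Real.exp_pos _).le).trans (le_of_eq ?_))
  rw [← Real.exp_nat_mul, ← Real.exp_add]
  congr 1
  rw [ht]; field_simp; ring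

end Exchangeable

/-! ### Uniform convergence of the empirical distributions of the tails of a sample -/

section TailCDF

variable {L : ℕ}

/-- The empirical distribution function of the entries `v j, v (j + 1), …` of a sample. -/
noncomputable def tailCDF (v : Fin L → ℝ) (j : Fin L) (z : ℝ) : ℝ :=
  tailMean v j fun y => if y ≤ z then 1 else 0

theorem card_Ici_cast (j : Fin L) : ((Finset.Ici j).card : ℝ) = (L : ℝ) - j := by
  rw [Fin.card_Ici, Nat.cast_sub j.2.le]

theorem card_Ici_pos (j : Fin L) : (0 : ℝ) < (Finset.Ici j).card := by
  exact_mod_cast Finset.card_pos.2 ⟨j, Finset.mem_Ici.2 le_rfl⟩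

theorem tailCDF_zero (hL : 0 < L) (v : Fin L → ℝ) : tailCDF v ⟨0, hL⟩ = empCDF v := by
  ext z
  have : (Finset.Ici (⟨0, hL⟩ : Fin L)) = Finset.univ := by
    ext i; simp [Fin.le_def]
  rw [tailCDF, tailMean, empCDF, this, Finset.card_univ, Fintype.card_fin]

theorem tailMean_mono {E : Type*} (v : Fin L → E) (j : Fin L) {f g : E → ℝ}
    (h : ∀ i, f (v i) ≤ g (v i)) : tailMean v j f ≤ tailMean v j g :=
  div_le_div_of_nonneg_right (Finset.sum_le_sum fun i _ => h i) (Nat.cast_nonneg _)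

theorem tailMean_const {E : Type*} (v : Fin L → E) (j : Fin L) (c : ℝ) :
    tailMean v j (fun _ => c) = c := by
  rw [tailMean, Finset.sum_const, nsmul_eq_mul, mul_div_cancel_left₀ _ (card_Ici_pos j).ne']

theorem tailCDF_mono (v : Fin L → ℝ) (j : Fin L) : Monotone (tailCDF v j) := by
  intro s t hst
  refine tailMean_mono v j fun i => ?_
  split_ifs with h1 h2
  · exact le_rfl
  · exact absurd (h1.trans hst) h2
  · exact zero_le_one
  · exact le_rfl

/-- Hoeffding's inequality for the empirical distribution function at one point. -/
theorem measure_le_abs_tailCDF_sub_le (hp : p.Valid) (hφ : IsDemandDensity p φ) (j : Fin L) (z : ℝ)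
    {ε : ℝ} (hε : 0 ≤ ε) :
    (Measure.pi fun _ : Fin L => demandLaw φ).real {v | ε ≤ |tailCDF v j z - demandCDF φ z|}
      ≤ 2 * Real.exp (-(2 * (Finset.Ici j).card * ε ^ 2)) := by
  have := hφ.isProbabilityMeasure hp
  set μ := Measure.pi fun _ : Fin L => demandLaw φ with hμ
  set f : ℝ → ℝ := fun y => if y ≤ z then 1 else 0 with hf
  have hfm : Measurable f := Measurable.ite measurableSet_Iic measurable_const measurable_const
  set n : ℝ := ((Finset.Ici j).card : ℝ) with hn
  have hn0 : 0 < n := card_Ici_pos j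
  have hmean : ∀ i : Fin L, ∫ v, f (v i) ∂μ = demandCDF φ z := by
    intro i
    have hmp := measurePreserving_eval (fun _ : Fin L => demandLaw φ) i
    rw [← integral_indicator_le, ← hmp.map_eq, integral_map hmp.aemeasurable
      hfm.aestronglyMeasurable]
  have hsub : ∀ i : Fin L, HasSubgaussianMGF (fun v : Fin L → ℝ => f (v i) - demandCDF φ z)
      ((‖(1 : ℝ) - 0‖₊ / 2) ^ 2) μ := by
    intro i
    have := hasSubgaussianMGF_of_mem_Icc (μ := μ) (X := fun v : Fin L → ℝ => f (v i)) (a := 0)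
      (b := 1) (hfm.comp (measurable_pi_apply i)).aemeasurable
      (Filter.Eventually.of_forall fun v => by
        simp only [hf]; split_ifs <;> simp)
    rwa [hmean i] at this
  have hind : iIndepFun (fun (i : Fin L) (v : Fin L → ℝ) => f (v i) - demandCDF φ z) μ :=
    iIndepFun_pi (X := fun _ y => f y - demandCDF φ z) fun _ =>
      (hfm.sub measurable_const).aemeasurable
  have hind' : iIndepFun (fun (i : Fin L) (v : Fin L → ℝ) => -(f (v i) - demandCDF φ z)) μ :=
    iIndepFun_pi (X := fun _ y => -(f y - demandCDF φ z)) fun _ =>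
      (hfm.sub measurable_const).neg.aemeasurable
  have hexp : -(n * ε) ^ 2 / (2 * ((∑ _i ∈ Finset.Ici j, ((‖(1 : ℝ) - 0‖₊ / 2) ^ 2) : NNReal) : ℝ))
      = -(2 * n * ε ^ 2) := by
    rw [Finset.sum_const]
    simp only [sub_zero, nnnorm_one, nsmul_eq_mul, NNReal.coe_mul, NNReal.coe_natCast,
      NNReal.coe_pow, NNReal.coe_div, NNReal.coe_one, NNReal.coe_ofNat, ← hn]
    field_simp
  have h1 := HasSubgaussianMGF.measure_sum_ge_le_of_iIndepFun hind (s := Finset.Ici j)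
    (fun i _ => hsub i) (mul_nonneg hn0.le hε)
  have h2 := HasSubgaussianMGF.measure_sum_ge_le_of_iIndepFun hind' (s := Finset.Ici j)
    (fun i _ => (hsub i).neg) (mul_nonneg hn0.le hε)
  rw [hexp] at h1 h2
  have hsplit : {v : Fin L → ℝ | ε ≤ |tailCDF v j z - demandCDF φ z|} ⊆
      {v | n * ε ≤ ∑ i ∈ Finset.Ici j, (f (v i) - demandCDF φ z)} ∪
      {v | n * ε ≤ ∑ i ∈ Finset.Ici j, -(f (v i) - demandCDF φ z)} := by
    intro v hv
    have e : n * (tailCDF v j z - demandCDF φ z)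
        = ∑ i ∈ Finset.Ici j, (f (v i) - demandCDF φ z) := by
      rw [Finset.sum_sub_distrib, Finset.sum_const, nsmul_eq_mul, tailCDF, tailMean, mul_sub,
        mul_div_cancel₀ _ hn0.ne']
    rcases le_abs.1 (show ε ≤ |tailCDF v j z - demandCDF φ z| from hv) with h | h
    · left
      change n * ε ≤ _
      rw [← e]; exact mul_le_mul_of_nonneg_left h hn0.le
    · right
      change n * ε ≤ _
      rw [Finset.sum_neg_distrib, ← e, ← mul_neg]; exact mul_le_mul_of_nonneg_left h hn0.le
  refine (measureReal_mono hsplit).trans ((measureReal_union_le _ _).trans ?_)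
  linarith

/-- From a grid of mesh `(D - d) / L`, closeness of the distribution functions extends to all
points. -/
theorem abs_tailCDF_sub_le_of_grid (hp : p.Valid) (hφ : IsDemandDensity p φ) (hL : 0 < L)
    {v : Fin L → ℝ} (hv : ∀ i, v i ∈ Icc p.d p.D) (j : Fin L) {ε : ℝ}
    (hε : ∀ k : Fin (L + 1), |tailCDF v j (p.d + k * ((p.D - p.d) / L))
      - demandCDF φ (p.d + k * ((p.D - p.d) / L))| ≤ ε) (z : ℝ) :
    |tailCDF v j z - demandCDF φ z| ≤ ε + p.Γ * ((p.D - p.d) / L) := by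
  have hL' : (0 : ℝ) < L := by exact_mod_cast hL
  have hε0 : 0 ≤ ε := (abs_nonneg _).trans (hε 0)
  have hw : 0 < (p.D - p.d) / L := div_pos (sub_pos.2 hp.d_lt_D) hL'
  set w := (p.D - p.d) / L with hw_def
  have hpos : 0 ≤ ε + p.Γ * w := add_nonneg hε0 (mul_nonneg hp.Γ_pos.le hw.le)
  rcases lt_or_ge z p.d with hz | hz
  · rw [demandCDF_of_le hp hφ hz.le, tailCDF, tailMean, Finset.sum_eq_zero]
    · simpa using hpos
    · exact fun i _ => if_neg (not_le.2 (hz.trans_le (hv i).1))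
  rcases le_or_gt p.D z with hz' | hz'
  · have : tailCDF v j z = 1 := by
      have h1 := tailMean_const v j 1
      rw [← h1, tailCDF]
      exact congrArg (· / _) (Finset.sum_congr rfl fun i _ => if_pos ((hv i).2.trans hz'))
    rw [demandCDF_of_ge hp hφ hz', this]
    simpa using hpos
  have hq0 : 0 ≤ (z - p.d) / w := div_nonneg (sub_nonneg.2 hz) hw.le
  set k := ⌊(z - p.d) / w⌋₊ with hk
  have hk1 : k * w ≤ z - p.d := (le_div_iff₀ hw).1 (Nat.floor_le hq0)
  have hk2 : z - p.d < (k + 1) * w := (div_lt_iff₀ hw).1 (Nat.lt_floor_add_one _)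
  have hkL : k < L := by
    have : (k : ℝ) * w < L * w := by
      rw [hw_def, mul_div_cancel₀ _ hL'.ne']; rw [hw_def] at hk1; linarith
    exact_mod_cast lt_of_mul_lt_mul_right this hw.le
  have h1 := hε ⟨k, by omega⟩
  have h2 := hε ⟨k + 1, by omega⟩
  simp only [Nat.cast_add, Nat.cast_one] at h1 h2
  have m1 := tailCDF_mono v j (show p.d + k * w ≤ z by linarith)
  have m2 := tailCDF_mono v j (show z ≤ p.d + (k + 1) * w by linarith)
  have f1 := demandCDF_mono hp hφ (show p.d + k * w ≤ z by linarith)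
  have f2 := demandCDF_mono hp hφ (show z ≤ p.d + (k + 1) * w by linarith)
  have f3 := demandCDF_sub_le hp hφ (show p.d + k * w ≤ p.d + (k + 1) * w by linarith)
  rw [show p.d + (k + 1) * w - (p.d + k * w) = w by ring] at f3
  rw [abs_le] at h1 h2 ⊢
  constructor <;> linarith

theorem half_le_log_div {T : ℕ} {δ : ℝ} (hT : 1 ≤ T) (hδ : 0 < δ) (hδ2 : δ ≤ 1 / 2) :
    1 / 2 ≤ Real.log (T / δ) := by
  have hT' : (1 : ℝ) ≤ T := by exact_mod_cast hT
  have h1 : (2 : ℝ) ≤ T / δ := by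
    rw [le_div_iff₀ hδ]; linarith
  have := Real.log_le_log two_pos h1
  linarith [Real.log_two_gt_d9]

theorem exp_neg_mul_log {T : ℕ} {δ : ℝ} (hT : 1 ≤ T) (hδ : 0 < δ) (k : ℕ) :
    Real.exp (-(k * Real.log (T / δ))) = (δ / T) ^ k := by
  have hT' : (0 : ℝ) < T := by exact_mod_cast hT
  rw [← mul_neg, ← Real.log_inv, inv_div, Real.exp_nat_mul, Real.exp_log (by positivity)]

/-- With probability at least `1 - δ / 2`, all the tails of a sample of size `L ≤ T` have an
empirical distribution function uniformly close to that of the law. -/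
theorem measure_not_tailCDF_close_le (hp : p.Valid) (hφ : IsDemandDensity p φ) (hL : 0 < L)
    {T : ℕ} (hLT : L ≤ T) {δ : ℝ} (hδ : 0 < δ) (hδ2 : δ ≤ 1 / 2) :
    (Measure.pi fun _ : Fin L => demandLaw φ).real {v | ¬((∀ i, v i ∈ Icc p.d p.D) ∧
      ∀ j z, |tailCDF v j z - demandCDF φ z| ≤ (2 + 2 * p.Γ * (p.D - p.d)) *
        √(Real.log (T / δ) / (Finset.Ici j).card))} ≤ δ / 2 := by
  have := hφ.isProbabilityMeasure hp
  have hT : 1 ≤ T := hL.trans_le hLT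
  have hT' : (1 : ℝ) ≤ T := by exact_mod_cast hT
  have hL' : (1 : ℝ) ≤ L := by exact_mod_cast hL
  have hℓ := half_le_log_div hT hδ hδ2
  set ℓ := Real.log (T / δ) with hℓ_def
  set μ := Measure.pi fun _ : Fin L => demandLaw φ with hμ
  set ε : Fin L → ℝ := fun j => 2 * √(ℓ / (Finset.Ici j).card) with hε
  have hsub : {v : Fin L → ℝ | ¬((∀ i, v i ∈ Icc p.d p.D) ∧
      ∀ j z, |tailCDF v j z - demandCDF φ z| ≤ (2 + 2 * p.Γ * (p.D - p.d)) *
        √(ℓ / (Finset.Ici j).card))} ⊆ {v | ¬∀ i, v i ∈ Icc p.d p.D} ∪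
      ⋃ j : Fin L, ⋃ k : Fin (L + 1), {v | ε j ≤ |tailCDF v j (p.d + k * ((p.D - p.d) / L))
        - demandCDF φ (p.d + k * ((p.D - p.d) / L))|} := by
    intro v hv
    by_contra hcon
    rw [mem_union, not_or] at hcon
    have hv1 : ∀ i, v i ∈ Icc p.d p.D := not_not.1 hcon.1
    refine hv ⟨hv1, fun j z => ?_⟩
    have h2 : ∀ k : Fin (L + 1), |tailCDF v j (p.d + k * ((p.D - p.d) / L))
        - demandCDF φ (p.d + k * ((p.D - p.d) / L))| ≤ ε j := fun k => by
      have := hcon.2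
      simp only [mem_iUnion, not_exists] at this
      exact (not_le.1 (this j k)).le
    refine (abs_tailCDF_sub_le_of_grid hp hφ hL hv1 j h2 z).trans ?_
    -- The mesh is of smaller order than the deviation, because `ℓ ≥ 1 / 2`.
    have hn1 : (1 : ℝ) ≤ (Finset.Ici j).card := by
      exact_mod_cast Finset.card_pos.2 ⟨j, Finset.mem_Ici.2 le_rfl⟩
    have hnL : ((Finset.Ici j).card : ℝ) ≤ L := by
      rw [card_Ici_cast]; linarith [Nat.cast_nonneg (α := ℝ) j.1]
    have h3 : 1 / (L : ℝ) ≤ 2 * √(ℓ / (Finset.Ici j).card) := by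
      have : 1 / (L : ℝ) ≤ √(ℓ / (Finset.Ici j).card) * 2 := by
        rw [← div_le_iff₀ two_pos]
        refine Real.le_sqrt_of_sq_le ?_
        rw [div_div, div_pow, one_pow, div_le_div_iff₀ (by positivity) (by positivity), one_mul]
        have h5 : (L : ℝ) ≤ L ^ 2 := by nlinarith
        have h6 : (1 / 2) * (L * 2) ^ 2 ≤ ℓ * (L * 2 : ℝ) ^ 2 := by gcongr
        nlinarith
      linarith
    have h4 := mul_le_mul_of_nonneg_left h3
      (mul_nonneg hp.Γ_pos.le (sub_nonneg.2 hp.d_lt_D.le))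
    simp only [hε]
    have h5 : p.Γ * ((p.D - p.d) / L) = p.Γ * (p.D - p.d) * (1 / L) := by ring
    rw [h5]; linarith
  have hnull : μ.real {v | ¬∀ i, v i ∈ Icc p.d p.D} = 0 := by
    rw [Measure.real, ENNReal.toReal_eq_zero_iff]
    left
    exact ae_iff.1 (Filter.eventually_all.2 fun i =>
      (measurePreserving_eval (fun _ : Fin L => demandLaw φ) i).quasiMeasurePreserving.ae
        hφ.ae_mem_Icc)
  have hterm : ∀ (j : Fin L) (k : Fin (L + 1)), μ.real {v | ε j ≤
      |tailCDF v j (p.d + k * ((p.D - p.d) / L)) - demandCDF φ (p.d + k * ((p.D - p.d) / L))|}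
      ≤ 2 * (δ / T) ^ 8 := by
    intro j k
    refine (measure_le_abs_tailCDF_sub_le hp hφ j _ (by positivity)).trans (le_of_eq ?_)
    rw [← exp_neg_mul_log hT hδ, ← hℓ_def]
    have hn := card_Ici_pos j
    have : ε j ^ 2 = 4 * (ℓ / (Finset.Ici j).card) := by
      rw [hε, mul_pow, Real.sq_sqrt (by positivity)]; norm_num
    rw [this]
    congr 3
    push_cast
    field_simp; norm_num
  refine (measureReal_mono hsub).trans ((measureReal_union_le _ _).trans ?_)
  rw [hnull, zero_add]
  calc μ.real (⋃ j : Fin L, ⋃ k : Fin (L + 1), {v | ε j ≤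
        |tailCDF v j (p.d + k * ((p.D - p.d) / L)) - demandCDF φ (p.d + k * ((p.D - p.d) / L))|})
      ≤ ∑ _j : Fin L, ∑ _k : Fin (L + 1), 2 * (δ / T) ^ 8 :=
        (measureReal_iUnion_fintype_le _).trans (Finset.sum_le_sum fun j _ =>
          (measureReal_iUnion_fintype_le _).trans (Finset.sum_le_sum fun k _ => hterm j k))
    _ = L * ((L + 1) * (2 * (δ / T) ^ 8)) := by simp
    _ ≤ T * ((T + T) * (2 * (δ / T) ^ 8)) := by
        have : (L : ℝ) ≤ T := by exact_mod_cast hLT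
        gcongr
    _ = 4 * (δ / T) ^ 6 * δ ^ 2 := by field_simp; ring
    _ ≤ 4 * (1 / 2) ^ 6 * δ := by
        have h1 : δ / T ≤ 1 / 2 := (div_le_self hδ.le hT').trans hδ2
        have h2 : δ ^ 2 ≤ δ := by nlinarith
        gcongr
    _ ≤ δ / 2 := by linarith

end TailCDF

/-! ### The stochastic gradient and its means -/

/-- A bound for the sampled gradient. -/
def Params.gradBound (p : Params) : ℝ := p.h₁ + p.p₁ + p.h₂

theorem Params.Valid.gradBound_pos (hp : p.Valid) : 0 < p.gradBound :=
  add_pos hp.sum_pos hp.h₂_pos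

theorem abs_sampleGrad_le (hp : p.Valid) (s x w y : ℝ) : |sampleGrad p s x w y| ≤ p.gradBound := by
  have := hp.h₁_pos; have := hp.p₁_pos; have := hp.h₂_pos
  unfold sampleGrad Params.gradBound
  rw [abs_le]
  split_ifs <;> constructor <;> linarith

theorem measurable_sampleGrad (p : Params) :
    Measurable fun q : ℝ × ℝ × ℝ × ℝ => sampleGrad p q.1 q.2.1 q.2.2.1 q.2.2.2 := by
  unfold sampleGrad
  refine (Measurable.ite (measurableSet_le (by fun_prop) (by fun_prop)) measurable_const ?_).add
    (Measurable.const_mul (Measurable.ite (measurableSet_le (by fun_prop) (by fun_prop))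
      measurable_const measurable_const) _)
  exact (Measurable.const_mul (Measurable.ite (measurableSet_le (by fun_prop) (by fun_prop))
      measurable_const measurable_const) _).sub measurable_const

/-- The mean of the sampled gradient over the current demand, the previous demand being `w`. -/
noncomputable def gradMean (p : Params) (φ : ℝ → ℝ) (s x w : ℝ) : ℝ :=
  (if w ≤ x then 0 else expCostDeriv p φ (s + x - w)) + p.h₂ * demandCDF φ x

theorem expCostDeriv_mem_Icc (hp : p.Valid) (hφ : IsDemandDensity p φ) (u : ℝ) :
    expCostDeriv p φ u ∈ Icc (-p.p₁) p.h₁ := by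
  have h1 := mul_nonneg hp.sum_pos.le (demandCDF_nonneg (φ := φ) u)
  have h2 := mul_le_mul_of_nonneg_left (demandCDF_le_one hp hφ u) hp.sum_pos.le
  unfold expCostDeriv
  constructor <;> linarith

theorem abs_gradMean_le (hp : p.Valid) (hφ : IsDemandDensity p φ) (s x w : ℝ) :
    |gradMean p φ s x w| ≤ p.gradBound := by
  have h1 := expCostDeriv_mem_Icc hp hφ (s + x - w)
  have h2 := mul_nonneg hp.h₂_pos.le (demandCDF_nonneg (φ := φ) x)
  have h3 := mul_le_mul_of_nonneg_left (demandCDF_le_one hp hφ x) hp.h₂_pos.le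
  have := hp.h₁_pos; have := hp.p₁_pos; have := hp.h₂_pos
  have h4 := h1.1
  have h5 := h1.2
  unfold gradMean Params.gradBound
  rw [abs_le]
  split_ifs <;> constructor <;> linarith

theorem measurable_gradMean (hp : p.Valid) (hφ : IsDemandDensity p φ) (s : ℝ) :
    Measurable fun q : ℝ × ℝ => gradMean p φ s q.1 q.2 := by
  have h1 := (expCostDeriv_continuous hp hφ).measurable
  have h2 := (demandCDF_continuous hp hφ).measurable
  unfold gradMean
  exact (Measurable.ite (measurableSet_le (by fun_prop) (by fun_prop)) measurable_const
    (by fun_prop)).add (by fun_prop)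

theorem abs_gradMean_sub_level_le (hp : p.Valid) (hφ : IsDemandDensity p φ) (s t x w : ℝ) :
    |gradMean p φ s x w - gradMean p φ t x w| ≤ (p.h₁ + p.p₁) * p.Γ * |s - t| := by
  unfold gradMean
  rw [add_sub_add_right_eq_sub]
  split_ifs
  · have := hp.sum_pos; have := hp.Γ_pos
    rw [sub_self, abs_zero]; positivity
  · have := abs_expCostDeriv_sub_le hp hφ (s + x - w) (t + x - w)
    rwa [show s + x - w - (t + x - w) = s - t by ring] at this

/-- At Agent 1's best level, the mean gradient is a continuous function of Agent 2's level `x`,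
up to an indicator function. -/
theorem gradMean_bestLevel₁ (hp : p.Valid) (hφ : IsDemandDensity p φ) (x w : ℝ) :
    gradMean p φ (bestLevel₁ p φ) x w = expCostDeriv p φ (bestLevel₁ p φ + min 0 (x - w))
      - p.h₂ * (if w ≤ x then 1 else 0) + p.h₂ * demandCDF φ x := by
  unfold gradMean
  split_ifs with h
  · rw [min_eq_left (by linarith), add_zero, expCostDeriv_bestLevel₁ hp hφ]; ring
  · rw [min_eq_right (by linarith), add_sub_assoc]; ring

/-- The indicator of the interval `(x - ρ, x + ρ]`. -/
noncomputable def nearInd (ρ x y : ℝ) : ℝ :=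
  (if y ≤ x + ρ then 1 else 0) - (if y ≤ x - ρ then 1 else 0)

theorem nearInd_mem_Icc {ρ : ℝ} (hρ : 0 ≤ ρ) (x y : ℝ) : nearInd ρ x y ∈ Icc (0 : ℝ) 1 := by
  unfold nearInd
  split_ifs with h1 h2 h2
  · norm_num
  · norm_num
  · exact absurd (by linarith) h1
  · norm_num

theorem measurable_nearInd (ρ : ℝ) : Measurable fun q : ℝ × ℝ => nearInd ρ q.1 q.2 := by
  unfold nearInd
  exact (Measurable.ite (measurableSet_le (by fun_prop) (by fun_prop)) measurable_const
    measurable_const).sub (Measurable.ite (measurableSet_le (by fun_prop) (by fun_prop))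
      measurable_const measurable_const)

/-- Moving Agent 2's level by at most `ρ` changes the mean gradient by `O(ρ)`, unless it is moved
across the previous demand. -/
theorem abs_gradMean_sub_le (hp : p.Valid) (hφ : IsDemandDensity p φ) {ρ x x' : ℝ}
    (h : |x' - x| ≤ ρ) (w : ℝ) :
    |gradMean p φ (bestLevel₁ p φ) x' w - gradMean p φ (bestLevel₁ p φ) x w|
      ≤ p.gradBound * p.Γ * ρ + p.h₂ * nearInd ρ x w := by
  have hh := hp.h₂_pos
  have hΓ := hp.Γ_pos
  rw [gradMean_bestLevel₁ hp hφ, gradMean_bestLevel₁ hp hφ]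
  have h1 : |expCostDeriv p φ (bestLevel₁ p φ + min 0 (x' - w))
      - expCostDeriv p φ (bestLevel₁ p φ + min 0 (x - w))| ≤ (p.h₁ + p.p₁) * p.Γ * ρ := by
    refine (abs_expCostDeriv_sub_le hp hφ _ _).trans ?_
    refine mul_le_mul_of_nonneg_left ?_ (mul_nonneg hp.sum_pos.le hΓ.le)
    rw [add_sub_add_left_eq_sub, min_comm, min_comm 0 (x - w)]
    exact (abs_min_sub_min_le_max _ _ _ _).trans (by simpa using h)
  have h2 : |(if w ≤ x' then (1 : ℝ) else 0) - (if w ≤ x then 1 else 0)| ≤ nearInd ρ x w := by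
    rw [abs_le] at h
    unfold nearInd
    split_ifs <;> first | (exfalso; linarith) | norm_num
  have h3 : |demandCDF φ x' - demandCDF φ x| ≤ p.Γ * ρ :=
    (abs_demandCDF_sub_le hp hφ _ _).trans (mul_le_mul_of_nonneg_left h hΓ.le)
  have h2' := mul_le_mul_of_nonneg_left h2 hh.le
  have h3' := mul_le_mul_of_nonneg_left h3 hh.le
  rw [← abs_of_pos hh, ← abs_mul, abs_of_pos hh] at h2' h3'
  unfold Params.gradBound
  rw [abs_le] at h1 h2' h3' ⊢
  constructor <;> linarith

section Means

variable {L : ℕ} (v : Fin L → ℝ) (j : Fin L)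

theorem tailMean_add (f g : ℝ → ℝ) :
    tailMean v j (fun y => f y + g y) = tailMean v j f + tailMean v j g := by
  simp only [tailMean, Finset.sum_add_distrib, add_div]

theorem tailMean_sub (f g : ℝ → ℝ) :
    tailMean v j (fun y => f y - g y) = tailMean v j f - tailMean v j g := by
  simp only [tailMean, Finset.sum_sub_distrib, sub_div]

theorem tailMean_const_mul (c : ℝ) (f : ℝ → ℝ) :
    tailMean v j (fun y => c * f y) = c * tailMean v j f := by
  simp only [tailMean, ← Finset.mul_sum, mul_div_assoc]

theorem tailMean_nearInd (ρ x : ℝ) :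
    tailMean v j (nearInd ρ x) = tailCDF v j (x + ρ) - tailCDF v j (x - ρ) :=
  tailMean_sub v j _ _

theorem tailMean_sampleGrad (s x w : ℝ) :
    tailMean v j (sampleGrad p s x w)
      = (if w ≤ x then 0 else (p.h₁ + p.p₁) * tailCDF v j (s + x - w) - p.p₁)
        + p.h₂ * tailCDF v j x := by
  have : sampleGrad p s x w = fun y =>
      (if w ≤ x then 0 else (p.h₁ + p.p₁) * (if y ≤ s + x - w then 1 else 0) - p.p₁)
        + p.h₂ * (if y ≤ x then 1 else 0) := rfl
  rw [this, tailMean_add, tailMean_const_mul]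
  congr 1
  split_ifs
  · exact tailMean_const v j 0
  · rw [tailMean_sub, tailMean_const_mul, tailMean_const]; rfl

variable {v j}

theorem abs_tailMean_sampleGrad_sub_le (hp : p.Valid) {ε : ℝ}
    (hε : ∀ z, |tailCDF v j z - demandCDF φ z| ≤ ε) (s x w : ℝ) :
    |tailMean v j (sampleGrad p s x w) - gradMean p φ s x w| ≤ p.gradBound * ε := by
  have hε0 : 0 ≤ ε := (abs_nonneg _).trans (hε 0)
  have h1 := mul_le_mul_of_nonneg_left (hε (s + x - w)) hp.sum_pos.le
  have h2 := mul_le_mul_of_nonneg_left (hε x) hp.h₂_pos.le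
  rw [← abs_of_pos hp.sum_pos, ← abs_mul, abs_of_pos hp.sum_pos] at h1
  rw [← abs_of_pos hp.h₂_pos, ← abs_mul, abs_of_pos hp.h₂_pos] at h2
  have h0 := mul_nonneg hp.sum_pos.le hε0
  rw [tailMean_sampleGrad]
  unfold gradMean expCostDeriv Params.gradBound
  rw [abs_le] at h1 h2 ⊢
  split_ifs <;> constructor <;> linarith

/-- The values of the distribution function along a moving threshold, averaged against a law or an
empirical law, are again averages of a distribution function; hence uniform closeness of the
distribution functions carries over to these averages. -/
theorem abs_tailMean_demandCDF_sub_le (hp : p.Valid) (hφ : IsDemandDensity p φ) {ε : ℝ}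
    (hε : ∀ z, |tailCDF v j z - demandCDF φ z| ≤ ε) (s x : ℝ) :
    |tailMean v j (fun w => demandCDF φ (s + min 0 (x - w)))
      - ∫ w, demandCDF φ (s + min 0 (x - w)) ∂demandLaw φ| ≤ ε := by
  have := hφ.isProbabilityMeasure hp
  set ν := demandLaw φ with hν
  set K : ℝ → ℝ → ℝ := fun w u => (if u ≤ s then 1 else 0) * (if w ≤ s + x - u then 1 else 0)
    with hK
  have hKm : Measurable (Function.uncurry K) := by
    unfold Function.uncurry
    exact (Measurable.ite (measurableSet_le (by fun_prop) (by fun_prop)) measurable_const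
      measurable_const).mul (Measurable.ite (measurableSet_le (by fun_prop) (by fun_prop))
        measurable_const measurable_const)
  have hKb : ∀ w u, |K w u| ≤ 1 := by
    intro w u; simp only [hK]; split_ifs <;> simp
  have hKw : ∀ w, Integrable (K w) ν := fun w =>
    Integrable.of_bound (hKm.of_uncurry_left).aestronglyMeasurable 1
      (Filter.Eventually.of_forall fun u => hKb w u)
  have hF : ∀ w, demandCDF φ (s + min 0 (x - w)) = ∫ u, K w u ∂ν := by
    intro w
    rw [← integral_indicator_le]
    refine integral_congr_ae (Filter.Eventually.of_forall fun u => ?_)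
    simp only [hK]
    rcases min_cases 0 (x - w) with ⟨h, h'⟩ | ⟨h, h'⟩ <;> rw [h] <;> split_ifs <;>
      first | (exfalso; linarith) | norm_num
  have hint : Integrable (Function.uncurry K) (ν.prod ν) :=
    Integrable.of_bound hKm.aestronglyMeasurable 1
      (Filter.Eventually.of_forall fun q => hKb q.1 q.2)
  have e1 : ∫ w, demandCDF φ (s + min 0 (x - w)) ∂ν
      = ∫ u, (if u ≤ s then 1 else 0) * demandCDF φ (s + x - u) ∂ν := by
    simp only [hF]
    rw [integral_integral_swap hint]
    refine integral_congr_ae (Filter.Eventually.of_forall fun u => ?_)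
    simp only [hK]
    rw [integral_const_mul, integral_indicator_le]
  have e2 : tailMean v j (fun w => demandCDF φ (s + min 0 (x - w)))
      = ∫ u, (if u ≤ s then 1 else 0) * tailCDF v j (s + x - u) ∂ν := by
    simp only [hF]
    rw [tailMean, ← integral_finsetSum _ fun i _ => hKw (v i), ← integral_div]
    refine integral_congr_ae (Filter.Eventually.of_forall fun u => ?_)
    simp only [hK, tailCDF, tailMean]
    rw [← Finset.mul_sum, mul_div_assoc]
  have i1 : Integrable (fun u => (if u ≤ s then (1 : ℝ) else 0) * demandCDF φ (s + x - u)) ν := by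
    have hm := (demandCDF_continuous hp hφ).measurable
    refine Integrable.of_bound ((Measurable.ite measurableSet_Iic measurable_const
      measurable_const).mul (by fun_prop)).aestronglyMeasurable 1
      (Filter.Eventually.of_forall fun u => ?_)
    have h0 := demandCDF_nonneg (φ := φ) (s + x - u)
    have h1 := demandCDF_le_one hp hφ (s + x - u)
    rw [Real.norm_eq_abs, abs_le]
    split_ifs <;> constructor <;> linarith
  have i2 : Integrable (fun u => (if u ≤ s then (1 : ℝ) else 0) * tailCDF v j (s + x - u)) ν := by
    refine Integrable.of_bound ((Measurable.ite measurableSet_Iic measurable_const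
      measurable_const).mul ((tailCDF_mono v j).measurable.comp (by fun_prop))).aestronglyMeasurable
      1 (Filter.Eventually.of_forall fun u => ?_)
    have := abs_tailMean_le v j (f := fun y => if y ≤ s + x - u then 1 else 0) (B := 1)
      (fun y => by split_ifs <;> simp)
    rw [norm_mul]
    refine mul_le_one₀ (by split_ifs <;> simp) (norm_nonneg _) this
  rw [e1, e2, ← integral_sub i2 i1]
  have := norm_integral_le_of_norm_le_const (μ := ν) (C := ε)
    (f := fun u => (if u ≤ s then (1 : ℝ) else 0) * tailCDF v j (s + x - u)
      - (if u ≤ s then (1 : ℝ) else 0) * demandCDF φ (s + x - u))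
    (Filter.Eventually.of_forall fun u => by
      rw [← mul_sub, Real.norm_eq_abs]
      split_ifs
      · rw [one_mul]; exact hε _
      · rw [zero_mul, abs_zero]; exact (abs_nonneg _).trans (hε 0))
  simpa using this

theorem abs_tailMean_gradMean_sub_le (hp : p.Valid) (hφ : IsDemandDensity p φ) {ε : ℝ}
    (hε : ∀ z, |tailCDF v j z - demandCDF φ z| ≤ ε) (x : ℝ) :
    |tailMean v j (gradMean p φ (bestLevel₁ p φ) x) - lossDeriv p φ x| ≤ p.gradBound * ε := by
  have := hφ.isProbabilityMeasure hp
  set s := bestLevel₁ p φ with hs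
  have e1 : tailMean v j (gradMean p φ s x)
      = (p.h₁ + p.p₁) * tailMean v j (fun w => demandCDF φ (s + min 0 (x - w))) - p.p₁
        - p.h₂ * tailCDF v j x + p.h₂ * demandCDF φ x := by
    have : gradMean p φ s x = fun w => (p.h₁ + p.p₁) * demandCDF φ (s + min 0 (x - w)) - p.p₁
        - p.h₂ * (if w ≤ x then 1 else 0) + p.h₂ * demandCDF φ x := by
      ext w; rw [hs, gradMean_bestLevel₁ hp hφ, expCostDeriv]
    rw [this, tailMean_add, tailMean_sub, tailMean_sub, tailMean_const_mul, tailMean_const_mul,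
      tailMean_const, tailMean_const]
    rfl
  have e2 : lossDeriv p φ x
      = (p.h₁ + p.p₁) * (∫ w, demandCDF φ (s + min 0 (x - w)) ∂demandLaw φ) - p.p₁ := by
    unfold lossDeriv expCostDeriv
    rw [integral_sub _ (integrable_const _), integral_const_mul]
    · simp [hs]
    · exact (hφ.integrable_of_continuous hp ((demandCDF_continuous hp hφ).comp
        (by fun_prop))).const_mul _
  have h1 := mul_le_mul_of_nonneg_left (abs_tailMean_demandCDF_sub_le hp hφ hε s x) hp.sum_pos.le
  have h2 := mul_le_mul_of_nonneg_left (hε x) hp.h₂_pos.le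
  rw [← abs_of_pos hp.sum_pos, ← abs_mul, abs_of_pos hp.sum_pos] at h1
  rw [← abs_of_pos hp.h₂_pos, ← abs_mul, abs_of_pos hp.h₂_pos] at h2
  rw [e1, e2]
  unfold Params.gradBound
  rw [abs_le] at h1 h2 ⊢
  constructor <;> linarith

end Means

/-! ### The iterates of the stochastic gradient descent -/

section Iterates

variable {L : ℕ}

/-- The entry number `i` of a sample, extended by `0`. -/
def entry (x : Fin L → ℝ) (i : ℕ) : ℝ := if h : i < L then x ⟨i, h⟩ else 0

/-- The entry before the entry number `j`, which is `d₀` if there is none. -/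
def prevEntry (x : Fin L → ℝ) (d₀ : ℝ) (j : ℕ) : ℝ := if j = 0 then d₀ else entry x (j - 1)

theorem entry_coe (x : Fin L → ℝ) (j : Fin L) : entry x j = x j := by simp [entry]

/-- The stochastic gradient of the augmented loss in step `j` of the descent. -/
noncomputable def ogdGrad (p : Params) (T : ℕ) (δ : ℝ) (x : Fin L → ℝ) (y d₀ : ℝ) (j : ℕ) : ℝ :=
  sampleGrad p (quantile (empCDF x) p.ratio) (ogdIter p T δ x y d₀ j) (prevEntry x d₀ j) (entry x j)
    + augWeight p T δ L * empCDF x (ogdIter p T δ x y d₀ j)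

theorem ogdIter_succ (p : Params) (T : ℕ) (δ : ℝ) (x : Fin L → ℝ) (y d₀ : ℝ) (j : ℕ) :
    ogdIter p T δ x y d₀ (j + 1) = min p.sMax (max 0 (ogdIter p T δ x y d₀ j
      - p.c / √L * ogdGrad p T δ x y d₀ j)) := rfl

theorem measurable_entry (i : ℕ) : Measurable fun x : Fin L → ℝ => entry x i := by
  unfold entry
  split_ifs with h
  · exact measurable_pi_apply _
  · exact measurable_const

theorem measurable_prevEntry (d₀ : ℝ) (j : ℕ) :
    Measurable fun x : Fin L → ℝ => prevEntry x d₀ j := by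
  unfold prevEntry
  split_ifs with h
  · exact measurable_const
  · exact measurable_entry _

theorem entry_comp_perm (x : Fin L → ℝ) {σ : Equiv.Perm (Fin L)} {j : ℕ}
    (hσ : ∀ i : Fin L, i.1 < j → σ i = i) {i : ℕ} (hi : i < j) : entry (x ∘ σ) i = entry x i := by
  unfold entry
  split_ifs with h
  · rw [Function.comp_apply, hσ ⟨i, h⟩ hi]
  · rfl

theorem prevEntry_comp_perm (x : Fin L → ℝ) (d₀ : ℝ) {σ : Equiv.Perm (Fin L)} {j : ℕ}
    (hσ : ∀ i : Fin L, i.1 < j → σ i = i) : prevEntry (x ∘ σ) d₀ j = prevEntry x d₀ j := by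
  unfold prevEntry
  split_ifs with h
  · rfl
  · exact entry_comp_perm x hσ (by omega)

/-- The iterate number `j` depends on the first `j` entries of the sample and, through the empirical
distribution, on the unordered collection of all entries. -/
theorem ogdIter_comp_perm (p : Params) (T : ℕ) (δ : ℝ) (x : Fin L → ℝ) (y d₀ : ℝ)
    {σ : Equiv.Perm (Fin L)} {j : ℕ} (hσ : ∀ i : Fin L, i.1 < j → σ i = i) :
    ogdIter p T δ (x ∘ σ) y d₀ j = ogdIter p T δ x y d₀ j := by
  induction j with
  | zero => rfl
  | succ j ih =>
    have ih' := ih fun i hi => hσ i (by omega)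
    rw [ogdIter_succ, ogdIter_succ, ogdGrad, ogdGrad, ih', empCDF_comp_perm,
      prevEntry_comp_perm x d₀ fun i hi => hσ i (by omega), entry_comp_perm x hσ j.lt_succ_self]

theorem measurable_ogdIter (hp : p.Valid) (hL : 0 < L) (T : ℕ) (δ y d₀ : ℝ) (j : ℕ) :
    Measurable fun x : Fin L → ℝ => ogdIter p T δ x y d₀ j := by
  induction j with
  | zero => exact measurable_const
  | succ j ih =>
    have h1 : Measurable fun x : Fin L → ℝ => ogdGrad p T δ x y d₀ j := by
      unfold ogdGrad
      refine Measurable.add ?_ (Measurable.const_mul ?_ _)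
      · exact (measurable_sampleGrad p).comp ((measurable_quantile_empCDF hL hp.ratio_pos
          hp.ratio_le_one).prodMk (ih.prodMk ((measurable_prevEntry d₀ j).prodMk
            (measurable_entry j))))
      · exact measurable_empCDF.comp (measurable_id.prodMk ih)
    simp only [ogdIter_succ]
    fun_prop

theorem ogdIter_succ_mem_Icc (hs : 0 ≤ p.sMax) (T : ℕ) (δ : ℝ) (x : Fin L → ℝ) (y d₀ : ℝ) (j : ℕ) :
    ogdIter p T δ x y d₀ (j + 1) ∈ Icc 0 p.sMax := by
  rw [ogdIter_succ]
  exact ⟨le_min hs (le_max_left _ _), min_le_left _ _⟩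

theorem ogdIter_mem_Icc (hs : 0 ≤ p.sMax) (T : ℕ) (δ : ℝ) (x : Fin L → ℝ) {y b : ℝ}
    (hy : y ∈ Icc b p.sMax) (d₀ : ℝ) (j : ℕ) :
    ogdIter p T δ x y d₀ j ∈ Icc (min b 0) p.sMax := by
  cases j with
  | zero => exact ⟨(min_le_left _ _).trans hy.1, hy.2⟩
  | succ j =>
    have := ogdIter_succ_mem_Icc hs T δ x y d₀ j
    exact ⟨(min_le_right _ _).trans this.1, this.2⟩

theorem clip_sub_sq_le {s z t : ℝ} (hz : z ∈ Icc 0 s) :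
    (min s (max 0 t) - z) ^ 2 ≤ (t - z) ^ 2 := by
  rw [sq_le_sq]
  have h1 : |min s (max 0 t) - min s z| ≤ |max 0 t - z| := by
    simpa using abs_min_sub_min_le_max s (max 0 t) s z
  have h2 : |max 0 t - max 0 z| ≤ |t - z| := by
    simpa using abs_max_sub_max_le_max 0 t 0 z
  rw [min_eq_right hz.2] at h1
  rw [max_eq_right hz.1] at h2
  exact h1.trans h2

/-- The regret inequality of projected gradient descent against linear losses. -/
theorem two_mul_sum_mul_ogdGrad_le (hp : p.Valid) (T : ℕ) (δ : ℝ) (x : Fin L → ℝ) (y d₀ : ℝ)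
    {z G : ℝ}
    (hz : z ∈ Icc 0 p.sMax) (hG : ∀ j, |ogdGrad p T δ x y d₀ j| ≤ G) (n : ℕ) :
    2 * (p.c / √L) * ∑ j ∈ Finset.range n, (ogdIter p T δ x y d₀ j - z) * ogdGrad p T δ x y d₀ j
      ≤ (y - z) ^ 2 - (ogdIter p T δ x y d₀ n - z) ^ 2 + n * (p.c / √L) ^ 2 * G ^ 2 := by
  have hη : 0 ≤ p.c / √L := div_nonneg hp.c_pos.le (Real.sqrt_nonneg _)
  set η := p.c / √L with hη_def
  induction n with
  | zero => simp [ogdIter]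
  | succ n ih =>
    rw [Finset.sum_range_succ, mul_add]
    have h1 := clip_sub_sq_le (t := ogdIter p T δ x y d₀ n - η * ogdGrad p T δ x y d₀ n) hz
    rw [hη_def, ← ogdIter_succ, ← hη_def] at h1
    have h2 : ogdGrad p T δ x y d₀ n ^ 2 ≤ G ^ 2 := by
      rw [← sq_abs]; gcongr; exact hG n
    have h3 := mul_le_mul_of_nonneg_left h2 (sq_nonneg η)
    push_cast
    linarith

theorem abs_ogdIter_succ_sub_le (hp : p.Valid) (T : ℕ) (δ : ℝ) (x : Fin L → ℝ) (y d₀ : ℝ)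
    {G : ℝ} {j : ℕ}
    (hj : ogdIter p T δ x y d₀ j ∈ Icc 0 p.sMax) (hG : |ogdGrad p T δ x y d₀ j| ≤ G) :
    |ogdIter p T δ x y d₀ (j + 1) - ogdIter p T δ x y d₀ j| ≤ p.c / √L * G := by
  have hη : 0 ≤ p.c / √L := div_nonneg hp.c_pos.le (Real.sqrt_nonneg _)
  have h1 := clip_sub_sq_le
    (t := ogdIter p T δ x y d₀ j - p.c / √L * ogdGrad p T δ x y d₀ j) hj
  rw [← ogdIter_succ, sq_le_sq] at h1
  refine h1.trans ?_
  rw [sub_sub_cancel_left, abs_neg, abs_mul, abs_of_nonneg hη]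
  exact mul_le_mul_of_nonneg_left hG hη

end Iterates

/-! ### The regret of the descent against the exact gradient -/

section Descent

variable {L : ℕ}

/-- The fluctuation of the sampled gradient around its mean over the current demand. -/
noncomputable def gradNoise (p : Params) (T : ℕ) (δ y d₀ z : ℝ) (j : Fin L) (x : Fin L → ℝ) :
    ℝ → ℝ := fun w => (z - ogdIter p T δ x y d₀ j) *
  sampleGrad p (quantile (empCDF x) p.ratio) (ogdIter p T δ x y d₀ j) (prevEntry x d₀ j) w

/-- The fluctuation of the gradient, averaged over the current demand, that is due to the
demand before. -/
noncomputable def meanNoise (p : Params) (φ : ℝ → ℝ) (T : ℕ) (δ y d₀ z : ℝ) (j : Fin L)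
    (x : Fin L → ℝ) : ℝ → ℝ := fun w => (z - ogdIter p T δ x y d₀ j) *
  gradMean p φ (bestLevel₁ p φ) (ogdIter p T δ x y d₀ j) w

/-- The indicator that a demand is within `ρ` of the current iterate. -/
noncomputable def nearNoise (p : Params) (T : ℕ) (δ y d₀ ρ : ℝ) (j : Fin L) (x : Fin L → ℝ) :
    ℝ → ℝ := nearInd ρ (ogdIter p T δ x y d₀ j)

theorem isPredictable_gradNoise (hp : p.Valid) (hL : 0 < L) (T : ℕ) (δ y d₀ z : ℝ) :
    IsPredictable (gradNoise (L := L) p T δ y d₀ z) := by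
  refine ⟨fun j => ?_, fun j v σ hσ => ?_⟩
  · have h1 := measurable_ogdIter hp hL T δ y d₀ j
    have h2 := measurable_quantile_empCDF hL hp.ratio_pos hp.ratio_le_one
    have h3 := measurable_prevEntry (L := L) d₀ j
    exact ((measurable_const.sub h1).comp measurable_fst).mul ((measurable_sampleGrad p).comp
      ((h2.comp measurable_fst).prodMk ((h1.comp measurable_fst).prodMk
        ((h3.comp measurable_fst).prodMk measurable_snd))))
  · unfold gradNoise
    rw [ogdIter_comp_perm p T δ v y d₀ (j := j.1) fun i hi => hσ i hi, empCDF_comp_perm,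
      prevEntry_comp_perm v d₀ (j := j.1) fun i hi => hσ i hi]

theorem isPredictable_meanNoise (hp : p.Valid) (hφ : IsDemandDensity p φ) (hL : 0 < L) (T : ℕ)
    (δ y d₀ z : ℝ) : IsPredictable (meanNoise (L := L) p φ T δ y d₀ z) := by
  refine ⟨fun j => ?_, fun j v σ hσ => ?_⟩
  · have h1 := measurable_ogdIter hp hL T δ y d₀ j
    exact ((measurable_const.sub h1).comp measurable_fst).mul ((measurable_gradMean hp hφ _).comp
      ((h1.comp measurable_fst).prodMk measurable_snd))
  · unfold meanNoise
    rw [ogdIter_comp_perm p T δ v y d₀ (j := j.1) fun i hi => hσ i hi]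

theorem isPredictable_nearNoise (hp : p.Valid) (hL : 0 < L) (T : ℕ) (δ y d₀ ρ : ℝ) :
    IsPredictable (nearNoise (L := L) p T δ y d₀ ρ) := by
  refine ⟨fun j => ?_, fun j v σ hσ => ?_⟩
  · have h1 := measurable_ogdIter hp hL T δ y d₀ j
    exact (measurable_nearInd ρ).comp ((h1.comp measurable_fst).prodMk measurable_snd)
  · unfold nearNoise
    rw [ogdIter_comp_perm p T δ v y d₀ (j := j.1) fun i hi => hσ i hi]

variable {T : ℕ} {δ y d₀ z R G : ℝ} {x : Fin L → ℝ}

/-- Replacing the sampled gradient by its mean over the current demand. -/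
theorem mul_gradMean_prevEntry_le (hp : p.Valid) (hφ : IsDemandDensity p φ) (j : Fin L)
    (hR : |ogdIter p T δ x y d₀ j - z| ≤ R) {ε σ : ℝ}
    (hε : ∀ t, |tailCDF x j t - demandCDF φ t| ≤ ε)
    (hσ : |quantile (empCDF x) p.ratio - bestLevel₁ p φ| ≤ σ) :
    (ogdIter p T δ x y d₀ j - z) *
        gradMean p φ (bestLevel₁ p φ) (ogdIter p T δ x y d₀ j) (prevEntry x d₀ j)
      ≤ (ogdIter p T δ x y d₀ j - z) * ogdGrad p T δ x y d₀ j
        + tailDev (gradNoise p T δ y d₀ z) j x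
        + R * (p.gradBound * ε + (p.h₁ + p.p₁) * p.Γ * σ + augWeight p T δ L) := by
  set a := ogdIter p T δ x y d₀ j with ha
  set w := prevEntry x d₀ j with hw
  set s := quantile (empCDF x) p.ratio with hs
  have hR0 : 0 ≤ R := (abs_nonneg _).trans hR
  have h1 := abs_tailMean_sampleGrad_sub_le hp hε s a w
  have h2 := (abs_gradMean_sub_level_le hp hφ s (bestLevel₁ p φ) a w).trans
    (mul_le_mul_of_nonneg_left hσ (mul_nonneg hp.sum_pos.le hp.Γ_pos.le))
  have haug : 0 ≤ augWeight p T δ L :=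
    mul_nonneg (mul_nonneg hp.C₁_pos.le hp.sum_pos.le) (Real.sqrt_nonneg _)
  have h3 : |augWeight p T δ L * empCDF x a| ≤ augWeight p T δ L := by
    rw [abs_of_nonneg (mul_nonneg haug (empCDF_nonneg x a))]
    exact mul_le_of_le_one_right haug (empCDF_le_one x a)
  have hdev : tailDev (gradNoise p T δ y d₀ z) j x
      = (z - a) * (sampleGrad p s a w (x j) - tailMean x j (sampleGrad p s a w)) := by
    unfold tailDev gradNoise
    rw [tailMean_const_mul, mul_sub]
  have hgrad : ogdGrad p T δ x y d₀ j = sampleGrad p s a w (x j)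
      + augWeight p T δ L * empCDF x a := by
    rw [ogdGrad, entry_coe]
  have key : (a - z) * gradMean p φ (bestLevel₁ p φ) a w
      = (a - z) * ogdGrad p T δ x y d₀ j + tailDev (gradNoise p T δ y d₀ z) j x
        + (a - z) * ((gradMean p φ (bestLevel₁ p φ) a w - gradMean p φ s a w)
          + (gradMean p φ s a w - tailMean x j (sampleGrad p s a w))
          - augWeight p T δ L * empCDF x a) := by
    rw [hdev, hgrad]; ring
  rw [key]
  refine add_le_add_right ?_ _
  refine (le_abs_self _).trans ?_
  rw [abs_mul]
  refine mul_le_mul hR ?_ (abs_nonneg _) hR0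
  rw [abs_le] at h1 h2 h3 ⊢
  constructor <;> linarith

/-- Replacing the mean gradient given the demand before by its mean over that demand. -/
theorem mul_lossDeriv_le (hp : p.Valid) (hφ : IsDemandDensity p φ) (j : Fin L)
    (hR : |ogdIter p T δ x y d₀ j - z| ≤ R) {ε : ℝ}
    (hε : ∀ t, |tailCDF x j t - demandCDF φ t| ≤ ε) :
    (ogdIter p T δ x y d₀ j - z) * lossDeriv p φ (ogdIter p T δ x y d₀ j)
      ≤ (ogdIter p T δ x y d₀ j - z) *
        gradMean p φ (bestLevel₁ p φ) (ogdIter p T δ x y d₀ j) (x j)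
        + tailDev (meanNoise p φ T δ y d₀ z) j x + R * (p.gradBound * ε) := by
  set a := ogdIter p T δ x y d₀ j with ha
  set s := bestLevel₁ p φ with hs
  have hR0 : 0 ≤ R := (abs_nonneg _).trans hR
  have h1 := abs_tailMean_gradMean_sub_le hp hφ hε a
  have hdev : tailDev (meanNoise p φ T δ y d₀ z) j x
      = (z - a) * (gradMean p φ s a (x j) - tailMean x j (gradMean p φ s a)) := by
    unfold tailDev meanNoise
    rw [tailMean_const_mul, mul_sub]
  have key : (a - z) * lossDeriv p φ a = (a - z) * gradMean p φ s a (x j)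
      + tailDev (meanNoise p φ T δ y d₀ z) j x
      + (a - z) * (lossDeriv p φ a - tailMean x j (gradMean p φ s a)) := by
    rw [hdev]; ring
  rw [key]
  refine add_le_add_right ((le_abs_self _).trans ?_) _
  rw [abs_mul]
  refine mul_le_mul hR ?_ (abs_nonneg _) hR0
  rwa [abs_sub_comm]

theorem nearInd_le (hp : p.Valid) (hφ : IsDemandDensity p φ) (j : Fin L) {ρ ε : ℝ} (hρ : 0 ≤ ρ)
    (hε : ∀ t, |tailCDF x j t - demandCDF φ t| ≤ ε) :
    nearInd ρ (ogdIter p T δ x y d₀ j) (x j)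
      ≤ tailDev (nearNoise p T δ y d₀ ρ) j x + (2 * p.Γ * ρ + 2 * ε) := by
  set a := ogdIter p T δ x y d₀ j with ha
  have hdev : tailDev (nearNoise p T δ y d₀ ρ) j x
      = nearInd ρ a (x j) - (tailCDF x j (a + ρ) - tailCDF x j (a - ρ)) := by
    unfold tailDev nearNoise
    rw [tailMean_nearInd]
  have h1 := hε (a + ρ)
  have h2 := hε (a - ρ)
  have h3 := demandCDF_sub_le hp hφ (show a - ρ ≤ a + ρ by linarith)
  rw [hdev]
  rw [abs_le] at h1 h2
  linarith

/-- Pairing an iterate with the current demand instead of the demand before. The iterates move by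
at most `ρ` in a step, apart from the first one, which may start below `0`. -/
theorem sum_mul_gradMean_le (hp : p.Valid) (hφ : IsDemandDensity p φ) (hL : 0 < L)
    (hs : 0 ≤ p.sMax) {ρ : ℝ} (hρ : p.c / √L * G ≤ ρ) (hρ0 : 0 ≤ ρ)
    (hR : ∀ j, |ogdIter p T δ x y d₀ j - z| ≤ R) (hG : ∀ j, |ogdGrad p T δ x y d₀ j| ≤ G) :
    ∑ j ∈ Finset.range L, (ogdIter p T δ x y d₀ j - z) *
        gradMean p φ (bestLevel₁ p φ) (ogdIter p T δ x y d₀ j) (entry x j)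
      ≤ ∑ j ∈ Finset.range L, (ogdIter p T δ x y d₀ j - z) *
        gradMean p φ (bestLevel₁ p φ) (ogdIter p T δ x y d₀ j) (prevEntry x d₀ j)
        + L * (ρ * p.gradBound + R * (p.gradBound * p.Γ * ρ))
        + R * p.h₂ * ∑ j ∈ Finset.range L, nearInd ρ (ogdIter p T δ x y d₀ j) (entry x j)
        + 4 * R * p.gradBound := by
  set a : ℕ → ℝ := fun j => ogdIter p T δ x y d₀ j with ha
  set q : ℝ → ℝ → ℝ := gradMean p φ (bestLevel₁ p φ) with hq
  set B := p.gradBound with hB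
  have hB0 : 0 < B := hp.gradBound_pos
  have hR0 : 0 ≤ R := (abs_nonneg _).trans (hR 0)
  have hΓ := hp.Γ_pos
  have hqB : ∀ u w, |q u w| ≤ B := fun u w => abs_gradMean_le hp hφ _ u w
  have haq : ∀ i u w, |(a i - z) * q u w| ≤ R * B := fun i u w => by
    rw [abs_mul]; exact mul_le_mul (hR i) (hqB u w) (abs_nonneg _) hR0
  have hstep : ∀ j, (a j - z) * q (a j) (entry x j)
      ≤ (a (j + 1) - z) * q (a (j + 1)) (prevEntry x d₀ (j + 1))
        + (ρ * B + R * (B * p.Γ * ρ) + R * p.h₂ * nearInd ρ (a j) (entry x j))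
        + if j = 0 then 2 * R * B else 0 := by
    intro j
    have hprev : prevEntry x d₀ (j + 1) = entry x j := by simp [prevEntry]
    rw [hprev]
    have hnear := mul_nonneg (mul_nonneg hR0 hp.h₂_pos.le)
      (nearInd_mem_Icc hρ0 (a j) (entry x j)).1
    cases j with
    | zero =>
      have h1 := abs_le.1 (haq 0 (a 0) (entry x 0))
      have h2 := abs_le.1 (haq (0 + 1) (a (0 + 1)) (entry x 0))
      rw [if_pos rfl]
      have : 0 ≤ ρ * B + R * (B * p.Γ * ρ) := by positivity
      linarith [h1.2, h2.1]
    | succ i =>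
      have hmove := (abs_ogdIter_succ_sub_le hp T δ x y d₀
        (ogdIter_succ_mem_Icc hs T δ x y d₀ i) (hG (i + 1))).trans hρ
      have h1 := abs_gradMean_sub_le hp hφ hmove (entry x (i + 1))
      rw [if_neg (Nat.succ_ne_zero i), add_zero]
      have key : (a (i + 1) - z) * q (a (i + 1)) (entry x (i + 1))
          = (a (i + 1 + 1) - z) * q (a (i + 1 + 1)) (entry x (i + 1))
            + -((a (i + 1 + 1) - a (i + 1)) * q (a (i + 1 + 1)) (entry x (i + 1)))
            + -((a (i + 1) - z) *
              (q (a (i + 1 + 1)) (entry x (i + 1)) - q (a (i + 1)) (entry x (i + 1)))) := by ring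
      rw [key]
      have h2 : -((a (i + 1 + 1) - a (i + 1)) * q (a (i + 1 + 1)) (entry x (i + 1))) ≤ ρ * B := by
        refine (neg_le_abs _).trans ?_
        rw [abs_mul]
        exact mul_le_mul hmove (hqB _ _) (abs_nonneg _) hρ0
      have h3 : -((a (i + 1) - z) *
          (q (a (i + 1 + 1)) (entry x (i + 1)) - q (a (i + 1)) (entry x (i + 1))))
          ≤ R * (B * p.Γ * ρ + p.h₂ * nearInd ρ (a (i + 1)) (entry x (i + 1))) := by
        refine (neg_le_abs _).trans ?_
        rw [abs_mul]
        exact mul_le_mul (hR _) h1 (abs_nonneg _) hR0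
      linarith
  obtain ⟨n, rfl⟩ : ∃ n, L = n + 1 := ⟨L - 1, by omega⟩
  have hsum := Finset.sum_le_sum fun j (_ : j ∈ Finset.range n) => hstep j
  rw [Finset.sum_add_distrib, Finset.sum_add_distrib, Finset.sum_add_distrib, Finset.sum_const,
    Finset.card_range, nsmul_eq_mul, ← Finset.mul_sum] at hsum
  have hif : ∑ j ∈ Finset.range n, (if j = 0 then 2 * R * B else 0) ≤ 2 * R * B := by
    rw [Finset.sum_ite_eq']
    split_ifs
    · exact le_rfl
    · positivity
  have hlast := (abs_le.1 (haq n (a n) (entry x n))).2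
  have hfirst := (abs_le.1 (haq 0 (a 0) (prevEntry x d₀ 0))).1
  have hnear := mul_nonneg (mul_nonneg hR0 hp.h₂_pos.le)
    (nearInd_mem_Icc hρ0 (a n) (entry x n)).1
  rw [Finset.sum_range_succ,
    Finset.sum_range_succ' (fun j => (a j - z) * q (a j) (prevEntry x d₀ j)),
    Finset.sum_range_succ (fun j => nearInd ρ (a j) (entry x j))]
  push_cast
  have h4 : 0 ≤ ρ * B + R * (B * p.Γ * ρ) := by positivity
  linarith

theorem sum_mul_ogdGrad_le (hp : p.Valid) (hL : 0 < L)
    (hz : z ∈ Icc 0 p.sMax) (hR : ∀ j, |ogdIter p T δ x y d₀ j - z| ≤ R)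
    (hG : ∀ j, |ogdGrad p T δ x y d₀ j| ≤ G) :
    ∑ j ∈ Finset.range L, (ogdIter p T δ x y d₀ j - z) * ogdGrad p T δ x y d₀ j
      ≤ √L * ((R ^ 2 + p.c ^ 2 * G ^ 2) / (2 * p.c)) := by
  have hL' : (0 : ℝ) < L := by exact_mod_cast hL
  have hsq : 0 < √(L : ℝ) := Real.sqrt_pos.2 hL'
  have hc := hp.c_pos
  have h1 := two_mul_sum_mul_ogdGrad_le hp T δ x y d₀ hz hG L
  have h2 : (y - z) ^ 2 ≤ R ^ 2 := by
    rw [← sq_abs]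
    have := hR 0
    rw [ogdIter] at this
    gcongr
  have h3 : (L : ℝ) * (p.c / √L) ^ 2 = p.c ^ 2 := by
    rw [div_pow, Real.sq_sqrt hL'.le, mul_div_cancel₀ _ hL'.ne']
  rw [h3] at h1
  have h4 : 2 * (p.c / √L) * (√L * ((R ^ 2 + p.c ^ 2 * G ^ 2) / (2 * p.c)))
      = R ^ 2 + p.c ^ 2 * G ^ 2 := by field_simp
  refine le_of_mul_le_mul_left ?_ (show 0 < 2 * (p.c / √L) by positivity)
  rw [h4]
  linarith [sq_nonneg (ogdIter p T δ x y d₀ L - z)]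

/-- The regret of the iterates against the exact gradient, in terms of the three noise terms, the
distances between empirical and true distribution functions, and the error of Agent 1's level. -/
theorem sum_mul_lossDeriv_le (hp : p.Valid) (hφ : IsDemandDensity p φ) (hL : 0 < L)
    (hz : z ∈ Icc 0 p.sMax) (hR : ∀ j, |ogdIter p T δ x y d₀ j - z| ≤ R)
    (hG : ∀ j, |ogdGrad p T δ x y d₀ j| ≤ G) {ρ σ : ℝ} (hρ : ρ = p.c / √L * G) {ε : Fin L → ℝ}
    (hε : ∀ j t, |tailCDF x j t - demandCDF φ t| ≤ ε j)
    (hσ : |quantile (empCDF x) p.ratio - bestLevel₁ p φ| ≤ σ) :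
    ∑ j ∈ Finset.range L, (ogdIter p T δ x y d₀ j - z) * lossDeriv p φ (ogdIter p T δ x y d₀ j)
      ≤ √L * ((R ^ 2 + p.c ^ 2 * G ^ 2) / (2 * p.c))
        + ∑ j, tailDev (gradNoise p T δ y d₀ z) j x + ∑ j, tailDev (meanNoise p φ T δ y d₀ z) j x
        + R * p.h₂ * ∑ j, tailDev (nearNoise p T δ y d₀ ρ) j x
        + L * (R * ((p.h₁ + p.p₁) * p.Γ * σ + augWeight p T δ L))
        + (2 * R * p.gradBound + 2 * R * p.h₂) * ∑ j, ε j
        + L * (ρ * (p.gradBound + R * p.gradBound * p.Γ + 2 * R * p.h₂ * p.Γ))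
        + 4 * R * p.gradBound := by
  have hG0 : 0 ≤ G := (abs_nonneg _).trans (hG 0)
  have hR0 : 0 ≤ R := (abs_nonneg _).trans (hR 0)
  have hρ0 : 0 ≤ ρ := by rw [hρ]; have := hp.c_pos; positivity
  have a1 := sum_mul_ogdGrad_le hp hL hz hR hG
  have a2 := Finset.sum_le_sum fun j (_ : j ∈ (Finset.univ : Finset (Fin L))) =>
    mul_gradMean_prevEntry_le (T := T) (δ := δ) (y := y) (d₀ := d₀) hp hφ j (hR j) (hε j) hσ
  have a3 := sum_mul_gradMean_le hp hφ hL (hz.1.trans hz.2) hρ.ge hρ0 hR hG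
  have a4 := Finset.sum_le_sum fun j (_ : j ∈ (Finset.univ : Finset (Fin L))) =>
    mul_lossDeriv_le (T := T) (δ := δ) (y := y) (d₀ := d₀) hp hφ j (hR j) (hε j)
  have a5 := Finset.sum_le_sum fun j (_ : j ∈ (Finset.univ : Finset (Fin L))) =>
    nearInd_le (T := T) (δ := δ) (y := y) (d₀ := d₀) hp hφ j hρ0 (hε j)
  simp only [Finset.sum_range, entry_coe] at a1 a3 ⊢
  simp only [Finset.sum_add_distrib, ← Finset.mul_sum, Finset.sum_const, Finset.card_univ,
    Fintype.card_fin, nsmul_eq_mul] at a2 a4 a5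
  have a5' := mul_le_mul_of_nonneg_left a5 (mul_nonneg hR0 hp.h₂_pos.le)
  linarith

end Descent

/-! ### The levels learnt in one epoch -/

theorem sum_inv_sqrt_le (n : ℕ) : ∑ i ∈ Finset.range n, 1 / √((i : ℝ) + 1) ≤ 2 * √n := by
  induction n with
  | zero => simp
  | succ n ih =>
    rw [Finset.sum_range_succ]
    push_cast
    have h0 : (0 : ℝ) ≤ n := n.cast_nonneg
    have h1 := Real.sq_sqrt h0
    have h2 := Real.sq_sqrt (show (0 : ℝ) ≤ n + 1 by linarith)
    have h3 : 0 < √((n : ℝ) + 1) := Real.sqrt_pos.2 (by linarith)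
    have h4 : 1 / √((n : ℝ) + 1) ≤ 2 * (√((n : ℝ) + 1) - √n) := by
      rw [div_le_iff₀ h3]
      nlinarith [sq_nonneg (√((n : ℝ) + 1) - √n)]
    linarith

theorem sum_sqrt_div_card_le {L : ℕ} {ℓ : ℝ} (hℓ : 0 ≤ ℓ) :
    ∑ j : Fin L, √(ℓ / (Finset.Ici j).card) ≤ 2 * √(L * ℓ) := by
  have e : ∑ j : Fin L, √(ℓ / (Finset.Ici j).card)
      = √ℓ * ∑ i ∈ Finset.range L, 1 / √((i : ℝ) + 1) := by
    rw [← Finset.sum_range_reflect, Finset.sum_range, Finset.mul_sum]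
    refine Finset.sum_congr rfl fun j _ => ?_
    rw [Real.sqrt_div hℓ, card_Ici_cast, mul_one_div]
    have hj := j.2
    have : ((L - 1 - (j : ℕ) : ℕ) : ℝ) + 1 = L - j := by
      rw [Nat.sub_sub, Nat.cast_sub (by omega)]; push_cast; ring
    rw [this]
  rw [e, Real.sqrt_mul L.cast_nonneg]
  have := mul_le_mul_of_nonneg_left (sum_inv_sqrt_le L) (Real.sqrt_nonneg ℓ)
  linarith

theorem augWeight_nonneg (hp : p.Valid) (T : ℕ) (δ : ℝ) (L : ℕ) : 0 ≤ augWeight p T δ L :=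
  mul_nonneg (mul_nonneg hp.C₁_pos.le hp.sum_pos.le) (Real.sqrt_nonneg _)

theorem augWeight_le (hp : p.Valid) {T : ℕ} {δ : ℝ} (hT : 1 ≤ T) (hδ : 0 < δ) (hδ2 : δ ≤ 1 / 2)
    (L : ℕ) : augWeight p T δ L
      ≤ p.C₁ * (p.h₁ + p.p₁) * (1 + 2 * |Real.log p.D|) * √(Real.log (T / δ) / L) := by
  have hℓ := half_le_log_div hT hδ hδ2
  have hT' : (0 : ℝ) < T := by exact_mod_cast hT
  have hD : 0 < p.D := hp.d_pos.trans hp.d_lt_D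
  have hA : 1 ≤ 1 + 2 * |Real.log p.D| := by linarith [abs_nonneg (Real.log p.D)]
  unfold augWeight
  rw [mul_assoc (p.C₁ * (p.h₁ + p.p₁))]
  refine mul_le_mul_of_nonneg_left ?_ (mul_nonneg hp.C₁_pos.le hp.sum_pos.le)
  have h1 : Real.log (T * p.D / δ) ≤ (1 + 2 * |Real.log p.D|) * Real.log (T / δ) := by
    rw [mul_div_right_comm, Real.log_mul (by positivity) hD.ne']
    nlinarith [le_abs_self (Real.log p.D), abs_nonneg (Real.log p.D)]
  calc √(Real.log (T * p.D / δ) / L)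
      ≤ √((1 + 2 * |Real.log p.D|) * (Real.log (T / δ) / L)) := by
        rw [← mul_div_assoc]
        exact Real.sqrt_le_sqrt (div_le_div_of_nonneg_right h1 L.cast_nonneg)
    _ = √(1 + 2 * |Real.log p.D|) * √(Real.log (T / δ) / L) := Real.sqrt_mul (by linarith) _
    _ ≤ (1 + 2 * |Real.log p.D|) * √(Real.log (T / δ) / L) := by
        refine mul_le_mul_of_nonneg_right ?_ (Real.sqrt_nonneg _)
        exact Real.sqrt_le_iff.2 ⟨by linarith, by nlinarith⟩

theorem abs_lossDeriv_le (hp : p.Valid) (hφ : IsDemandDensity p φ) (x : ℝ) :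
    |lossDeriv p φ x| ≤ p.gradBound := by
  have := hφ.isProbabilityMeasure hp
  have := norm_integral_le_of_norm_le_const (μ := demandLaw φ) (C := p.gradBound)
    (f := fun y => expCostDeriv p φ (bestLevel₁ p φ + min 0 (x - y)))
    (Filter.Eventually.of_forall fun y => by
      have h := expCostDeriv_mem_Icc hp hφ (bestLevel₁ p φ + min 0 (x - y))
      have := hp.h₁_pos; have := hp.p₁_pos; have := hp.h₂_pos
      rw [Real.norm_eq_abs, abs_le, Params.gradBound]
      constructor <;> linarith [h.1, h.2])
  simpa [lossDeriv] using this

theorem ogdOutput_mem_Icc {L : ℕ} (hL : 0 < L) (hs : 0 ≤ p.sMax) (T : ℕ) (δ : ℝ) (x : Fin L → ℝ)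
    {y b : ℝ} (hy : y ∈ Icc b p.sMax) (d₀ : ℝ) :
    ogdOutput p T δ x y d₀ ∈ Icc (min b 0) p.sMax := by
  have hL' : (0 : ℝ) < L := by exact_mod_cast hL
  have h := fun j => ogdIter_mem_Icc hs T δ x hy d₀ j
  unfold ogdOutput
  constructor
  · rw [le_div_iff₀ hL', mul_comm, ← nsmul_eq_mul]
    simpa using Finset.card_nsmul_le_sum (Finset.range L) _ _ fun j _ => (h j).1
  · rw [div_le_iff₀ hL', mul_comm, ← nsmul_eq_mul]
    simpa using Finset.sum_le_card_nsmul (Finset.range L) _ _ fun j _ => (h j).2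

/-- Convexity turns the regret of the iterates into a bound for the loss of their average. -/
theorem avgLoss_ogdOutput_sub_le (hp : p.Valid) (hφ : IsDemandDensity p φ) {L : ℕ} (hL : 0 < L)
    (T : ℕ) (δ : ℝ) (x : Fin L → ℝ) (y d₀ z : ℝ) :
    L * (avgLoss p φ (bestLevel₁ p φ) (ogdOutput p T δ x y d₀) - avgLoss p φ (bestLevel₁ p φ) z)
      ≤ ∑ j ∈ Finset.range L,
        (ogdIter p T δ x y d₀ j - z) * lossDeriv p φ (ogdIter p T δ x y d₀ j) := by
  have hL' : (0 : ℝ) < L := by exact_mod_cast hL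
  set f := avgLoss p φ (bestLevel₁ p φ) with hf
  set m := ogdOutput p T δ x y d₀ with hm
  have hsum : ∑ j ∈ Finset.range L, ogdIter p T δ x y d₀ j = L * m := by
    rw [hm, ogdOutput, mul_div_cancel₀ _ hL'.ne']
  have h1 := Finset.sum_le_sum fun j (_ : j ∈ Finset.range L) =>
    avgLoss_subgradient hp hφ (ogdIter p T δ x y d₀ j) m
  have h2 := Finset.sum_le_sum fun j (_ : j ∈ Finset.range L) =>
    avgLoss_subgradient hp hφ z (ogdIter p T δ x y d₀ j)
  rw [Finset.sum_add_distrib, ← Finset.mul_sum, Finset.sum_sub_distrib, hsum] at h1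
  rw [Finset.sum_add_distrib] at h2
  simp only [Finset.sum_const, Finset.card_range, nsmul_eq_mul] at h1 h2
  rw [sub_self, mul_zero, add_zero] at h1
  have h3 : ∑ j ∈ Finset.range L,
      lossDeriv p φ (ogdIter p T δ x y d₀ j) * (z - ogdIter p T δ x y d₀ j)
      = -∑ j ∈ Finset.range L,
        (ogdIter p T δ x y d₀ j - z) * lossDeriv p φ (ogdIter p T δ x y d₀ j) := by
    rw [← Finset.sum_neg_distrib]
    exact Finset.sum_congr rfl fun j _ => by ring
  rw [h3] at h2
  linarith

/-- A bound for the distance of two levels of Agent 2. -/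
noncomputable def Params.levelRange (p : Params) (b : ℝ) : ℝ := |b| + |p.sMax| + 1

theorem abs_sub_le_levelRange {b x z : ℝ} (hx : x ∈ Icc (min b 0) p.sMax)
    (hz : z ∈ Icc 0 p.sMax) : |x - z| ≤ p.levelRange b := by
  have h1 : -|b| ≤ min b 0 := le_min (neg_abs_le b) (neg_nonpos.2 (abs_nonneg b))
  have h2 := le_abs_self p.sMax
  have h3 := abs_nonneg b
  rw [abs_le, Params.levelRange]
  constructor <;> linarith [hx.1, hx.2, hz.1, hz.2]

theorem Params.levelRange_pos (p : Params) (b : ℝ) : 0 < p.levelRange b := by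
  unfold Params.levelRange; positivity

section Epoch

variable {L : ℕ}

/-- The events on which the regret of the descent is of order `√(L ℓ)`: all tails of the sample have
distribution functions close to that of the law, and the three noise terms are small. -/
structure IsGoodSample (p : Params) (φ : ℝ → ℝ) (T : ℕ) (δ y d₀ z R ρ ℓ : ℝ) (x : Fin L → ℝ) :
    Prop where
  mem_Icc : ∀ i, x i ∈ Icc p.d p.D
  tailCDF_close : ∀ j t, |tailCDF x j t - demandCDF φ t| ≤ (2 + 2 * p.Γ * (p.D - p.d)) *
    √(ℓ / (Finset.Ici j).card)
  grad : ∑ j, tailDev (gradNoise p T δ y d₀ z) j x ≤ 8 * (R * p.gradBound) * √(L * ℓ)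
  mean : ∑ j, tailDev (meanNoise p φ T δ y d₀ z) j x ≤ 8 * (R * p.gradBound) * √(L * ℓ)
  near : ∑ j, tailDev (nearNoise p T δ y d₀ ρ) j x ≤ 8 * 1 * √(L * ℓ)

theorem measure_not_isGoodSample_le (hp : p.Valid) (hφ : IsDemandDensity p φ) (hL : 0 < L)
    {T : ℕ} (hLT : L ≤ T) {δ : ℝ} (hδ : 0 < δ) (hδ2 : δ ≤ 1 / 2) {y d₀ z R ρ : ℝ} (hR0 : 0 < R)
    (hρ : 0 ≤ ρ) (hR : ∀ (x : Fin L → ℝ) (j : ℕ), |ogdIter p T δ x y d₀ j - z| ≤ R) :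
    (Measure.pi fun _ : Fin L => demandLaw φ).real
      {x | ¬IsGoodSample p φ T δ y d₀ z R ρ (Real.log (T / δ)) x} ≤ δ := by
  have := hφ.isProbabilityMeasure hp
  have hT : 1 ≤ T := hL.trans_le hLT
  have hT' : (1 : ℝ) ≤ T := by exact_mod_cast hT
  have hL' : (0 : ℝ) < L := by exact_mod_cast hL
  have hℓ := half_le_log_div hT hδ hδ2
  have hdkw := measure_not_tailCDF_close_le hp hφ hL hLT hδ hδ2
  set ℓ := Real.log (T / δ) with hℓ_def
  set μ := Measure.pi fun _ : Fin L => demandLaw φ with hμ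
  have hB0 : 0 < R * p.gradBound := mul_pos hR0 hp.gradBound_pos
  have hS : √(L * ℓ) ^ 2 = L * ℓ := Real.sq_sqrt (by positivity)
  have hazuma : ∀ (ψ : Fin L → (Fin L → ℝ) → ℝ → ℝ) (B : ℝ), IsPredictable ψ → 0 < B →
      (∀ j v w, |ψ j v w| ≤ B) →
      μ.real {x | 8 * B * √(L * ℓ) < ∑ j, tailDev ψ j x} ≤ δ / 8 := by
    intro ψ B hψ hB hψB
    have h1 := hψ.measure_sum_tailDev_ge_le (ν := demandLaw φ) hB hψB hL
      (u := 8 * B * √(L * ℓ)) (by positivity)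
    have h2 : -((8 * B * √(L * ℓ)) ^ 2 / (8 * L * B ^ 2)) = -((8 : ℕ) * ℓ) := by
      rw [mul_pow, hS]; push_cast; field_simp
    rw [h2, hℓ_def, exp_neg_mul_log hT hδ] at h1
    have h3 : (δ / T) ^ 8 ≤ δ / 8 := by
      have h4 : δ / T ≤ δ := div_le_self hδ.le hT'
      calc (δ / T) ^ 8 ≤ δ ^ 8 := by gcongr
        _ = δ ^ 7 * δ := by ring
        _ ≤ (1 / 2) ^ 7 * δ := by gcongr
        _ ≤ δ / 8 := by linarith
    have h5 : {x | 8 * B * √(L * ℓ) < ∑ j, tailDev ψ j x} ⊆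
        {x | 8 * B * √(L * ℓ) ≤ ∑ j, tailDev ψ j x} := fun x hx => by
      have hx' : 8 * B * √(L * ℓ) < ∑ j, tailDev ψ j x := hx
      exact hx'.le
    exact (measureReal_mono h5).trans (h1.trans h3)
  have hg := hazuma _ _ (isPredictable_gradNoise hp hL T δ y d₀ z) hB0 fun j v w => by
    rw [gradNoise, abs_mul, abs_sub_comm]
    exact mul_le_mul (hR v j) (abs_sampleGrad_le hp _ _ _ _) (abs_nonneg _) hR0.le
  have hm := hazuma _ _ (isPredictable_meanNoise hp hφ hL T δ y d₀ z) hB0 fun j v w => by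
    rw [meanNoise, abs_mul, abs_sub_comm]
    exact mul_le_mul (hR v j) (abs_gradMean_le hp hφ _ _ _) (abs_nonneg _) hR0.le
  have hn := hazuma _ 1 (isPredictable_nearNoise hp hL T δ y d₀ ρ) one_pos fun j v w => by
    have := nearInd_mem_Icc hρ (ogdIter p T δ v y d₀ j) w
    rw [nearNoise, abs_of_nonneg this.1]; exact this.2
  have hsub : {x | ¬IsGoodSample p φ T δ y d₀ z R ρ ℓ x} ⊆
      {x : Fin L → ℝ | ¬((∀ i, x i ∈ Icc p.d p.D) ∧
        ∀ j t, |tailCDF x j t - demandCDF φ t| ≤ (2 + 2 * p.Γ * (p.D - p.d)) *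
        √(ℓ / (Finset.Ici j).card))} ∪
      ({x | 8 * (R * p.gradBound) * √(L * ℓ) < ∑ j, tailDev (gradNoise p T δ y d₀ z) j x} ∪
      ({x | 8 * (R * p.gradBound) * √(L * ℓ) < ∑ j, tailDev (meanNoise p φ T δ y d₀ z) j x} ∪
      {x | 8 * 1 * √(L * ℓ) < ∑ j, tailDev (nearNoise p T δ y d₀ ρ) j x})) := by
    intro x hx
    by_contra hcon
    simp only [mem_union, not_or, mem_ofPred_eq, not_not, not_lt] at hcon
    exact hx ⟨hcon.1.1, hcon.1.2, hcon.2.1, hcon.2.2.1, hcon.2.2.2⟩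
  refine (measureReal_mono hsub).trans (((measureReal_union_le _ _).trans (add_le_add hdkw
    ((measureReal_union_le _ _).trans (add_le_add hg
      ((measureReal_union_le _ _).trans (add_le_add hm hn)))))).trans ?_)
  linarith

/-- The levels that are learnt from the demands of an epoch of length `L`: with high probability
Agent 1's level has error `O(√(ℓ / L))` for `ℓ = log (T / δ)`, and Agent 2's level, combined with
Agent 1's best level, exceeds the minimal expected loss by `O(√(ℓ / L))`. -/
theorem exists_epoch_bound (hp : p.Valid) (b : ℝ) :
    ∃ K : ℝ, 0 < K ∧ ∀ φ, IsDemandDensity p φ → ∀ z, 0 ≤ z →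
      (∀ x, avgLoss p φ (bestLevel₁ p φ) z ≤ avgLoss p φ (bestLevel₁ p φ) x) →
      ∀ L T : ℕ, 0 < L → L ≤ T → ∀ δ : ℝ, 0 < δ → δ ≤ 1 / 2 → ∀ y ∈ Icc b p.sMax, ∀ d₀ : ℝ,
      (Measure.pi fun _ : Fin L => demandLaw φ).real
        {x | ¬(|quantile (empCDF x) p.ratio - bestLevel₁ p φ| ≤ K * √(Real.log (T / δ) / L) ∧
          avgLoss p φ (bestLevel₁ p φ) (ogdOutput p T δ x y d₀) - avgLoss p φ (bestLevel₁ p φ) z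
            ≤ K * √(Real.log (T / δ) / L))} ≤ δ := by
  have hc := hp.c_pos
  have hB0 := hp.gradBound_pos
  have hΓ := hp.Γ_pos
  have hγ := hp.γ_pos
  have hh := hp.h₂_pos
  have hsum := hp.sum_pos
  have hC := hp.C₁_pos
  have hDd : 0 < p.D - p.d := sub_pos.2 hp.d_lt_D
  obtain ⟨R, hR_def⟩ : ∃ R, R = p.levelRange b := ⟨_, rfl⟩
  have hR0 : 0 < R := hR_def ▸ p.levelRange_pos b
  obtain ⟨K₁, hK₁⟩ : ∃ K₁ : ℝ, K₁ = 2 + 2 * p.Γ * (p.D - p.d) := ⟨_, rfl⟩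
  have hK₁0 : 0 < K₁ := by rw [hK₁]; positivity
  obtain ⟨A, hA⟩ : ∃ A : ℝ, A = p.C₁ * (p.h₁ + p.p₁) * (1 + 2 * |Real.log p.D|) := ⟨_, rfl⟩
  have hA0 : 0 < A := by rw [hA]; positivity
  obtain ⟨B, hB⟩ : ∃ B, B = p.gradBound := ⟨_, rfl⟩
  rw [← hB] at hB0
  obtain ⟨G, hG⟩ : ∃ G : ℝ, G = B + A := ⟨_, rfl⟩
  have hG0 : 0 < G := by rw [hG]; positivity
  -- The summands are the coefficients of `√(L ℓ)` in the terms of the regret of the descent.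
  obtain ⟨K, hK⟩ : ∃ K : ℝ,
    K = 2 * ((R ^ 2 + p.c ^ 2 * G ^ 2) / (2 * p.c)) + 16 * (R * B) + R * p.h₂ * 8
    + R * ((p.h₁ + p.p₁) * p.Γ * (K₁ / p.γ) + A) + (2 * R * B + 2 * R * p.h₂) * (K₁ * 2)
    + 2 * p.c * G * (B + R * B * p.Γ + 2 * R * p.h₂ * p.Γ) + 8 * R * B := ⟨_, rfl⟩
  have hK0 : 0 < K := by rw [hK]; positivity
  refine ⟨K + K₁ / p.γ + B * R, by positivity, ?_⟩
  intro φ hφ z hz0 hz L T hL hLT δ hδ hδ2 y hy d₀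
  have hprob := hφ.isProbabilityMeasure hp
  have hL' : (0 : ℝ) < L := by exact_mod_cast hL
  have hL1 : (1 : ℝ) ≤ L := by exact_mod_cast hL
  have hT : 1 ≤ T := hL.trans_le hLT
  have hℓ := half_le_log_div hT hδ hδ2
  have hzs : z ∈ Icc 0 p.sMax := ⟨hz0, le_sMax_of_isMin hp hφ (lossDeriv_eq_zero hp hφ hz)⟩
  have hs0 : 0 ≤ p.sMax := hzs.1.trans hzs.2
  have hR : ∀ (x : Fin L → ℝ) (j : ℕ), |ogdIter p T δ x y d₀ j - z| ≤ R := fun x j =>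
    hR_def ▸ abs_sub_le_levelRange (ogdIter_mem_Icc hs0 T δ x hy d₀ j) hzs
  have haug := augWeight_le hp hT hδ hδ2 L
  rw [← hA] at haug
  have hmain := measure_not_isGoodSample_le hp hφ hL hLT hδ hδ2 (y := y) (d₀ := d₀) (z := z)
    hR0 (ρ := p.c / √L * G) (by positivity) hR
  set ℓ := Real.log (T / δ) with hℓ_def
  have hclose : ∀ x : Fin L → ℝ, IsGoodSample p φ T δ y d₀ z R (p.c / √L * G) ℓ x → ∀ j t,
      |tailCDF x j t - demandCDF φ t| ≤ K₁ * √(ℓ / (Finset.Ici j).card) :=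
    fun x hx => hK₁ ▸ hx.tailCDF_close
  suffices hgood_imp : ∀ x : Fin L → ℝ, IsGoodSample p φ T δ y d₀ z R (p.c / √L * G) ℓ x →
      |quantile (empCDF x) p.ratio - bestLevel₁ p φ| ≤ (K + K₁ / p.γ + B * R) * √(ℓ / L) ∧
        avgLoss p φ (bestLevel₁ p φ) (ogdOutput p T δ x y d₀) - avgLoss p φ (bestLevel₁ p φ) z
          ≤ (K + K₁ / p.γ + B * R) * √(ℓ / L) by
    refine le_trans (measureReal_mono ?_) hmain
    exact fun x hx hgood => hx (hgood_imp x hgood)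
  intro x hgood
  have hq : |quantile (empCDF x) p.ratio - bestLevel₁ p φ| ≤ K₁ * √(ℓ / L) / p.γ := by
    refine abs_quantile_sub_le hp hφ hL hgood.mem_Icc fun t => ?_
    have := hclose x hgood ⟨0, hL⟩ t
    rwa [tailCDF_zero hL, card_Ici_cast, Nat.cast_zero, sub_zero] at this
  have hr0 : 0 ≤ √(ℓ / L) := Real.sqrt_nonneg _
  have hexp : (K + K₁ / p.γ + B * R) * √(ℓ / L)
      = K * √(ℓ / L) + K₁ * √(ℓ / L) / p.γ + B * R * √(ℓ / L) := by ring
  have n1 : 0 ≤ K * √(ℓ / L) := by positivity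
  have n2 : 0 ≤ K₁ * √(ℓ / L) / p.γ := by positivity
  have n3 : 0 ≤ B * R * √(ℓ / L) := by positivity
  rw [hexp]
  refine ⟨by linarith, ?_⟩
  rcases lt_or_ge (L : ℝ) ℓ with hlarge | hsmall
  · -- If `ℓ > L`, the bound exceeds the trivial one.
    have h1 : 1 ≤ √(ℓ / L) := Real.one_le_sqrt.2 ((one_le_div hL').2 hlarge.le)
    have h2 := avgLoss_subgradient hp hφ z (ogdOutput p T δ x y d₀)
    have h3 : -(lossDeriv p φ (ogdOutput p T δ x y d₀) * (z - ogdOutput p T δ x y d₀)) ≤ B * R := by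
      refine (neg_le_abs _).trans ?_
      rw [abs_mul]
      refine mul_le_mul (hB ▸ abs_lossDeriv_le hp hφ _) ?_ (abs_nonneg _) hB0.le
      rw [abs_sub_comm]
      exact hR_def ▸ abs_sub_le_levelRange (ogdOutput_mem_Icc hL hs0 T δ x hy d₀) hzs
    have h4 : B * R ≤ B * R * √(ℓ / L) := le_mul_of_one_le_right (by positivity) h1
    linarith
  · have hr1 : √(ℓ / L) ≤ 1 := Real.sqrt_le_one.2 ((div_le_one hL').2 hsmall)
    have hGb : ∀ j, |ogdGrad p T δ x y d₀ j| ≤ G := by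
      intro j
      rw [hG, hB]
      have haug0 := augWeight_nonneg hp T δ L
      refine (abs_add_le _ _).trans (add_le_add (abs_sampleGrad_le hp _ _ _ _) ?_)
      rw [abs_of_nonneg (mul_nonneg haug0 (empCDF_nonneg _ _))]
      refine (mul_le_of_le_one_right haug0 (empCDF_le_one _ _)).trans (haug.trans ?_)
      exact mul_le_of_le_one_right hA0.le hr1
    have hreg := sum_mul_lossDeriv_le hp hφ hL hzs (hR x) hGb rfl (hclose x hgood) hq
    rw [← hB] at hreg
    have havg := avgLoss_ogdOutput_sub_le hp hφ hL T δ x y d₀ z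
    set S := √(L * ℓ) with hS
    have hSr : L * √(ℓ / L) = S := by
      rw [hS, show (L : ℝ) * ℓ = L ^ 2 * (ℓ / L) by field_simp, Real.sqrt_mul (by positivity),
        Real.sqrt_sq hL'.le]
    have hLS : √L ≤ 2 * S := by
      rw [hS, Real.sqrt_mul hL'.le]
      have : 1 / 2 ≤ √ℓ := Real.le_sqrt_of_sq_le (by linarith)
      have := mul_le_mul_of_nonneg_left this (Real.sqrt_nonneg (L : ℝ))
      linarith
    have h1S : 1 ≤ 2 * S := (Real.one_le_sqrt.2 hL1).trans hLS
    have hsε : ∑ j : Fin L, K₁ * √(ℓ / (Finset.Ici j).card) ≤ K₁ * (2 * S) := by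
      rw [← Finset.mul_sum]
      exact mul_le_mul_of_nonneg_left (sum_sqrt_div_card_le (by linarith)) hK₁0.le
    have e1 : √L * ((R ^ 2 + p.c ^ 2 * G ^ 2) / (2 * p.c))
        ≤ 2 * S * ((R ^ 2 + p.c ^ 2 * G ^ 2) / (2 * p.c)) := by gcongr
    have e2 : R * p.h₂ * ∑ j, tailDev (nearNoise p T δ y d₀ (p.c / √L * G)) j x
        ≤ R * p.h₂ * (8 * 1 * S) := mul_le_mul_of_nonneg_left hgood.near (by positivity)
    have e3 : L * (R * ((p.h₁ + p.p₁) * p.Γ * (K₁ * √(ℓ / L) / p.γ) + augWeight p T δ L))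
        ≤ R * ((p.h₁ + p.p₁) * p.Γ * (K₁ / p.γ) + A) * S := by
      calc L * (R * ((p.h₁ + p.p₁) * p.Γ * (K₁ * √(ℓ / L) / p.γ) + augWeight p T δ L))
          ≤ L * (R * ((p.h₁ + p.p₁) * p.Γ * (K₁ * √(ℓ / L) / p.γ) + A * √(ℓ / L))) := by gcongr
        _ = R * ((p.h₁ + p.p₁) * p.Γ * (K₁ / p.γ) + A) * (L * √(ℓ / L)) := by ring
        _ = _ := by rw [hSr]
    have e4 : (2 * R * B + 2 * R * p.h₂) * ∑ j : Fin L, K₁ * √(ℓ / (Finset.Ici j).card)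
        ≤ (2 * R * B + 2 * R * p.h₂) * (K₁ * (2 * S)) :=
      mul_le_mul_of_nonneg_left hsε (by positivity)
    have e5 : L * (p.c / √L * G * (B + R * B * p.Γ + 2 * R * p.h₂ * p.Γ))
        ≤ 2 * S * (p.c * G * (B + R * B * p.Γ + 2 * R * p.h₂ * p.Γ)) := by
      have : (L : ℝ) * (p.c / √L * G * (B + R * B * p.Γ + 2 * R * p.h₂ * p.Γ))
          = √L * (p.c * G * (B + R * B * p.Γ + 2 * R * p.h₂ * p.Γ)) := by
        have hd : (L : ℝ) / √L = √L := Real.div_sqrt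
        calc _ = (L / √L) * (p.c * G * (B + R * B * p.Γ + 2 * R * p.h₂ * p.Γ)) := by ring
          _ = _ := by rw [hd]
      rw [this]
      gcongr
    have e6 : 4 * R * B ≤ 4 * R * B * (2 * S) := le_mul_of_one_le_right (by positivity) h1S
    have hg := hgood.grad
    have hm := hgood.mean
    rw [← hS, ← hB] at hg hm
    have htot : L * (avgLoss p φ (bestLevel₁ p φ) (ogdOutput p T δ x y d₀)
        - avgLoss p φ (bestLevel₁ p φ) z) ≤ K * S := by
      refine (havg.trans hreg).trans (le_of_le_of_eq (add_le_add (add_le_add (add_le_add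
        (add_le_add (add_le_add (add_le_add (add_le_add e1 hg) hm) e2) e3) e4) e5) e6) ?_)
      rw [hK]; ring
    have : avgLoss p φ (bestLevel₁ p φ) (ogdOutput p T δ x y d₀)
        - avgLoss p φ (bestLevel₁ p φ) z ≤ K * √(ℓ / L) := by
      refine le_of_mul_le_mul_left ?_ hL'
      rw [← hSr] at htot
      linarith
    linarith

end Epoch

/-! ### The inventory dynamics -/

section Dynamics

variable {S₁ S₂ w : ℕ → ℝ}

/-- Agent 1's inventory position: the stock together with the delayed shipment. -/
noncomputable def position (S₁ S₂ w : ℕ → ℝ) (t : ℕ) : ℝ :=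
  (state S₁ S₂ w t).inv₁ + (state S₁ S₂ w t).late

/-- Agent 1's order in round `t`. -/
noncomputable def orderAt (S₁ S₂ w : ℕ → ℝ) (t : ℕ) : ℝ :=
  (state S₁ S₂ w t).order (w t) (S₁ (t + 1))

theorem state_succ {t : ℕ} (ht : 1 ≤ t) :
    state S₁ S₂ w (t + 1) = (state S₁ S₂ w t).step (w t) (S₁ (t + 1)) (S₂ (t + 1)) := by
  obtain ⟨k, rfl⟩ : ∃ k, t = k + 1 := ⟨t - 1, by omega⟩
  rfl

theorem orderAt_eq (t : ℕ) :
    orderAt S₁ S₂ w t = max (S₁ (t + 1) - (position S₁ S₂ w t - w t)) 0 := by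
  rw [orderAt, State.order, State.after₁, position]
  congr 2; ring

/-- The position follows the recursion of a single base-stock system with unlimited supply. -/
theorem position_succ {t : ℕ} (ht : 1 ≤ t) :
    position S₁ S₂ w (t + 1) = max (S₁ (t + 1)) (position S₁ S₂ w t - w t) := by
  rw [position, state_succ ht]
  simp only [State.step]
  have h1 : ∀ a b : ℝ, min a b + max (b - a) 0 = b := fun a b => by
    rcases le_total a b with h | h
    · rw [min_eq_left h, max_eq_left (sub_nonneg.2 h)]; ring
    · rw [min_eq_right h, max_eq_right (sub_nonpos.2 h)]; ring
  rw [add_assoc, h1, State.order, State.after₁, position]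
  rw [show (state S₁ S₂ w t).inv₁ - w t + (state S₁ S₂ w t).late
    = (state S₁ S₂ w t).inv₁ + (state S₁ S₂ w t).late - w t by ring]
  rcases le_total (S₁ (t + 1)) ((state S₁ S₂ w t).inv₁ + (state S₁ S₂ w t).late - w t) with h | h
  · rw [max_eq_right (sub_nonpos.2 h), max_eq_right h]; ring
  · rw [max_eq_left (sub_nonneg.2 h), max_eq_left h]; ring

theorem inv₂_succ {t : ℕ} (ht : 1 ≤ t) : (state S₁ S₂ w (t + 1)).inv₂
    = max ((state S₁ S₂ w t).inv₂ - orderAt S₁ S₂ w t) (S₂ (t + 1)) := by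
  rw [state_succ ht, orderAt]
  simp only [State.step, State.after₂]
  set u := (state S₁ S₂ w t).inv₂ - (state S₁ S₂ w t).order (w t) (S₁ (t + 1))
  rcases le_total (S₂ (t + 1)) u with h | h
  · rw [max_eq_right (sub_nonpos.2 h), max_eq_left h]; ring
  · rw [max_eq_left (sub_nonneg.2 h), max_eq_right h]; ring

theorem late_succ {t : ℕ} (ht : 1 ≤ t) : (state S₁ S₂ w (t + 1)).late
    = max (orderAt S₁ S₂ w t - (state S₁ S₂ w t).inv₂) 0 := by
  rw [state_succ ht, orderAt]; rfl

theorem roundLoss_eq (t : ℕ) : roundLoss p S₁ S₂ w t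
    = cost p (position S₁ S₂ w t - (state S₁ S₂ w t).late - w t)
      + p.h₂ * max ((state S₁ S₂ w t).inv₂ - orderAt S₁ S₂ w t) 0 := by
  rw [roundLoss, cost, orderAt, position, add_sub_cancel_right]

theorem le_position {t : ℕ} (ht : 1 ≤ t) : S₁ t ≤ position S₁ S₂ w t := by
  rcases ht.eq_or_lt with rfl | h
  · simp [position, state]
  · obtain ⟨k, rfl⟩ : ∃ k, t = k + 1 := ⟨t - 1, by omega⟩
    rw [position_succ (by omega)]
    exact le_max_left _ _

theorem le_inv₂ {t : ℕ} (ht : 1 ≤ t) : S₂ t ≤ (state S₁ S₂ w t).inv₂ := by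
  rcases ht.eq_or_lt with rfl | h
  · simp [state]
  · obtain ⟨k, rfl⟩ : ∃ k, t = k + 1 := ⟨t - 1, by omega⟩
    rw [inv₂_succ (by omega)]
    exact le_max_right _ _

theorem orderAt_nonneg (t : ℕ) : 0 ≤ orderAt S₁ S₂ w t := le_max_right _ _

variable {R : ℝ}

theorem position_le (h₁ : ∀ t, |S₁ t| ≤ R) (hw : ∀ t, 0 ≤ w t) {t : ℕ} (ht : 1 ≤ t) :
    position S₁ S₂ w t ≤ R := by
  induction t, ht using Nat.le_induction with
  | base => simpa [position, state] using (abs_le.1 (h₁ 1)).2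
  | succ t ht ih =>
    rw [position_succ ht]
    exact max_le (abs_le.1 (h₁ _)).2 (by linarith [hw t])

theorem orderAt_le (h₁ : ∀ t, |S₁ t| ≤ R) (hw : ∀ t, w t ∈ Icc 0 p.D) {t : ℕ} (ht : 1 ≤ t) :
    orderAt S₁ S₂ w t ≤ 2 * R + p.D := by
  have h3 := abs_le.1 (h₁ t)
  have h4 := abs_le.1 (h₁ (t + 1))
  have h5 := le_position (S₂ := S₂) (w := w) (S₁ := S₁) ht
  rw [orderAt_eq]
  refine max_le ?_ ?_ <;> linarith [(hw t).1, (hw t).2]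

theorem inv₂_le (h₂ : ∀ t, |S₂ t| ≤ R) {t : ℕ} (ht : 1 ≤ t) : (state S₁ S₂ w t).inv₂ ≤ R := by
  induction t, ht using Nat.le_induction with
  | base => exact (abs_le.1 (h₂ 1)).2
  | succ t ht ih =>
    rw [inv₂_succ ht]
    refine max_le ?_ (abs_le.1 (h₂ _)).2
    linarith [orderAt_nonneg (S₁ := S₁) (S₂ := S₂) (w := w) t]

theorem late_mem_Icc (h₁ : ∀ t, |S₁ t| ≤ R) (h₂ : ∀ t, |S₂ t| ≤ R) (hw : ∀ t, w t ∈ Icc 0 p.D)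
    {t : ℕ} (ht : 1 ≤ t) :
    (state S₁ S₂ w t).late ∈ Icc 0 (3 * R + p.D) := by
  have hR : 0 ≤ R := (abs_nonneg _).trans (h₁ 0)
  have hD : 0 ≤ p.D := (hw 0).1.trans (hw 0).2
  rcases ht.eq_or_lt with rfl | h
  · simp only [state]
    constructor <;> linarith
  · obtain ⟨k, rfl⟩ : ∃ k, t = k + 1 := ⟨t - 1, by omega⟩
    rw [late_succ (by omega)]
    have h3 := orderAt_le (p := p) (S₂ := S₂) h₁ hw (t := k) (by omega)
    have h4 := le_inv₂ (S₁ := S₁) (S₂ := S₂) (w := w) (t := k) (by omega)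
    have h5 := (abs_le.1 (h₂ k)).1
    exact ⟨le_max_right _ _, max_le (by linarith) (by linarith)⟩

/-- All losses are bounded if the levels and the demands are. -/
theorem roundLoss_mem_Icc (hp : p.Valid) (h₁ : ∀ t, |S₁ t| ≤ R) (h₂ : ∀ t, |S₂ t| ≤ R)
    (hw : ∀ t, w t ∈ Icc 0 p.D) {t : ℕ} (ht : 1 ≤ t) :
    roundLoss p S₁ S₂ w t ∈ Icc 0 ((p.h₁ + p.p₁) * (4 * R + 2 * p.D) + p.h₂ * R) := by
  have hR : 0 ≤ R := (abs_nonneg _).trans (h₁ 0)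
  have a1 := position_le (S₂ := S₂) h₁ (fun t => (hw t).1) ht
  have a2 := le_position (S₂ := S₂) (w := w) (S₁ := S₁) ht
  have a3 := abs_le.1 (h₁ t)
  have a4 := late_mem_Icc (p := p) h₁ h₂ hw ht
  have a5 := inv₂_le (S₁ := S₁) (w := w) h₂ ht
  have a6 := orderAt_nonneg (S₁ := S₁) (S₂ := S₂) (w := w) t
  rw [roundLoss_eq]
  constructor
  · have := hp.h₂_pos
    have := cost_nonneg hp (position S₁ S₂ w t - (state S₁ S₂ w t).late - w t)
    positivity
  · refine add_le_add ?_ (mul_le_mul_of_nonneg_left (max_le (by linarith) hR) hp.h₂_pos.le)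
    have h3 := (le_abs_self _).trans
      (abs_cost_sub_le hp (position S₁ S₂ w t - (state S₁ S₂ w t).late - w t) 0)
    have h0 : cost p 0 = 0 := by simp [cost]
    rw [h0, sub_zero, sub_zero] at h3
    refine h3.trans (mul_le_mul_of_nonneg_left ?_ hp.sum_pos.le)
    rw [abs_le]
    constructor <;> linarith [(hw t).1, (hw t).2, a4.1, a4.2]

/-- A bounded number of rounds after the levels were fixed, the system is in its steady state: the
position and Agent 2's stock have come down to the desired levels, and each order equals the
demand. -/
theorem roundLoss_eq_of_steady (hp : p.Valid) (h₁ : ∀ t, |S₁ t| ≤ R) (h₂ : ∀ t, |S₂ t| ≤ R)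
    (hw : ∀ t, w t ∈ Icc p.d p.D) {a n N : ℕ} {s₁ s₂ : ℝ} (ha : 1 ≤ a) (hN : 2 * R ≤ p.d * N)
    (hs₁ : ∀ i < n, S₁ (a + i) = s₁)
    (hs₂ : ∀ i < n, S₂ (a + i) = s₂) {i : ℕ} (hi : 2 * N ≤ i) (hin : i + 2 < n) :
    roundLoss p S₁ S₂ w (a + i + 1) = cost p (s₁ - max (w (a + i) - s₂) 0 - w (a + i + 1))
      + p.h₂ * max (s₂ - w (a + i + 1)) 0 := by
  have hd := hp.d_pos
  have hw0 : ∀ t, 0 ≤ w t := fun t => hd.le.trans (hw t).1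
  have hR : 0 ≤ R := (abs_nonneg _).trans (h₁ 0)
  have hsR : -R ≤ s₁ := by rw [← hs₁ i (by omega)]; exact (abs_le.1 (h₁ _)).1
  have hsR₂ : -R ≤ s₂ := by rw [← hs₂ i (by omega)]; exact (abs_le.1 (h₂ _)).1
  -- An excess of the position over `s₁` shrinks by the demand in each round.
  have hpos : ∀ k < n, position S₁ S₂ w (a + k) ≤ max s₁ (R - p.d * k) := by
    intro k
    induction k with
    | zero => intro _; simpa using Or.inr (position_le (S₂ := S₂) h₁ hw0 ha)
    | succ k ih =>
      intro hk
      have h3 := ih (by omega)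
      rw [← add_assoc, position_succ (by omega), add_assoc, hs₁ _ hk]
      refine max_le (le_max_left _ _) ?_
      push_cast
      rcases max_cases s₁ (R - p.d * k) with ⟨h, -⟩ | ⟨h, -⟩ <;> rw [h] at h3
      · exact (by linarith [hw0 (a + k)] : _ ≤ s₁).trans (le_max_left _ _)
      · exact (by linarith [(hw (a + k)).1] : _ ≤ R - p.d * (k + 1)).trans (le_max_right _ _)
  have hpos' : ∀ k, N ≤ k → k < n → position S₁ S₂ w (a + k) = s₁ := by
    intro k hNk hk
    have h3 : p.d * N ≤ p.d * k := by gcongr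
    refine le_antisymm ((hpos k hk).trans (max_le le_rfl (by linarith))) ?_
    rw [← hs₁ k hk]; exact le_position (by omega)
  have hord : ∀ k, N ≤ k → k + 1 < n → orderAt S₁ S₂ w (a + k) = w (a + k) := by
    intro k hNk hk
    rw [orderAt_eq, hpos' k hNk (by omega), add_assoc, hs₁ _ hk, sub_sub_cancel,
      max_eq_left (hw0 _)]
  -- From then on orders equal demands, so an excess of Agent 2's stock shrinks likewise.
  have hinv : ∀ k, N + k + 1 < n → (state S₁ S₂ w (a + (N + k))).inv₂ ≤ max s₂ (R - p.d * k) := by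
    intro k
    induction k with
    | zero => intro _; simpa using Or.inr (inv₂_le (S₁ := S₁) (w := w) h₂ (t := a + N) (by omega))
    | succ k ih =>
      intro hk
      have h3 := ih (by omega)
      rw [← add_assoc, ← add_assoc, inv₂_succ (by omega), add_assoc a N k,
        hord _ (by omega) (by omega), add_assoc, hs₂ _ (by omega)]
      refine max_le ?_ (le_max_left _ _)
      push_cast
      rcases max_cases s₂ (R - p.d * k) with ⟨h, -⟩ | ⟨h, -⟩ <;> rw [h] at h3
      · exact (by linarith [hw0 (a + (N + k))] : _ ≤ s₂).trans (le_max_left _ _)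
      · exact (by linarith [(hw (a + (N + k))).1] : _ ≤ R - p.d * (k + 1)).trans (le_max_right _ _)
  have hinv' : ∀ k, 2 * N ≤ k → k + 1 < n → (state S₁ S₂ w (a + k)).inv₂ = s₂ := by
    intro k hNk hk
    obtain ⟨j, rfl⟩ : ∃ j, k = N + j := ⟨k - N, by omega⟩
    have h3 : p.d * N ≤ p.d * j := by
      have : N ≤ j := by omega
      gcongr
    refine le_antisymm ((hinv j hk).trans (max_le le_rfl (by linarith))) ?_
    rw [← hs₂ (N + j) (by omega)]; exact le_inv₂ (by omega)
  rw [roundLoss_eq, late_succ (by omega), hord i (by omega) (by omega), hinv' i hi (by omega),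
    add_assoc a i 1, hpos' (i + 1) (by omega) (by omega), hinv' (i + 1) (by omega) (by omega),
    hord (i + 1) (by omega) (by omega)]

end Dynamics

/-! ### The levels of the algorithm -/

section Levels

variable {n₀ : ℕ} {x₀ : Fin n₀ → ℝ} {T : ℕ} {δ b d₀ : ℝ} {y₀ : ℕ → ℝ} {w : ℕ → ℝ}

theorem epochLength_pos (m : ℕ) : 0 < epochLength m := by unfold epochLength; positivity

theorem level₁_of_two_le {m : ℕ} (hm : 2 ≤ m) :
    level₁ p x₀ w m = quantile (empCDF (epochSample w (m - 1))) p.ratio :=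
  if_neg (by omega)

theorem level₂_of_two_le {m : ℕ} (hm : 2 ≤ m) : level₂ p T δ y₀ d₀ w m
    = ogdOutput p T δ (epochSample w (m - 1)) (y₀ (m - 1)) d₀ :=
  if_neg (by omega)

/-- A bound for all levels of both agents. -/
noncomputable def levelBound (p : Params) (b : ℝ) {n₀ : ℕ} (x₀ : Fin n₀ → ℝ) : ℝ :=
  p.D + |quantile (empCDF x₀) p.ratio| + p.levelRange b

theorem abs_level₁_le (hp : p.Valid) (hw : ∀ t, w t ∈ Icc p.d p.D) (m : ℕ) :
    |level₁ p x₀ w m| ≤ levelBound p b x₀ := by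
  have hD : 0 < p.D := hp.d_pos.trans hp.d_lt_D
  have hr := p.levelRange_pos b
  have hq := abs_nonneg (quantile (empCDF x₀) p.ratio)
  rw [levelBound, level₁]
  split_ifs with h
  · linarith
  · have := quantile_empCDF_mem_Icc (epochLength_pos (m - 1)) (x := epochSample w (m - 1))
      (fun i => hw _) hp.ratio_pos hp.ratio_le_one
    rw [abs_of_nonneg (hp.d_pos.le.trans this.1)]
    linarith [this.2]

theorem level₂_mem_Icc (hs : 0 ≤ p.sMax) (hy : ∀ m, y₀ m ∈ Icc b p.sMax) (m : ℕ) :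
    level₂ p T δ y₀ d₀ w m ∈ Icc (min b 0) p.sMax := by
  rw [level₂]
  split_ifs with h
  · exact ⟨(min_le_left _ _).trans (hy 0).1, (hy 0).2⟩
  · exact ogdOutput_mem_Icc (epochLength_pos _) hs T δ _ (hy _) d₀

theorem abs_level₂_le (hp : p.Valid) (hs : 0 ≤ p.sMax) (hy : ∀ m, y₀ m ∈ Icc b p.sMax) (m : ℕ) :
    |level₂ p T δ y₀ d₀ w m| ≤ levelBound p b x₀ := by
  have h1 := abs_sub_le_levelRange (level₂_mem_Icc (T := T) (δ := δ) (d₀ := d₀) (w := w) hs hy m)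
    (z := 0) ⟨le_rfl, hs⟩
  have hD : 0 < p.D := hp.d_pos.trans hp.d_lt_D
  have hq := abs_nonneg (quantile (empCDF x₀) p.ratio)
  rw [sub_zero] at h1
  rw [levelBound]; linarith

theorem measurable_epochSample (m : ℕ) : Measurable fun w : ℕ → ℝ => epochSample w m :=
  measurable_pi_lambda _ fun _ => measurable_pi_apply _

theorem measurable_ogdOutput (hp : p.Valid) {L : ℕ} (hL : 0 < L) (T : ℕ) (δ y d₀ : ℝ) :
    Measurable fun x : Fin L → ℝ => ogdOutput p T δ x y d₀ :=
  (Finset.measurable_sum _ fun j _ => measurable_ogdIter hp hL T δ y d₀ j).div_const _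

theorem measurable_level₁ (hp : p.Valid) (m : ℕ) : Measurable fun w => level₁ p x₀ w m := by
  unfold level₁
  split_ifs
  · exact measurable_const
  · exact (measurable_quantile_empCDF (epochLength_pos _) hp.ratio_pos hp.ratio_le_one).comp
      (measurable_epochSample _)

theorem measurable_level₂ (hp : p.Valid) (m : ℕ) : Measurable fun w => level₂ p T δ y₀ d₀ w m := by
  unfold level₂
  split_ifs
  · exact measurable_const
  · exact (measurable_ogdOutput hp (epochLength_pos _) T δ _ d₀).comp (measurable_epochSample _)

theorem measurable_state {S₁ S₂ : (ℕ → ℝ) → ℕ → ℝ} (h₁ : ∀ t, Measurable fun w => S₁ w t)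
    (h₂ : ∀ t, Measurable fun w => S₂ w t) (t : ℕ) :
    (Measurable fun w => (state (S₁ w) (S₂ w) w t).inv₁) ∧
    (Measurable fun w => (state (S₁ w) (S₂ w) w t).inv₂) ∧
    Measurable fun w => (state (S₁ w) (S₂ w) w t).late := by
  induction t with
  | zero => exact ⟨h₁ 1, h₂ 1, measurable_const⟩
  | succ t ih =>
    cases t with
    | zero => exact ⟨h₁ 1, h₂ 1, measurable_const⟩
    | succ t =>
      obtain ⟨i1, i2, i3⟩ := ih
      have h3 := h₁ (t + 2)
      have h4 := h₂ (t + 2)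
      have h5 : Measurable fun w : ℕ → ℝ => w (t + 1) := measurable_pi_apply _
      simp only [state, State.step, State.after₁, State.after₂, State.order]
      refine ⟨?_, ?_, ?_⟩ <;> fun_prop

theorem measurable_roundLoss {S₁ S₂ : (ℕ → ℝ) → ℕ → ℝ} (h₁ : ∀ t, Measurable fun w => S₁ w t)
    (h₂ : ∀ t, Measurable fun w => S₂ w t) (t : ℕ) :
    Measurable fun w => roundLoss p (S₁ w) (S₂ w) w t := by
  obtain ⟨i1, i2, i3⟩ := measurable_state h₁ h₂ t
  have h3 := h₁ (t + 1)
  have h5 : Measurable fun w : ℕ → ℝ => w t := measurable_pi_apply _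
  simp only [roundLoss, State.order, State.after₁]
  fun_prop

/-- The loss of round `t` under the algorithm. -/
noncomputable def algLoss (p : Params) {n₀ : ℕ} (x₀ : Fin n₀ → ℝ) (y₀ : ℕ → ℝ) (d₀ : ℝ) (T : ℕ)
    (δ : ℝ) (t : ℕ) (w : ℕ → ℝ) : ℝ :=
  roundLoss p (fun t => level₁ p x₀ w (epochOf t)) (fun t => level₂ p T δ y₀ d₀ w (epochOf t)) w t

theorem measurable_algLoss (hp : p.Valid) (t : ℕ) : Measurable (algLoss p x₀ y₀ d₀ T δ t) :=
  measurable_roundLoss (S₁ := fun w t => level₁ p x₀ w (epochOf t))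
    (S₂ := fun w t => level₂ p T δ y₀ d₀ w (epochOf t))
    (fun _ => measurable_level₁ hp _) (fun _ => measurable_level₂ hp _) t

/-- A bound for the loss of a round. -/
noncomputable def lossBound (p : Params) (b : ℝ) {n₀ : ℕ} (x₀ : Fin n₀ → ℝ) : ℝ :=
  (p.h₁ + p.p₁) * (4 * levelBound p b x₀ + 2 * p.D) + p.h₂ * levelBound p b x₀

theorem algLoss_mem_Icc (hp : p.Valid) (hs : 0 ≤ p.sMax) (hy : ∀ m, y₀ m ∈ Icc b p.sMax)
    (hw : ∀ t, w t ∈ Icc p.d p.D) {t : ℕ} (ht : 1 ≤ t) :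
    algLoss p x₀ y₀ d₀ T δ t w ∈ Icc 0 (lossBound p b x₀) :=
  roundLoss_mem_Icc hp (fun _ => abs_level₁_le hp hw _) (fun _ => abs_level₂_le hp hs hy _)
    (fun t => ⟨hp.d_pos.le.trans (hw t).1, (hw t).2⟩) ht

/-- The loss of a round in the steady state, with `q.1` and `q.2` the previous and the current
demand. -/
noncomputable def steadyLoss (p : Params) (s₁ s₂ : ℝ) (q : ℝ × ℝ) : ℝ :=
  cost p (s₁ - max (q.1 - s₂) 0 - q.2) + p.h₂ * max (s₂ - q.2) 0

theorem epochOf_two_pow_add {k i : ℕ} (hi : i < 2 ^ k) : epochOf (2 ^ k + i) = k + 1 := by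
  rw [epochOf, (Nat.log_eq_iff (Or.inr ⟨one_lt_two, by positivity⟩)).2]
  rw [pow_succ]
  omega

/-- All but a bounded number of rounds of an epoch are steady. The last round of an epoch is not
covered, as its order depends on the level of the next epoch. -/
theorem algLoss_eq_steadyLoss (hp : p.Valid) (hs : 0 ≤ p.sMax) (hy : ∀ m, y₀ m ∈ Icc b p.sMax)
    (hw : ∀ t, w t ∈ Icc p.d p.D) {N k i : ℕ} (hN : 2 * levelBound p b x₀ ≤ p.d * N)
    (hi : 2 * N ≤ i) (hik : i + 2 < 2 ^ k) :
    algLoss p x₀ y₀ d₀ T δ (2 ^ k + i + 1) w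
      = steadyLoss p (level₁ p x₀ w (k + 1)) (level₂ p T δ y₀ d₀ w (k + 1))
        (w (2 ^ k + i), w (2 ^ k + i + 1)) :=
  roundLoss_eq_of_steady hp (fun _ => abs_level₁_le hp hw _) (fun _ => abs_level₂_le hp hs hy _)
    hw Nat.one_le_two_pow hN (fun j hj => by rw [epochOf_two_pow_add hj])
    (fun j hj => by rw [epochOf_two_pow_add hj]) hi hik

end Levels

/-! ### Expectations under independent demands -/

theorem continuous_steadyLoss (p : Params) (s₁ s₂ : ℝ) : Continuous (steadyLoss p s₁ s₂) := by
  unfold steadyLoss cost; fun_prop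

theorem measurable_steadyLoss (p : Params) :
    Measurable fun r : (ℝ × ℝ) × (ℝ × ℝ) => steadyLoss p r.1.1 r.1.2 r.2 := by
  unfold steadyLoss cost; fun_prop

theorem integral_steadyLoss (hp : p.Valid) (hφ : IsDemandDensity p φ) (s₁ s₂ : ℝ) :
    ∫ q, steadyLoss p s₁ s₂ q ∂(demandLaw φ).prod (demandLaw φ) = avgLoss p φ s₁ s₂ := by
  have := hφ.isProbabilityMeasure hp
  have hae : ∀ᵐ q ∂(demandLaw φ).prod (demandLaw φ), q ∈ Icc p.d p.D ×ˢ Icc p.d p.D := by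
    have h1 := Measure.quasiMeasurePreserving_fst (μ := demandLaw φ) (ν := demandLaw φ)
    have h2 := Measure.quasiMeasurePreserving_snd (μ := demandLaw φ) (ν := demandLaw φ)
    filter_upwards [h1.ae hφ.ae_mem_Icc, h2.ae hφ.ae_mem_Icc] with q hq1 hq2
    exact ⟨hq1, hq2⟩
  obtain ⟨K, hK⟩ := (isCompact_Icc (a := p.d) (b := p.D)).prod
    (isCompact_Icc (a := p.d) (b := p.D)) |>.exists_bound_of_continuousOn
    (continuous_steadyLoss p s₁ s₂).continuousOn
  have hint : Integrable (steadyLoss p s₁ s₂) ((demandLaw φ).prod (demandLaw φ)) :=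
    Integrable.of_bound (continuous_steadyLoss p s₁ s₂).aestronglyMeasurable K (hae.mono hK)
  have hc := expCost_continuous hp hφ
  rw [integral_prod _ hint, avgLoss]
  unfold condLoss
  have h1 : ∀ x, ∫ y, steadyLoss p s₁ s₂ (x, y) ∂demandLaw φ
      = expCost p φ (s₁ - max (x - s₂) 0) + p.h₂ * ∫ y, max (s₂ - y) 0 ∂demandLaw φ := by
    intro x
    have h2 : Integrable (fun y => p.h₂ * max (s₂ - y) 0) (demandLaw φ) :=
      hφ.integrable_of_continuous hp (by fun_prop)
    have h3 := integral_add (integrable_cost hp hφ (s₁ - max (x - s₂) 0)) h2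
    rw [integral_const_mul] at h3
    exact h3
  simp only [h1]
  rw [integral_add (hφ.integrable_of_continuous hp (by fun_prop)) (integrable_const _),
    integral_add (hφ.integrable_of_continuous hp (by fun_prop))
    (hφ.integrable_of_continuous hp (by fun_prop)), integral_const_mul]
  simp [add_comm, integral_const_mul]

section Demands

variable {Ω : Type*} [MeasurableSpace Ω] {P : Measure Ω} {dem : ℕ → Ω → ℝ}

theorem ae_demand_mem_Icc (hφ : IsDemandDensity p φ) (hm : ∀ t, Measurable (dem t))
    (hlaw : ∀ t, P.map (dem t) = demandLaw φ) : ∀ᵐ ω ∂P, ∀ t, dem t ω ∈ Icc p.d p.D := by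
  refine ae_all_iff.2 fun t => ?_
  have := hφ.ae_mem_Icc
  rw [← hlaw t] at this
  exact ae_of_ae_map (hm t).aemeasurable this

theorem map_epochSample [IsProbabilityMeasure P] (hm : ∀ t, Measurable (dem t))
    (hlaw : ∀ t, P.map (dem t) = demandLaw φ) (hind : iIndepFun dem P) (m : ℕ) :
    P.map (fun ω => epochSample (fun t => dem t ω) m) = Measure.pi fun _ => demandLaw φ := by
  have hinj : Function.Injective fun i : Fin (epochLength m) => 2 ^ (m - 1) + (i : ℕ) :=
    fun i j h => Fin.ext (by simpa using h)
  have h := (iIndepFun_iff_map_fun_eq_pi_map fun i => (hm _).aemeasurable).1 (hind.precomp hinj)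
  simp only [hlaw] at h
  exact h

theorem measurable_demands (hm : ∀ t, Measurable (dem t)) :
    Measurable fun ω t => dem t ω := measurable_pi_lambda _ hm

/-- The demands of an epoch are independent of the two demands of later rounds. -/
theorem map_epochSample_prod [IsProbabilityMeasure P] (hm : ∀ t, Measurable (dem t))
    (hlaw : ∀ t, P.map (dem t) = demandLaw φ) (hind : iIndepFun dem P) {m t : ℕ} (hm1 : 1 ≤ m)
    (ht : 2 ^ m ≤ t) :
    P.map (fun ω => (epochSample (fun t => dem t ω) m, (dem t ω, dem (t + 1) ω)))
      = (Measure.pi fun _ => demandLaw φ).prod ((demandLaw φ).prod (demandLaw φ)) := by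
  have hpow : 2 ^ m = 2 ^ (m - 1) + 2 ^ (m - 1) := by
    obtain ⟨k, rfl⟩ : ∃ k, m = k + 1 := ⟨m - 1, by omega⟩
    rw [Nat.add_sub_cancel, pow_succ]; ring
  set A := Finset.range (2 ^ m) with hA
  set B : Finset ℕ := {t, t + 1} with hB
  have hdisj : Disjoint A B := by
    rw [Finset.disjoint_left]
    intro i hi hi'
    simp only [hA, hB, Finset.mem_range, Finset.mem_insert, Finset.mem_singleton] at hi hi'
    omega
  have h1 := hind.indepFun_finset A B hdisj hm
  have hlt (i : Fin (epochLength m)) : 2 ^ (m - 1) + (i : ℕ) ∈ A := by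
    have hi : (i : ℕ) < 2 ^ (m - 1) := i.2
    rw [hA, Finset.mem_range]; omega
  let f : (A → ℝ) → Fin (epochLength m) → ℝ := fun v i => v ⟨_, hlt i⟩
  let g : (B → ℝ) → ℝ × ℝ := fun v => (v ⟨t, by simp [hB]⟩, v ⟨t + 1, by simp [hB]⟩)
  have hf : Measurable f := measurable_pi_lambda _ fun _ => measurable_pi_apply _
  have hg : Measurable g := (measurable_pi_apply _).prodMk (measurable_pi_apply _)
  have h2 : IndepFun (fun ω => epochSample (fun t => dem t ω) m)
      (fun ω => (dem t ω, dem (t + 1) ω)) P := h1.comp hf hg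
  have hms : Measurable fun ω => epochSample (fun t => dem t ω) m :=
    (measurable_epochSample m).comp (measurable_demands hm)
  have h3 := hind.indepFun (i := t) (j := t + 1) (by omega)
  rw [(indepFun_iff_map_prod_eq_prod_map_map
      hms.aemeasurable ((hm _).prodMk (hm _)).aemeasurable).1 h2,
    (indepFun_iff_map_prod_eq_prod_map_map (hm _).aemeasurable (hm _).aemeasurable).1 h3,
    map_epochSample hm hlaw hind, hlaw, hlaw]

end Demands

/-! ### The levels of the last epoch -/

section Guarantees

variable {n₀ : ℕ}

/-- The number of rounds up to round `t` is at most four times the sample size available to the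
epoch of `t`. -/
theorem epochLength_epochOf {t : ℕ} (ht : 2 ≤ t) :
    epochLength (epochOf t - 1) ≤ t ∧ t ≤ 4 * epochLength (epochOf t - 1) := by
  have h1 : 1 ≤ Nat.log 2 t := (Nat.le_log_iff_pow_le one_lt_two (by omega)).2 (by omega)
  obtain ⟨k, hk⟩ : ∃ k, Nat.log 2 t = k + 1 := ⟨Nat.log 2 t - 1, by omega⟩
  have h2 := Nat.pow_log_le_self 2 (x := t) (by omega)
  have h3 := Nat.lt_pow_succ_log_self one_lt_two t
  simp only [epochLength, epochOf, hk, Nat.add_sub_cancel, Nat.succ_eq_add_one, pow_succ] at *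
  omega

theorem sqrt_div_le_two_mul {ℓ : ℝ} (hℓ : 0 ≤ ℓ) {L t : ℕ} (hL : 0 < L) (ht : 0 < t)
    (h : t ≤ 4 * L) : √(ℓ / L) ≤ 2 * √(ℓ / t) := by
  have hL' : (0 : ℝ) < L := by exact_mod_cast hL
  have ht' : (0 : ℝ) < t := by exact_mod_cast ht
  have h' : (t : ℝ) ≤ 4 * L := by exact_mod_cast h
  rw [show (2 : ℝ) * √(ℓ / t) = √(2 ^ 2 * (ℓ / t)) by
    rw [Real.sqrt_mul (by norm_num), Real.sqrt_sq (by norm_num)]]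
  refine Real.sqrt_le_sqrt ?_
  rw [← mul_div_assoc, div_le_div_iff₀ hL' ht']
  nlinarith

theorem sqrt_sqrt_div {ℓ T : ℝ} (hℓ : 0 ≤ ℓ) (hT : 0 < T) :
    √(√(ℓ / T)) = T ^ (-(1 / 4) : ℝ) * ℓ ^ (1 / 4 : ℝ) := by
  rw [Real.sqrt_eq_rpow, Real.sqrt_eq_rpow, ← Real.rpow_mul (by positivity),
    Real.div_rpow hℓ hT.le, Real.rpow_neg hT.le]
  norm_num
  ring

theorem abs_bestLevel₁_le (hp : p.Valid) (hφ : IsDemandDensity p φ) :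
    |bestLevel₁ p φ| ≤ p.D := by
  rw [abs_of_pos (hp.d_pos.trans (d_lt_bestLevel₁ hp hφ))]
  exact bestLevel₁_le hp hφ

/-- The levels of the epoch of round `T` are close to the best ones with high probability. Quadratic
growth of the expected loss turns the bound for the excess loss into one for the second level. -/
theorem exists_level_bound (hp : p.Valid) (b : ℝ) (x₀ : Fin n₀ → ℝ) :
    ∃ C : ℝ, 0 < C ∧ ∀ φ, IsDemandDensity p φ → ∀ z, 0 ≤ z → z ≤ p.sMax →
      (∀ x, avgLoss p φ (bestLevel₁ p φ) z ≤ avgLoss p φ (bestLevel₁ p φ) x) →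
      ∀ (Ω : Type*) [MeasurableSpace Ω] (P : Measure Ω) [IsProbabilityMeasure P]
        (dem : ℕ → Ω → ℝ), (∀ t, Measurable (dem t)) → (∀ t, P.map (dem t) = demandLaw φ) →
        iIndepFun dem P → ∀ y₀ : ℕ → ℝ, (∀ m, y₀ m ∈ Icc b p.sMax) → ∀ d₀ : ℝ,
        ∀ T : ℕ, 1 ≤ T → ∀ δ : ℝ, 0 < δ → δ ≤ 1 / 2 →
          1 - δ ≤ P.real {ω |
            |level₁ p x₀ (fun t => dem t ω) (epochOf T) - bestLevel₁ p φ|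
                ≤ C * √(Real.log (T / δ) / T) ∧
            |level₂ p T δ y₀ d₀ (fun t => dem t ω) (epochOf T) - z|
                ≤ C * ((T : ℝ) ^ (-(1 / 4) : ℝ) * Real.log (T / δ) ^ (1 / 4 : ℝ))} := by
  have hD : 0 < p.D := hp.d_pos.trans hp.d_lt_D
  obtain ⟨K, hK0, hK⟩ := exists_epoch_bound hp b
  obtain ⟨μ, hμ, hquad⟩ := exists_quadratic_growth hp (p.levelRange b) (p.levelRange_pos b).le
  have hr := p.levelRange_pos b
  obtain ⟨q₀, hq₀⟩ : ∃ q₀, q₀ = quantile (empCDF x₀) p.ratio := ⟨_, rfl⟩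
  refine ⟨2 * K + √(2 * K / μ) + 2 * (|q₀| + p.D + p.levelRange b), by positivity, ?_⟩
  intro φ hφ z hz0 hzs hz Ω _ P _ dem hm hlaw hind y₀ hy d₀ T hT δ hδ hδ2
  have hℓ := half_le_log_div hT hδ hδ2
  set ℓ := Real.log (T / δ) with hℓ_def
  have hT' : (0 : ℝ) < T := by exact_mod_cast hT
  have hs0 := Real.sqrt_nonneg (ℓ / T)
  rw [← sqrt_sqrt_div (by linarith) hT']
  have hs1 := Real.sqrt_nonneg (√(ℓ / T))
  have hq1 := Real.sqrt_nonneg (2 * K / μ)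
  rcases hT.eq_or_lt with rfl | hT2
  · -- In the first epoch the levels are bounded, and `log (1 / δ) ≥ 1 / 2`.
    have e1 : 1 / 2 ≤ √(ℓ / (1 : ℕ)) := by
      refine Real.le_sqrt_of_sq_le ?_
      rw [Nat.cast_one, div_one]; linarith
    have e2 : 1 / 2 ≤ √(√(ℓ / (1 : ℕ))) := by
      refine Real.le_sqrt_of_sq_le ?_
      linarith
    have hb := abs_bestLevel₁_le hp hφ
    have hx := abs_sub_le_levelRange (x := y₀ 0) (z := z)
      ⟨(min_le_left b 0).trans (hy 0).1, (hy 0).2⟩ ⟨hz0, hzs⟩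
    have hall : {ω : Ω | |level₁ p x₀ (fun t => dem t ω) (epochOf 1) - bestLevel₁ p φ|
          ≤ (2 * K + √(2 * K / μ) + 2 * (|q₀| + p.D + p.levelRange b)) * √(ℓ / (1 : ℕ)) ∧
        |level₂ p 1 δ y₀ d₀ (fun t => dem t ω) (epochOf 1) - z|
          ≤ (2 * K + √(2 * K / μ) + 2 * (|q₀| + p.D + p.levelRange b))
            * √(√(ℓ / (1 : ℕ)))} = univ := by
      refine eq_univ_of_forall fun ω => ⟨?_, ?_⟩
      · rw [level₁, if_pos (by simp [epochOf]), ← hq₀]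
        have := abs_sub q₀ (bestLevel₁ p φ)
        nlinarith [abs_nonneg q₀]
      · rw [level₂, if_pos (by simp [epochOf])]
        nlinarith [abs_nonneg q₀]
    rw [hall, probReal_univ]
    linarith
  · obtain ⟨hL1, hL2⟩ := epochLength_epochOf hT2
    have hm2 : 2 ≤ epochOf T := by
      have : 1 ≤ Nat.log 2 T := (Nat.le_log_iff_pow_le one_lt_two (by omega)).2 (by omega)
      rw [epochOf]; omega
    set m := epochOf T
    have hL := epochLength_pos (m - 1)
    -- The bad event for the sample is pulled back to `Ω`; it need not be measurable.
    have hbad := hK φ hφ z hz0 hz _ T hL hL1 δ hδ hδ2 _ (hy (m - 1)) d₀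
    rw [← map_epochSample hm hlaw hind (m - 1)] at hbad
    have hms : AEMeasurable (fun ω => epochSample (fun t => dem t ω) (m - 1)) P :=
      ((measurable_epochSample (m - 1)).comp (measurable_demands hm)).aemeasurable
    have hroot := sqrt_div_le_two_mul (ℓ := ℓ) (by linarith) hL (by omega) hL2
    set bad := {x : Fin (epochLength (m - 1)) → ℝ |
      ¬(|quantile (empCDF x) p.ratio - bestLevel₁ p φ| ≤ K * √(ℓ / epochLength (m - 1)) ∧
        avgLoss p φ (bestLevel₁ p φ) (ogdOutput p T δ x (y₀ (m - 1)) d₀)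
          - avgLoss p φ (bestLevel₁ p φ) z ≤ K * √(ℓ / epochLength (m - 1)))}
    have hpre : P.real ((fun ω => epochSample (fun t => dem t ω) (m - 1)) ⁻¹' bad) ≤ δ :=
      (ENNReal.toReal_mono (measure_ne_top _ _) (Measure.le_map_apply hms bad)).trans hbad
    set good := {ω : Ω | |level₁ p x₀ (fun t => dem t ω) m - bestLevel₁ p φ|
          ≤ (2 * K + √(2 * K / μ) + 2 * (|q₀| + p.D + p.levelRange b)) * √(ℓ / T) ∧
        |level₂ p T δ y₀ d₀ (fun t => dem t ω) m - z|
          ≤ (2 * K + √(2 * K / μ) + 2 * (|q₀| + p.D + p.levelRange b)) * √(√(ℓ / T))}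
    have hcover : univ ⊆ good ∪ (fun ω => epochSample (fun t => dem t ω) (m - 1)) ⁻¹' bad := by
      intro ω _
      by_cases hω : epochSample (fun t => dem t ω) (m - 1) ∈ bad
      · exact Or.inr hω
      · obtain ⟨g1, g2⟩ := not_not.1 hω
        refine Or.inl ⟨?_, ?_⟩
        · rw [level₁_of_two_le hm2]
          nlinarith [abs_nonneg q₀]
        · rw [level₂_of_two_le hm2]
          set x := ogdOutput p T δ (epochSample (fun t => dem t ω) (m - 1)) (y₀ (m - 1)) d₀
          have hx := hquad φ hφ z hz x (abs_sub_le_levelRange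
            (ogdOutput_mem_Icc hL (hz0.trans hzs) T δ _ (hy _) d₀) ⟨hz0, hzs⟩)
          have hx2 : (x - z) ^ 2 ≤ 2 * K / μ * √(ℓ / T) := by
            rw [div_mul_eq_mul_div, le_div_iff₀ hμ]
            nlinarith
          have hx3 := Real.abs_le_sqrt hx2
          rw [Real.sqrt_mul (by positivity)] at hx3
          nlinarith [abs_nonneg q₀]
    have h1 : P.real univ ≤ P.real good
        + P.real ((fun ω => epochSample (fun t => dem t ω) (m - 1)) ⁻¹' bad) :=
      (measureReal_mono hcover).trans (measureReal_union_le _ _)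
    rw [probReal_univ] at h1
    linarith

/-! ### The expected regret -/

theorem avgLoss_bestLevel₁_sub_le (hp : p.Valid) (hφ : IsDemandDensity p φ) (x z : ℝ) :
    avgLoss p φ (bestLevel₁ p φ) x - avgLoss p φ (bestLevel₁ p φ) z ≤ p.gradBound * |x - z| := by
  have h1 := avgLoss_subgradient hp hφ z x
  have h2 := abs_lossDeriv_le hp hφ x
  have h3 := neg_abs_le (lossDeriv p φ x * (z - x))
  rw [abs_mul, abs_sub_comm] at h3
  have := mul_le_mul_of_nonneg_right h2 (abs_nonneg (x - z))
  linarith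

/-- A bound for the excess of the expected loss over its minimum, for arbitrary levels in the
range of the algorithm. -/
noncomputable def excessBound (p : Params) (b : ℝ) : ℝ :=
  (p.h₁ + p.p₁) * (2 * p.D) + p.gradBound * p.levelRange b

theorem excessBound_nonneg (hp : p.Valid) (b : ℝ) : 0 ≤ excessBound p b := by
  have h1 := hp.sum_pos
  have h2 := hp.gradBound_pos
  have h3 := p.levelRange_pos b
  have hD : 0 < p.D := hp.d_pos.trans hp.d_lt_D
  unfold excessBound; positivity

/-- The expected loss of a steady round with levels computed from an independent sample, given a
bound for these levels that fails with probability at most `δ`. -/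
theorem integral_steadyLoss_level_le (hp : p.Valid) (hφ : IsDemandDensity p φ) {b z : ℝ}
    (hz0 : 0 ≤ z) (hzs : z ≤ p.sMax) {L T : ℕ} (hL : 0 < L) {δ ε y d₀ : ℝ}
    (hε : 0 ≤ ε) (hy : y ∈ Icc b p.sMax)
    (hbad : (Measure.pi fun _ : Fin L => demandLaw φ).real
        {x | ¬(|quantile (empCDF x) p.ratio - bestLevel₁ p φ| ≤ ε ∧
          avgLoss p φ (bestLevel₁ p φ) (ogdOutput p T δ x y d₀) - avgLoss p φ (bestLevel₁ p φ) z
            ≤ ε)} ≤ δ)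
    (hint : Integrable (fun r : (Fin L → ℝ) × (ℝ × ℝ) =>
      steadyLoss p (quantile (empCDF r.1) p.ratio) (ogdOutput p T δ r.1 y d₀) r.2)
      ((Measure.pi fun _ => demandLaw φ).prod ((demandLaw φ).prod (demandLaw φ)))) :
    ∫ r, steadyLoss p (quantile (empCDF r.1) p.ratio) (ogdOutput p T δ r.1 y d₀) r.2
        ∂((Measure.pi fun _ : Fin L => demandLaw φ).prod ((demandLaw φ).prod (demandLaw φ)))
      ≤ avgLoss p φ (bestLevel₁ p φ) z + (p.h₁ + p.p₁ + 1) * ε + excessBound p b * δ := by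
  have := hφ.isProbabilityMeasure hp
  have hsum := hp.sum_pos
  have hE := excessBound_nonneg hp b
  have hD : 0 < p.D := hp.d_pos.trans hp.d_lt_D
  set π := Measure.pi fun _ : Fin L => demandLaw φ with hπ
  set bad := {x : Fin L → ℝ | ¬(|quantile (empCDF x) p.ratio - bestLevel₁ p φ| ≤ ε ∧
          avgLoss p φ (bestLevel₁ p φ) (ogdOutput p T δ x y d₀) - avgLoss p φ (bestLevel₁ p φ) z
            ≤ ε)} with hbad_def
  have hint2 := hint.integral_prod_left
  rw [integral_prod _ hint]
  simp only [integral_steadyLoss hp hφ] at hint2 ⊢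
  have hae : ∀ᵐ x ∂π, ∀ i, x i ∈ Icc p.d p.D := ae_all_iff.2 fun i =>
    (measurePreserving_eval (fun _ : Fin L => demandLaw φ) i).quasiMeasurePreserving.ae
      hφ.ae_mem_Icc
  have hmeas : MeasurableSet (toMeasurable π bad) := measurableSet_toMeasurable _ _
  have hi2 : Integrable (fun x => avgLoss p φ (bestLevel₁ p φ) z + (p.h₁ + p.p₁ + 1) * ε
      + (toMeasurable π bad).indicator (fun _ => excessBound p b) x) π :=
    (integrable_const _).add ((integrable_const _).indicator hmeas)
  have hle : (fun x : Fin L → ℝ => avgLoss p φ (quantile (empCDF x) p.ratio)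
      (ogdOutput p T δ x y d₀)) ≤ᵐ[π] fun x => avgLoss p φ (bestLevel₁ p φ) z
      + (p.h₁ + p.p₁ + 1) * ε + (toMeasurable π bad).indicator (fun _ => excessBound p b) x := by
    filter_upwards [hae] with x hx
    have h1 := (le_abs_self _).trans (abs_avgLoss_sub_le hp hφ (quantile (empCDF x) p.ratio)
      (bestLevel₁ p φ) (ogdOutput p T δ x y d₀))
    by_cases hxb : x ∈ bad
    · rw [indicator_of_mem (subset_toMeasurable _ _ hxb)]
      have h2 := avgLoss_bestLevel₁_sub_le hp hφ (ogdOutput p T δ x y d₀) z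
      have h3 := abs_sub_le_levelRange (ogdOutput_mem_Icc hL (hz0.trans hzs) T δ x hy d₀)
        (z := z) ⟨hz0, hzs⟩
      have h4 := mul_le_mul_of_nonneg_left h3 hp.gradBound_pos.le
      have h5 := quantile_empCDF_mem_Icc hL hx hp.ratio_pos hp.ratio_le_one
      have h6 := abs_bestLevel₁_le hp hφ
      have h7 : |quantile (empCDF x) p.ratio - bestLevel₁ p φ| ≤ 2 * p.D := by
        have := abs_sub (quantile (empCDF x) p.ratio) (bestLevel₁ p φ)
        rw [abs_of_nonneg (hp.d_pos.le.trans h5.1)] at this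
        linarith [h5.2]
      have h8 := mul_le_mul_of_nonneg_left h7 hsum.le
      have h9 : 0 ≤ (p.h₁ + p.p₁ + 1) * ε := by positivity
      rw [excessBound]
      linarith
    · obtain ⟨g1, g2⟩ := not_not.1 hxb
      have h2 := mul_le_mul_of_nonneg_left g1 hsum.le
      have h3 : 0 ≤ (toMeasurable π bad).indicator (fun _ => excessBound p b) x :=
        indicator_nonneg (fun _ _ => hE) x
      linarith
  refine (integral_mono_ae hint2 hi2 hle).trans ?_
  rw [integral_add (integrable_const _) ((integrable_const _).indicator hmeas), integral_const,
    integral_indicator_const _ hmeas, probReal_univ, one_smul, smul_eq_mul, measureReal_def,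
    measure_toMeasurable, ← measureReal_def, mul_comm]
  have := mul_le_mul_of_nonneg_left hbad hE
  linarith

end Guarantees

section Regret

variable {n₀ : ℕ} {x₀ : Fin n₀ → ℝ} {Ω : Type*} [MeasurableSpace Ω] {P : Measure Ω}
  {dem : ℕ → Ω → ℝ} {b d₀ δ : ℝ} {y₀ : ℕ → ℝ} {T : ℕ}

theorem ae_algLoss_mem_Icc (hp : p.Valid) (hφ : IsDemandDensity p φ) (hs : 0 ≤ p.sMax)
    (hm : ∀ t, Measurable (dem t)) (hlaw : ∀ t, P.map (dem t) = demandLaw φ)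
    (hy : ∀ m, y₀ m ∈ Icc b p.sMax) {t : ℕ} (ht : 1 ≤ t) :
    ∀ᵐ ω ∂P, algLoss p x₀ y₀ d₀ T δ t (fun s => dem s ω) ∈ Icc 0 (lossBound p b x₀) := by
  filter_upwards [ae_demand_mem_Icc hφ hm hlaw] with ω hω
  exact algLoss_mem_Icc hp hs hy hω ht

theorem integrable_algLoss [IsProbabilityMeasure P] (hp : p.Valid) (hφ : IsDemandDensity p φ)
    (hs : 0 ≤ p.sMax) (hm : ∀ t, Measurable (dem t)) (hlaw : ∀ t, P.map (dem t) = demandLaw φ)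
    (hy : ∀ m, y₀ m ∈ Icc b p.sMax) {t : ℕ} (ht : 1 ≤ t) :
    Integrable (fun ω => algLoss p x₀ y₀ d₀ T δ t (fun s => dem s ω)) P := by
  refine Integrable.of_bound
    ((measurable_algLoss hp t).comp (measurable_demands hm)).aestronglyMeasurable
    (lossBound p b x₀) ?_
  filter_upwards [ae_algLoss_mem_Icc (x₀ := x₀) (d₀ := d₀) (T := T) (δ := δ) hp hφ hs hm hlaw hy ht]
    with ω hω
  rw [Real.norm_of_nonneg hω.1]
  exact hω.2

/-- The loss of a round that is not within a bounded distance of the ends of its epoch. There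
the inventories follow the desired levels, which are independent of the two latest demands. -/
theorem integral_algLoss_le [IsProbabilityMeasure P] (hp : p.Valid) (hφ : IsDemandDensity p φ)
    {z : ℝ} (hz0 : 0 ≤ z) (hzs : z ≤ p.sMax) (hm : ∀ t, Measurable (dem t))
    (hlaw : ∀ t, P.map (dem t) = demandLaw φ) (hind : iIndepFun dem P)
    (hy : ∀ m, y₀ m ∈ Icc b p.sMax) {N k i : ℕ} (hN : 2 * levelBound p b x₀ ≤ p.d * N)
    (hi : 2 * N ≤ i) (hik : i + 2 < 2 ^ k) {ε : ℝ} (hε : 0 ≤ ε)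
    (hbad : (Measure.pi fun _ : Fin (epochLength k) => demandLaw φ).real
        {x | ¬(|quantile (empCDF x) p.ratio - bestLevel₁ p φ| ≤ ε ∧
          avgLoss p φ (bestLevel₁ p φ) (ogdOutput p T δ x (y₀ k) d₀)
            - avgLoss p φ (bestLevel₁ p φ) z ≤ ε)} ≤ δ) :
    ∫ ω, algLoss p x₀ y₀ d₀ T δ (2 ^ k + i + 1) (fun s => dem s ω) ∂P
      ≤ avgLoss p φ (bestLevel₁ p φ) z + (p.h₁ + p.p₁ + 1) * ε + excessBound p b * δ := by
  have hs := hz0.trans hzs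
  have hk : 1 ≤ k := by
    rcases Nat.eq_zero_or_pos k with rfl | h
    · rw [pow_zero] at hik; omega
    · exact h
  have hF : Measurable fun r : (Fin (epochLength k) → ℝ) × (ℝ × ℝ) =>
      steadyLoss p (quantile (empCDF r.1) p.ratio) (ogdOutput p T δ r.1 (y₀ k) d₀) r.2 :=
    (measurable_steadyLoss p).comp
      ((((measurable_quantile_empCDF (epochLength_pos k) hp.ratio_pos hp.ratio_le_one).comp
        measurable_fst).prodMk
        ((measurable_ogdOutput hp (epochLength_pos k) T δ _ d₀).comp measurable_fst)).prodMk
      measurable_snd)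
  have hg : Measurable fun ω => (epochSample (fun t => dem t ω) k,
      (dem (2 ^ k + i) ω, dem (2 ^ k + i + 1) ω)) :=
    ((measurable_epochSample k).comp (measurable_demands hm)).prodMk ((hm _).prodMk (hm _))
  have hmap := map_epochSample_prod hm hlaw hind hk (t := 2 ^ k + i) (by omega)
  have heq : (fun ω => algLoss p x₀ y₀ d₀ T δ (2 ^ k + i + 1) (fun s => dem s ω)) =ᵐ[P]
      fun ω => steadyLoss p (quantile (empCDF (epochSample (fun t => dem t ω) k)) p.ratio)
        (ogdOutput p T δ (epochSample (fun t => dem t ω) k) (y₀ k) d₀)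
        (dem (2 ^ k + i) ω, dem (2 ^ k + i + 1) ω) := by
    filter_upwards [ae_demand_mem_Icc hφ hm hlaw] with ω hω
    rw [algLoss_eq_steadyLoss hp hs hy hω hN hi hik, level₁_of_two_le (by omega),
      level₂_of_two_le (by omega)]
    rfl
  have hint := (integrable_algLoss (x₀ := x₀) (d₀ := d₀) (T := T) (δ := δ) hp hφ hs hm hlaw hy
    (t := 2 ^ k + i + 1) (by omega)).congr heq
  rw [integral_congr_ae heq]
  have h1 := integral_map hg.aemeasurable (μ := P) hF.aestronglyMeasurable
  have h2 := (integrable_map_measure (μ := P) hF.aestronglyMeasurable hg.aemeasurable).2 hint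
  rw [hmap] at h1 h2
  rw [← h1]
  exact integral_steadyLoss_level_le hp hφ hz0 hzs (epochLength_pos k) hε (hy k) hbad h2

open Classical in
/-- The rounds up to `T` within a bounded distance of the ends of their epochs. -/
noncomputable def transientRounds (N T : ℕ) : Finset ℕ :=
  (Finset.Icc 1 T).filter fun t => ¬∃ k i, 2 * N ≤ i ∧ i + 2 < 2 ^ k ∧ t = 2 ^ k + i + 1

theorem mem_transientRounds {N T t : ℕ} : t ∈ transientRounds N T ↔
    (1 ≤ t ∧ t ≤ T) ∧ ¬∃ k i, 2 * N ≤ i ∧ i + 2 < 2 ^ k ∧ t = 2 ^ k + i + 1 := by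
  classical rw [transientRounds, Finset.mem_filter, Finset.mem_Icc]

theorem card_transientRounds_le (N T : ℕ) :
    (transientRounds N T).card ≤ (Nat.log 2 T + 1) * (2 * N + 2) := by
  have hsub : transientRounds N T
      ⊆ (Finset.range (Nat.log 2 T + 1) ×ˢ Finset.range (2 * N + 2)).image
        fun q => if q.2 ≤ 2 * N then 2 ^ q.1 + q.2 else 2 ^ q.1 + (2 ^ q.1 - 1) := by
    intro t ht
    obtain ⟨ht1, ht2⟩ := mem_transientRounds.1 ht
    have h1 := Nat.pow_log_le_self 2 (x := t) (by omega)
    have h2 := Nat.lt_pow_succ_log_self one_lt_two t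
    have h3 := Nat.log_mono_right (b := 2) ht1.2
    rw [Nat.succ_eq_add_one, pow_succ] at h2
    rw [Finset.mem_image]
    obtain ⟨j, hj⟩ := Nat.exists_eq_add_of_le h1
    by_cases hjN : j ≤ 2 * N
    · refine ⟨(Nat.log 2 t, j), ?_, ?_⟩
      · simp only [Finset.mem_product, Finset.mem_range]; omega
      · rw [if_pos hjN]; exact hj.symm
    · refine ⟨(Nat.log 2 t, 2 * N + 1), ?_, ?_⟩
      · simp only [Finset.mem_product, Finset.mem_range]; omega
      · rw [if_neg (by simp)]
        by_contra h
        dsimp only at h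
        exact ht2 ⟨Nat.log 2 t, j - 1, by omega, by omega, by omega⟩
  refine (Finset.card_le_card hsub).trans (Finset.card_image_le.trans ?_)
  rw [Finset.card_product, Finset.card_range, Finset.card_range]

theorem natLog_two_le {T : ℕ} (hT : 1 ≤ T) : (Nat.log 2 T : ℝ) ≤ 2 * Real.log T := by
  have h1 : ((2 : ℝ)) ^ Nat.log 2 T ≤ T := by
    exact_mod_cast Nat.pow_log_le_self 2 (x := T) (by omega)
  have h2 := Real.log_le_log (by positivity) h1
  rw [Real.log_pow] at h2
  have h3 : 1 / 2 ≤ Real.log 2 := by linarith [Real.log_two_gt_d9]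
  have h4 : (0 : ℝ) ≤ Nat.log 2 T := Nat.cast_nonneg _
  nlinarith

theorem avgLoss_nonneg (hp : p.Valid) (s₁ s₂ : ℝ) : 0 ≤ avgLoss p φ s₁ s₂ := by
  have := hp.h₂_pos
  refine integral_nonneg fun x => add_nonneg (by positivity) ?_
  exact integral_nonneg fun y => cost_nonneg hp _

/-- The expected losses of the rounds sum up to the regret bound: a steady round `t` contributes
`O(√(log T / t) + T ^ (-2))` and each of the `O(log T)` transient rounds contributes `O(1)`. -/
theorem exists_regret_bound (hp : p.Valid) (b : ℝ) (x₀ : Fin n₀ → ℝ) :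
    ∃ C : ℝ, 0 < C ∧ ∀ φ, IsDemandDensity p φ → ∀ z, 0 ≤ z → z ≤ p.sMax →
      (∀ x, avgLoss p φ (bestLevel₁ p φ) z ≤ avgLoss p φ (bestLevel₁ p φ) x) →
      ∀ (Ω : Type*) [MeasurableSpace Ω] (P : Measure Ω) [IsProbabilityMeasure P]
        (dem : ℕ → Ω → ℝ), (∀ t, Measurable (dem t)) → (∀ t, P.map (dem t) = demandLaw φ) →
        iIndepFun dem P → ∀ y₀ : ℕ → ℝ, (∀ m, y₀ m ∈ Icc b p.sMax) → ∀ d₀ : ℝ,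
        ∀ T : ℕ, 1 ≤ T →
          ∑ t ∈ Finset.Icc 1 T,
            ((∫ ω, algLoss p x₀ y₀ d₀ T (1 / (T : ℝ) ^ 2) t (fun s => dem s ω) ∂P)
              - avgLoss p φ (bestLevel₁ p φ) z) ≤ C * √(T : ℝ) * (1 + Real.log T) := by
  have hD : 0 < p.D := hp.d_pos.trans hp.d_lt_D
  have hsum := hp.sum_pos
  have hh := hp.h₂_pos
  have hr := p.levelRange_pos b
  have hE := excessBound_nonneg hp b
  obtain ⟨K, hK0, hK⟩ := exists_epoch_bound hp b
  obtain ⟨N, hN'⟩ := exists_nat_ge (2 * levelBound p b x₀ / p.d)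
  have hN : 2 * levelBound p b x₀ ≤ p.d * N := by
    rw [div_le_iff₀ hp.d_pos] at hN'; linarith
  have hlb : 0 ≤ lossBound p b x₀ := by
    have h1 : 0 ≤ levelBound p b x₀ := by unfold levelBound; positivity
    unfold lossBound; positivity
  obtain ⟨A, hA⟩ : ∃ A, A = (p.h₁ + p.p₁ + 1) * K := ⟨_, rfl⟩
  have hA0 : 0 < A := by rw [hA]; positivity
  obtain ⟨B, hB⟩ : ∃ B, B = lossBound p b x₀ := ⟨_, rfl⟩
  obtain ⟨E, hE'⟩ : ∃ E, E = excessBound p b := ⟨_, rfl⟩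
  rw [← hB] at hlb
  rw [← hE'] at hE
  refine ⟨12 * A + E + B * (2 * (2 * N + 2)), by positivity, ?_⟩
  intro φ hφ z hz0 hzs hz Ω _ P _ dem hm hlaw hind y₀ hy d₀ T hT
  have hT' : (1 : ℝ) ≤ T := by exact_mod_cast hT
  have hlog : 0 ≤ Real.log T := Real.log_nonneg hT'
  obtain ⟨δ, hδ⟩ : ∃ δ : ℝ, δ = 1 / (T : ℝ) ^ 2 := ⟨_, rfl⟩
  have hδ0 : 0 < δ := by rw [hδ]; positivity
  -- The failure probability `δ` is at most `1 / T`, so failures cost `O(1)` in all.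
  have hδT : δ * T ≤ 1 := by
    rw [hδ, div_mul_eq_mul_div, div_le_one (by positivity)]; nlinarith
  have hℓ : Real.log (T / δ) = 3 * Real.log T := by
    rw [hδ, div_div_eq_mul_div, div_one, show (T : ℝ) * T ^ 2 = T ^ 3 by ring, Real.log_pow]
    norm_num
  rw [← hδ]
  have hterm : ∀ t ∈ Finset.Icc 1 T,
      (∫ ω, algLoss p x₀ y₀ d₀ T δ t (fun s => dem s ω) ∂P) - avgLoss p φ (bestLevel₁ p φ) z
      ≤ 2 * A * √(3 * Real.log T) * (1 / √t) + E * δ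
        + if t ∈ transientRounds N T then B else 0 := by
    intro t ht
    have ht1 := Finset.mem_Icc.1 ht
    have h0 : 0 ≤ 2 * A * √(3 * Real.log T) * (1 / √t) := by positivity
    have h1 : 0 ≤ E * δ := by positivity
    split_ifs with htr
    · have h2 := integral_mono_ae (integrable_algLoss (x₀ := x₀) (d₀ := d₀) (T := T) (δ := δ) hp
        hφ (hz0.trans hzs) hm hlaw hy ht1.1) (integrable_const B)
        ((ae_algLoss_mem_Icc hp hφ (hz0.trans hzs) hm hlaw hy ht1.1).mono fun ω hω =>
          hB ▸ hω.2)
      rw [integral_const, probReal_univ, one_smul] at h2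
      have h3 := avgLoss_nonneg (φ := φ) hp (bestLevel₁ p φ) z
      linarith
    · obtain ⟨k, i, hi, hik, rfl⟩ : ∃ k i, 2 * N ≤ i ∧ i + 2 < 2 ^ k ∧ t = 2 ^ k + i + 1 := by
        by_contra h
        exact htr (mem_transientRounds.2 ⟨ht1, h⟩)
      have hT2 : (2 : ℝ) ≤ T := by
        have := Nat.one_le_two_pow (n := k)
        have : 2 ≤ T := by omega
        exact_mod_cast this
      -- A steady round exists only if `T ≥ 2`, which makes `δ ≤ 1 / 4`.
      have hδ2 : δ ≤ 1 / 2 := by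
        rw [hδ]
        exact one_div_le_one_div_of_le two_pos (by nlinarith)
      have hepoch : epochOf (2 ^ k + i + 1) - 1 = k := by
        rw [add_assoc, epochOf_two_pow_add (by omega), Nat.add_sub_cancel]
      have hL := epochLength_epochOf (t := 2 ^ k + i + 1) (by
        have := Nat.one_le_two_pow (n := k); omega)
      rw [hepoch] at hL
      have h2 := integral_algLoss_le (x₀ := x₀) hp hφ hz0 hzs hm hlaw hind hy hN hi hik
        (mul_nonneg hK0.le (Real.sqrt_nonneg _))
        (hK φ hφ z hz0 hz _ T (epochLength_pos k) (hL.1.trans ht1.2) δ hδ0 hδ2 _ (hy k) d₀)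
      have h3 := sqrt_div_le_two_mul (ℓ := 3 * Real.log T) (by linarith) (epochLength_pos k)
        (t := 2 ^ k + i + 1) (by omega) hL.2
      rw [hℓ, ← mul_assoc, ← hA, ← hE'] at h2
      have h4 := mul_le_mul_of_nonneg_left h3 hA0.le
      rw [Real.sqrt_div (by linarith) (((2 ^ k + i + 1 : ℕ)) : ℝ)] at h4
      have e : A * (2 * (√(3 * Real.log T) / √((2 ^ k + i + 1 : ℕ) : ℝ)))
        = 2 * A * √(3 * Real.log T) * (1 / √((2 ^ k + i + 1 : ℕ) : ℝ)) := by ring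
      linarith
  refine (Finset.sum_le_sum hterm).trans ?_
  rw [Finset.sum_add_distrib, Finset.sum_add_distrib, ← Finset.mul_sum, Finset.sum_const,
    Nat.card_Icc, Nat.add_sub_cancel, nsmul_eq_mul, ← Finset.sum_filter, Finset.sum_const,
    nsmul_eq_mul]
  have hs1 : ∑ t ∈ Finset.Icc 1 T, 1 / √(t : ℝ) ≤ 2 * √T := by
    have h := Finset.sum_Ico_add' (fun t : ℕ => 1 / √(t : ℝ)) 0 T 1
    rw [← Finset.range_eq_Ico] at h
    have h2 := sum_inv_sqrt_le T
    push_cast at h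
    rw [h] at h2
    exact h2
  have hs2 : √(3 * Real.log T) ≤ 3 * (1 + Real.log T) := by
    refine (Real.sqrt_le_left (by linarith)).2 ?_
    nlinarith
  have hcard : (((Finset.Icc 1 T).filter (· ∈ transientRounds N T)).card : ℝ)
      ≤ 2 * (1 + Real.log T) * (2 * N + 2) := by
    have h1 : ((Finset.Icc 1 T).filter (· ∈ transientRounds N T)).card
        ≤ (Nat.log 2 T + 1) * (2 * N + 2) :=
      (Finset.card_le_card fun t ht => (Finset.mem_filter.1 ht).2).trans
        (card_transientRounds_le N T)
    have h2 : (((Finset.Icc 1 T).filter (· ∈ transientRounds N T)).card : ℝ)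
        ≤ (Nat.log 2 T + 1) * (2 * N + 2) := by exact_mod_cast h1
    refine h2.trans (mul_le_mul_of_nonneg_right ?_ (by positivity))
    linarith [natLog_two_le hT]
  have hsq : 1 ≤ √(T : ℝ) := Real.one_le_sqrt.2 hT'
  have hprod : 1 ≤ √(T : ℝ) * (1 + Real.log T) := by nlinarith
  have b1 : 2 * A * √(3 * Real.log T) * ∑ t ∈ Finset.Icc 1 T, 1 / √(t : ℝ)
      ≤ 2 * A * (3 * (1 + Real.log T)) * (2 * √T) := by gcongr
  have b2 : (T : ℝ) * (E * δ) ≤ E * (√(T : ℝ) * (1 + Real.log T)) := by nlinarith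
  have b3 : (((Finset.Icc 1 T).filter (· ∈ transientRounds N T)).card : ℝ) * B
      ≤ B * (2 * (2 * N + 2)) * (√(T : ℝ) * (1 + Real.log T)) := by
    have h1 := mul_le_mul_of_nonneg_right hcard hlb
    have h2 : 0 ≤ B * (2 * (2 * N + 2)) * (1 + Real.log T) := by positivity
    nlinarith
  linarith

end Regret

end TwoEchelon

open TwoEchelon in
theorem mainTheorem1 (p : TwoEchelon.Params) (hp : p.Valid) (b : ℝ)
    (n₀ : ℕ) (hn₀ : 0 < n₀) (x₀ : Fin n₀ → ℝ) :
    ∃ C : ℝ, 0 < C ∧ ∃ k : ℕ,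
      ∀ (α : ℝ) (_ : α ∈ Set.Icc (0 : ℝ) 1)
        (φ : ℝ → ℝ) (_ : TwoEchelon.IsDemandDensity p φ)
        (s₁ s₂ : ℝ) (_ : TwoEchelon.IsBestPolicy p α φ s₁ s₂)
        (Ω : Type*) [MeasurableSpace Ω] (P : MeasureTheory.Measure Ω)
        [MeasureTheory.IsProbabilityMeasure P]
        (dem : ℕ → Ω → ℝ) (_ : ∀ t, Measurable (dem t))
        (_ : ∀ t, P.map (dem t) = TwoEchelon.demandLaw φ)
        (_ : ProbabilityTheory.iIndepFun dem P)
        (y₀ : ℕ → ℝ) (_ : ∀ m, b ≤ y₀ m ∧ y₀ m ≤ p.sMax) (d₀ : ℝ),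
        (∀ T : ℕ, 2 ≤ T → (TwoEchelon.epochOf T : ℝ) ≤ C * Real.log T) ∧
        (∀ T : ℕ, 1 ≤ T → ∀ δ : ℝ, 0 < δ → δ < 1 →
          1 - 2 * δ ≤ P.real {ω |
            |TwoEchelon.level₁ p x₀ (fun t => dem t ω) (TwoEchelon.epochOf T) - s₁|
                ≤ C * √(Real.log (T / δ) / T) ∧
            |TwoEchelon.level₂ p T δ y₀ d₀ (fun t => dem t ω) (TwoEchelon.epochOf T) - s₂|
                ≤ C * ((T : ℝ) ^ (-(1 / 4) : ℝ) * Real.log (T / δ) ^ (1 / 4 : ℝ))}) ∧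
        (∀ T : ℕ, 1 ≤ T →
          MeasureTheory.Integrable (fun ω => TwoEchelon.regret p x₀ y₀ d₀ T (1 / (T : ℝ) ^ 2)
            (TwoEchelon.H p α φ s₁ s₂) (fun t => dem t ω)) P ∧
          ∫ ω, TwoEchelon.regret p x₀ y₀ d₀ T (1 / (T : ℝ) ^ 2)
              (TwoEchelon.H p α φ s₁ s₂) (fun t => dem t ω) ∂P
            ≤ C * √(T : ℝ) * (1 + Real.log T) ^ k) := by
  obtain ⟨A, hA0, hA⟩ := exists_level_bound hp b x₀
  obtain ⟨B, hB0, hB⟩ := exists_regret_bound hp b x₀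
  -- The summand `5` is for the number of epochs, which is at most `4 log T` for `T ≥ 2`.
  refine ⟨A + B + 5, by positivity, 1, ?_⟩
  intro α _ φ hφ s₁ s₂ hbest Ω _ P _ dem hm hlaw hind y₀ hy d₀
  obtain ⟨rfl, hs2⟩ := hbest.eq_and_nonneg hp hφ
  have hmin := fun x => hbest.isMin hp hφ (bestLevel₁ p φ) x
  have hle := le_sMax_of_isMin hp hφ (lossDeriv_eq_zero hp hφ hmin)
  refine ⟨fun T hT => ?_, fun T hT δ hδ hδ1 => ?_, fun T hT => ?_⟩
  · have h1 := natLog_two_le (T := T) (by omega)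
    have h2 := Real.log_le_log two_pos (show (2 : ℝ) ≤ T by exact_mod_cast hT)
    have h3 := Real.log_two_gt_d9
    rw [epochOf]
    push_cast
    nlinarith
  · rcases le_or_gt δ (1 / 2) with hδ2 | hδ2
    · have h := hA φ hφ s₂ hs2 hle hmin Ω P dem hm hlaw hind y₀ hy d₀ T hT δ hδ hδ2
      have hlog := half_le_log_div hT hδ hδ2
      refine le_trans (by linarith) (h.trans (MeasureTheory.measureReal_mono ?_))
      rintro ω ⟨g1, g2⟩
      have hAB : A ≤ A + B + 5 := by linarith
      refine ⟨g1.trans (mul_le_mul_of_nonneg_right hAB (Real.sqrt_nonneg _)),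
        g2.trans (mul_le_mul_of_nonneg_right hAB ?_)⟩
      exact mul_nonneg (by positivity) (Real.rpow_nonneg (by linarith) _)
    · -- For `δ > 1 / 2` the claimed probability is negative.
      exact le_trans (by linarith) MeasureTheory.measureReal_nonneg
  · have hint : ∀ t ∈ Finset.Icc 1 T, MeasureTheory.Integrable (fun ω =>
        algLoss p x₀ y₀ d₀ T (1 / (T : ℝ) ^ 2) t (fun s => dem s ω)
          - H p α φ (bestLevel₁ p φ) s₂) P := fun t ht =>
      (integrable_algLoss hp hφ (hs2.trans hle) hm hlaw hy (Finset.mem_Icc.1 ht).1).sub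
        (MeasureTheory.integrable_const _)
    refine ⟨MeasureTheory.integrable_finsetSum _ hint, ?_⟩
    refine (MeasureTheory.integral_finsetSum _ hint).trans_le ?_
    have h := hB φ hφ s₂ hs2 hle hmin Ω P dem hm hlaw hind y₀ hy d₀ T hT
    have hT' : (1 : ℝ) ≤ T := by exact_mod_cast hT
    have hlog := Real.log_nonneg hT'
    rw [pow_one]
    calc _ = _ := Finset.sum_congr rfl fun t ht => by
            rw [MeasureTheory.integral_sub (integrable_algLoss hp hφ (hs2.trans hle) hm hlaw hy
              (Finset.mem_Icc.1 ht).1) (MeasureTheory.integrable_const _),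
              MeasureTheory.integral_const, MeasureTheory.probReal_univ, one_smul,
              H_eq_integral hp hφ, ← avgLoss]
      _ ≤ _ := h
      _ ≤ _ := by gcongr; linarith
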